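/- **Conventions.** $\mathrm{Tri}^\otimes$ is the 2-category of symmetric monoidal triangulated categories (the tensor product is exact in each variable); 1-morphisms are strong symmetric monoidal triangulated functors, 2-morphisms are monoidal natural transformations commuting with the shifts. For a contravariant pseudofunctor $H:\mathcal D\to\mathrm{Tri}^\otimes$ write $f^*=H(f)$. A pseudonatural transformation $\alpha$ is a pseudonatural equivalence if every $\alpha(S)$ is an equivalence in $\mathrm{Tri}^\otimes$. Let $\mathcal P$ be a class of morphisms of $\mathcal D$. $H$ is *$\mathcal P$-premotivic* if: (B1) every $f^*$ has a right adjoint $f_*$; (B2) $f^*$ has a left adjoint $f_\sharp$ for $f\in\mathcal P$; (B3) for every Cartesian square $f g'=g f'$ with $f$ and its base change $f'$ in $\mathcal P$, the exchange transformation $f'_\sharp g'^*\to g^*f_\sharp$ is an isomorphism; (B4) for $f\in\mathcal P$ the exchange transformation $f_\sharp(K\otimes f^*L)\to f_\sharp K\otimes L$ is an isomorphism. A pseudonatural transformation $\alpha:H\to H'$ of $\mathcal P$-premotivic pseudofunctors is *$\mathcal P$-premotivic* if (C1) every functor $\alpha(S)$ has a right adjoint and (C2) for $f:X\to S$ in $\mathcal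 P$ the exchange transformation $f_\sharp\alpha(X)\to\alpha(S)f_\sharp$ is an isomorphism. A *category with immersions* is a category $\mathcal C$ with fiber products, an initial object and a final object, together with two classes of monomorphisms, the closed and the open immersions, both containing all isomorphisms and stable under composition and pullback, and a function assigning to each closed immersion $i:Z\to S$ an open immersion $j:U\to S$, its complement, such that: for every commutative square from a closed immersion $i_2:Z_2\to S_2$ to a closed immersion $i_1:Z_1\to S_1$, with complements $U_2$, $U_1$, the projection $U_1\times_{S_1}S_2\to S_2$ factors as an open immersion $U_1\times_{S_1}S_2\to U_2$ followed by $U_2\to S_2$, and this open immersion is an isomorphism if the square is Cartesian. For a category with specified closed immersions and complements, a premotivic pseudofunctor $H$ satisfies *(Loc)* if for every closed immersion $i:Z\to S$ with complement $j:U\to S$: $i_*$ is fully faithful, the pair $(i^*,j^*)$ is conservative, and $H(W)=0$ whenever $W$ is a fiber product of $i$ and $j$. **Setting.** Let $\mathcal C$ be a category with immersions, and let $\mathcal E\subset\mathcal C$ be a full subcategory such that every object of $\mathcal C$ admits a closed immersion into an object of $\mathcal E$, and such that for every open immersion $U\to S$ with $S\in\mathcal E$ also $U\in\mathcal E$; $\mathcal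 E$ has the induced closed and open immersions and complements. Let $\mathscr P$ be a class of morphisms of $\mathcal C$ containing all isomorphisms and all open immersions, stable under composition and pullback; let $\mathscr P'$ be the class of morphisms of $\mathcal E$ that lie in $\mathscr P$. Let $\widetilde{\mathcal C}$ be the category whose objects are the closed immersions $(Z\to S)$ of $\mathcal C$ with $S\in\mathcal E$, and whose morphisms $(Z_2\to S_2)\to(Z_1\to S_1)$ are the commutative squares. Let $U:\mathcal E\to\widetilde{\mathcal C}$ be the functor $S\mapsto(S\xrightarrow{\mathrm{id}}S)$. Let $\widetilde{\mathscr P}$ be the class of morphisms of $\widetilde{\mathcal C}$ given by Cartesian squares whose component $S_2\to S_1$ is in $\mathscr P$. For $X=(Z\xrightarrow{i}S)$ let $\rho_i:X\to U(S)$ be the morphism with components $i$ and $\mathrm{id}_S$. The closed immersions of $\widetilde{\mathcal C}$ are the morphisms isomorphic to some $\rho_i$, the open immersions are the morphisms isomorphic to $U(j)$ for an open immersion $j$ of $\mathcal E$, and the complement of $\rho_i$ is $U(j)$, where $j$ is the complement of $i$. **Theorem.** (1) Let $V:\mathcal E\to\mathrm{Tri}^\otimes$ be a $\mathscr P'$-premotivic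 pseudofunctor satisfying (Loc). Then there are a $\widetilde{\mathscr P}$-premotivic pseudofunctor $G:\widetilde{\mathcal C}\to\mathrm{Tri}^\otimes$ satisfying (Loc) and a pseudonatural equivalence $\delta:V\to G\circ U$ such that for every object $(Z\xrightarrow{i}S)$ of $\widetilde{\mathcal C}$ the underlying category of $G(Z\to S)$ is the full subcategory of $V(S)$ of the objects $K$ with $j^*K=0$, where $j$ is the complement of $i$, and the inclusion $G(Z\to S)\to V(S)$ is right adjoint to $\rho_i^*\circ\delta(S)$. (2) Let $V,V':\mathcal E\to\mathrm{Tri}^\otimes$ be $\mathscr P'$-premotivic and $G,G':\widetilde{\mathcal C}\to\mathrm{Tri}^\otimes$ be $\widetilde{\mathscr P}$-premotivic pseudofunctors, all satisfying (Loc), let $\delta:V\to G\circ U$ and $\delta':V'\to G'\circ U$ be pseudonatural equivalences, and let $\epsilon:V\to V'$ be a $\mathscr P'$-premotivic pseudonatural transformation. Then there is a $\widetilde{\mathscr P}$-premotivic pseudonatural transformation $\beta:G\to G'$ such that $(\beta\circ U)\,\delta\cong\delta'\,\epsilon$ (an invertible modification), and any two such $\beta$ are isomorphic (by an invertible modification).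 -/

import Mathlib

open CategoryTheory CategoryTheory.Limits
open scoped Pseudofunctor.StrongTrans

universe v u v₁ u₁ v₂ u₂

noncomputable section

/-! ### The 2-category of symmetric monoidal triangulated categories -/

/-- A symmetric monoidal triangulated category: a triangulated category (with the octahedral
axiom) with a symmetric monoidal structure whose tensor product is exact in each variable. (By
the symmetry, exactness in the second variable gives exactness in the first one.) -/
structure TensorTriCat where
  carrier : Type u
  [category : Category.{v} carrier]
  [preadditive : Preadditive carrier]
  [hasZeroObject : HasZeroObject carrier]
  [hasShift : HasShift carrier ℤ]
  [shiftAdditive : ∀ n : ℤ, (shiftFunctor carrier n).Additive]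
  [pretriangulated : Pretriangulated carrier]
  [triangulated : IsTriangulated carrier]
  [monoidal : MonoidalCategory carrier]
  [symmetric : SymmetricCategory carrier]
  exact_tensor : ∀ K : carrier,
    ∃ _ : (MonoidalCategory.tensorLeft K).CommShift ℤ, (MonoidalCategory.tensorLeft K).IsTriangulated

namespace TensorTriCat

instance : CoeSort TensorTriCat.{v, u} (Type u) := ⟨carrier⟩

attribute [instance] category preadditive hasZeroObject hasShift shiftAdditive pretriangulated
  triangulated monoidal symmetric

/-- 1-morphisms: (strong) symmetric monoidal triangulated functors. -/
structure Hom (A B : TensorTriCat.{v, u}) where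
  functor : A.carrier ⥤ B.carrier
  [braided : functor.Braided]
  [commShift : functor.CommShift ℤ]
  [isTriangulated : functor.IsTriangulated]

attribute [instance] Hom.braided Hom.commShift Hom.isTriangulated

/-- 2-morphisms: natural transformations which are monoidal and commute with the shifts. -/
@[ext]
structure Hom₂ {A B : TensorTriCat.{v, u}} (F G : Hom A B) where
  natTrans : F.functor ⟶ G.functor
  [isMonoidal : natTrans.IsMonoidal]
  [commShift : NatTrans.CommShift natTrans ℤ]

attribute [instance] Hom₂.isMonoidal Hom₂.commShift

instance (A B : TensorTriCat.{v, u}) : Category (Hom A B) where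
  Hom F G := Hom₂ F G
  id F := { natTrans := 𝟙 F.functor }
  comp a b := { natTrans := a.natTrans ≫ b.natTrans }
  id_comp _ := Hom₂.ext (Category.id_comp _)
  comp_id _ := Hom₂.ext (Category.comp_id _)
  assoc _ _ _ := Hom₂.ext (Category.assoc _ _ _)

@[ext]
lemma hom₂_ext {A B : TensorTriCat.{v, u}} {F G : Hom A B} {a b : F ⟶ G}
    (h : a.natTrans = b.natTrans) : a = b :=
  Hom₂.ext h

@[simp]
lemma natTrans_id {A B : TensorTriCat.{v, u}} (F : Hom A B) :
    Hom₂.natTrans (𝟙 F) = 𝟙 F.functor := rfl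

@[simp]
lemma natTrans_comp {A B : TensorTriCat.{v, u}} {F G H : Hom A B} (a : F ⟶ G) (b : G ⟶ H) :
    Hom₂.natTrans (a ≫ b) = a.natTrans ≫ b.natTrans := rfl

lemma ext_app {A B : TensorTriCat.{v, u}} {F G : Hom A B} {a b : F ⟶ G}
    (h : ∀ X, a.natTrans.app X = b.natTrans.app X) : a = b :=
  Hom₂.ext (NatTrans.ext (funext h))

/-- An isomorphism of functors that is monoidal and commutes with the shifts is an invertible
2-morphism. -/
@[simps]
def isoMk {A B : TensorTriCat.{v, u}} {F G : Hom A B} (e : F.functor ≅ G.functor)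
    [NatTrans.IsMonoidal e.hom] [NatTrans.CommShift e.hom ℤ] : F ≅ G where
  hom := { natTrans := e.hom }
  inv := { natTrans := e.inv }

instance : CategoryStruct TensorTriCat.{v, u} where
  Hom A B := Hom A B
  id A := { functor := 𝟭 A.carrier }
  comp F G := { functor := F.functor ⋙ G.functor }

instance : Bicategory TensorTriCat.{v, u} where
  homCategory A B := inferInstanceAs (Category (Hom A B))
  whiskerLeft F _ _ a := { natTrans := Functor.whiskerLeft F.functor a.natTrans }
  whiskerRight a H := { natTrans := Functor.whiskerRight a.natTrans H.functor }
  associator F G H := isoMk (Functor.associator F.functor G.functor H.functor)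
  leftUnitor F :=
    haveI : NatTrans.IsMonoidal F.functor.leftUnitor.hom := inferInstance
    isoMk F.functor.leftUnitor
  rightUnitor F := isoMk F.functor.rightUnitor
  whiskerLeft_id _ _ := ext_app fun _ ↦ rfl
  whiskerLeft_comp _ _ _ _ _ _ := ext_app fun _ ↦ rfl
  id_whiskerLeft a := ext_app fun X ↦
    (by simp : a.natTrans.app X = 𝟙 _ ≫ a.natTrans.app X ≫ 𝟙 _)
  comp_whiskerLeft F G _ _ a := ext_app fun X ↦
    (by simp : a.natTrans.app (G.functor.obj (F.functor.obj X)) = 𝟙 _ ≫ a.natTrans.app _ ≫ 𝟙 _)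
  id_whiskerRight _ G := ext_app fun _ ↦ G.functor.map_id _
  comp_whiskerRight _ _ H := ext_app fun _ ↦ H.functor.map_comp _ _
  whiskerRight_id a := ext_app fun X ↦
    (by simp : a.natTrans.app X = 𝟙 _ ≫ a.natTrans.app X ≫ 𝟙 _)
  whiskerRight_comp a G H := ext_app fun X ↦
    (by simp : H.functor.map (G.functor.map (a.natTrans.app X)) =
      𝟙 _ ≫ H.functor.map (G.functor.map (a.natTrans.app X)) ≫ 𝟙 _)
  whisker_assoc F _ _ a H := ext_app fun X ↦
    (by simp : H.functor.map (a.natTrans.app (F.functor.obj X)) =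
      𝟙 _ ≫ H.functor.map (a.natTrans.app (F.functor.obj X)) ≫ 𝟙 _)
  whisker_exchange a b := ext_app fun X ↦ (b.natTrans.naturality (a.natTrans.app X)).symm
  pentagon F G H K := ext_app fun X ↦
    (by simp : K.functor.map (𝟙 (H.functor.obj (G.functor.obj (F.functor.obj X)))) ≫
      𝟙 _ ≫ 𝟙 _ = 𝟙 _ ≫ 𝟙 _)
  triangle F G := ext_app fun X ↦
    (by simp : 𝟙 (G.functor.obj (F.functor.obj X)) ≫ 𝟙 _ = G.functor.map (𝟙 (F.functor.obj X)))

end TensorTriCat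

/-! ### Contravariant pseudofunctors with values in symmetric monoidal triangulated categories -/

/-- Contravariant pseudofunctors from a category `D` to `TensorTriCat`. -/
abbrev TriPseudofunctor (D : Type u₁) [Category.{v₁} D] :=
  Pseudofunctor (LocallyDiscrete Dᵒᵖ) TensorTriCat.{v, u}

namespace TriPseudofunctor

variable {D : Type u₁} [Category.{v₁} D] {D' : Type u₂} [Category.{v₂} D']

/-- The value of a pseudofunctor at an object. -/
abbrev at' (H : TriPseudofunctor.{v, u} D) (S : D) : TensorTriCat.{v, u} :=
  H.obj ⟨Opposite.op S⟩

/-- The functor `f^* : H(S) ⥤ H(X)` for `f : X ⟶ S`. -/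
abbrev star (H : TriPseudofunctor.{v, u} D) {X S : D} (f : X ⟶ S) :
    (H.at' S).carrier ⥤ (H.at' X).carrier :=
  (H.map f.op.toLoc).functor

/-- The isomorphism `g'^* f^* ≅ f'^* g^*` for a commutative square `g' ≫ f = f' ≫ g`. -/
def squareIso (H : TriPseudofunctor.{v, u} D) {X' X S' S : D} {g' : X' ⟶ X} {f' : X' ⟶ S'}
    {f : X ⟶ S} {g : S' ⟶ S} (sq : CommSq g' f' f g) :
    H.map f.op.toLoc ≫ H.map g'.op.toLoc ≅ H.map g.op.toLoc ≫ H.map f'.op.toLoc :=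
  H.isoMapOfCommSq sq.flip.op.toLoc

/-- The exchange transformation `f'_♯ g'^* ⟶ g^* f_♯` at `K`:
`f'_♯ g'^* K ⟶ f'_♯ g'^* f^* f_♯ K ≅ f'_♯ f'^* g^* f_♯ K ⟶ g^* f_♯ K`. -/
def exchangeBase (H : TriPseudofunctor.{v, u} D) {X' X S' S : D} {g' : X' ⟶ X} {f' : X' ⟶ S'}
    {f : X ⟶ S} {g : S' ⟶ S} (sq : CommSq g' f' f g)
    {fs : (H.at' X).carrier ⥤ (H.at' S).carrier} (adj : fs ⊣ H.star f)
    {fs' : (H.at' X').carrier ⥤ (H.at' S').carrier} (adj' : fs' ⊣ H.star f')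
    (K : (H.at' X).carrier) :
    fs'.obj ((H.star g').obj K) ⟶ (H.star g).obj (fs.obj K) :=
  fs'.map ((H.star g').map (adj.unit.app K)) ≫
    fs'.map ((H.squareIso sq).hom.natTrans.app (fs.obj K)) ≫
    adj'.counit.app ((H.star g).obj (fs.obj K))

open scoped MonoidalCategory in
/-- The exchange transformation `f_♯ (K ⊗ f^* L) ⟶ f_♯ K ⊗ L`:
`f_♯ (K ⊗ f^* L) ⟶ f_♯ (f^* f_♯ K ⊗ f^* L) ≅ f_♯ f^* (f_♯ K ⊗ L) ⟶ f_♯ K ⊗ L`. -/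
def exchangeTensor (H : TriPseudofunctor.{v, u} D) {X S : D} {f : X ⟶ S}
    {fs : (H.at' X).carrier ⥤ (H.at' S).carrier} (adj : fs ⊣ H.star f)
    (K : (H.at' X).carrier) (L : (H.at' S).carrier) :
    fs.obj (K ⊗ (H.star f).obj L) ⟶ fs.obj K ⊗ L :=
  fs.map (adj.unit.app K ▷ (H.star f).obj L) ≫
    fs.map (Functor.LaxMonoidal.μ (H.star f) (fs.obj K) L) ≫
    adj.counit.app (fs.obj K ⊗ L)

/-- `H` is `P`-premotivic. The conditions are stated for all choices of the left adjoints `f_♯`;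
they do not depend on the choice, and (B-2) says that `f_♯` exists. In (B-3) the square is Cartesian with `f` in `P`; its base change `f'`
is required to be in `P` too, which is automatic when `P` is stable under pullbacks. -/
structure IsPremotivic (P : MorphismProperty D) (H : TriPseudofunctor.{v, u} D) : Prop where
  /-- (B-1) `f^*` has a right adjoint `f_*`. -/
  b1 : ∀ {X S : D} (f : X ⟶ S), (H.star f).IsLeftAdjoint
  /-- (B-2) for `f` in `P`, `f^*` has a left adjoint `f_♯`. -/
  b2 : ∀ {X S : D} (f : X ⟶ S), P f → (H.star f).IsRightAdjoint
  /-- (B-3) base change. -/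
  b3 : ∀ {X' X S' S : D} {g' : X' ⟶ X} {f' : X' ⟶ S'} {f : X ⟶ S} {g : S' ⟶ S}
    (sq : IsPullback g' f' f g), P f → P f' →
    ∀ {fs : (H.at' X).carrier ⥤ (H.at' S).carrier} (adj : fs ⊣ H.star f)
      {fs' : (H.at' X').carrier ⥤ (H.at' S').carrier} (adj' : fs' ⊣ H.star f')
      (K : (H.at' X).carrier), IsIso (H.exchangeBase sq.toCommSq adj adj' K)
  /-- (B-4) projection formula. -/
  b4 : ∀ {X S : D} (f : X ⟶ S), P f →
    ∀ {fs : (H.at' X).carrier ⥤ (H.at' S).carrier} (adj : fs ⊣ H.star f)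
      (K : (H.at' X).carrier) (L : (H.at' S).carrier), IsIso (H.exchangeTensor adj K L)

/-- The exchange transformation `f_♯ α(X) ⟶ α(S) f_♯` at `K`:
`f_♯ α(X) K ⟶ f_♯ α(X) f^* f_♯ K ≅ f_♯ f^* α(S) f_♯ K ⟶ α(S) f_♯ K`. -/
def exchangeTrans {H H' : TriPseudofunctor.{v, u} D} (α : H ⟶ H') {X S : D} {f : X ⟶ S}
    {fs : (H.at' X).carrier ⥤ (H.at' S).carrier} (adj : fs ⊣ H.star f)
    {fs' : (H'.at' X).carrier ⥤ (H'.at' S).carrier} (adj' : fs' ⊣ H'.star f)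
    (K : (H.at' X).carrier) :
    fs'.obj ((α.app ⟨Opposite.op X⟩).functor.obj K) ⟶
      (α.app ⟨Opposite.op S⟩).functor.obj (fs.obj K) :=
  fs'.map ((α.app ⟨Opposite.op X⟩).functor.map (adj.unit.app K)) ≫
    fs'.map ((α.naturality f.op.toLoc).hom.natTrans.app (fs.obj K)) ≫
    adj'.counit.app ((α.app ⟨Opposite.op S⟩).functor.obj (fs.obj K))

/-- A pseudonatural transformation is `P`-premotivic. -/
structure IsPremotivicTrans (P : MorphismProperty D) {H H' : TriPseudofunctor.{v, u} D}
    (α : H ⟶ H') : Prop where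
  /-- (C-1) `α(S)` has a right adjoint. -/
  c1 : ∀ S : D, (α.app ⟨Opposite.op S⟩).functor.IsLeftAdjoint
  /-- (C-2) `α` commutes with `f_♯` for `f` in `P`. -/
  c2 : ∀ {X S : D} (f : X ⟶ S), P f →
    ∀ {fs : (H.at' X).carrier ⥤ (H.at' S).carrier} (adj : fs ⊣ H.star f)
      {fs' : (H'.at' X).carrier ⥤ (H'.at' S).carrier} (adj' : fs' ⊣ H'.star f)
      (K : (H.at' X).carrier), IsIso (exchangeTrans α adj adj' K)

/-- A pseudonatural transformation is a pseudonatural equivalence if all `α(S)` are equivalences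
in the 2-category `TensorTriCat`. -/
def IsPseudonaturalEquivalence {H H' : TriPseudofunctor.{v, u} D} (α : H ⟶ H') : Prop :=
  ∀ S : D, ∃ e : Bicategory.Equivalence (H.at' S) (H'.at' S), e.hom = α.app ⟨Opposite.op S⟩

/-- The composition `H ∘ F` of a pseudofunctor with a functor. -/
abbrev precomp (F : D ⥤ D') (H : TriPseudofunctor.{v, u} D') : TriPseudofunctor.{v, u} D :=
  F.op.toPseudofunctor.comp H

open scoped Bicategory in
/-- The pseudonatural transformation `H ∘ F ⟶ H' ∘ F` induced by `β : H ⟶ H'`. -/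
def precompTrans (F : D ⥤ D') {H H' : TriPseudofunctor.{v, u} D'} (β : H ⟶ H') :
    precomp F H ⟶ precomp F H' where
  app S := β.app (F.op.toPseudofunctor.obj S)
  naturality f := β.naturality (F.op.toPseudofunctor.map f)
  naturality_naturality η := β.naturality_naturality (F.op.toPseudofunctor.map₂ η)
  naturality_id S := by
    let Φ := F.op.toPseudofunctor
    have h := β.naturality_naturality (Φ.mapId S).hom
    have key : (β.naturality (Φ.map (𝟙 S))).hom ≫
        β.app (Φ.obj S) ◁ (H'.map₂ (Φ.mapId S).hom ≫ (H'.mapId (Φ.obj S)).hom) =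
        (H.map₂ (Φ.mapId S).hom ≫ (H.mapId (Φ.obj S)).hom) ▷ β.app (Φ.obj S) ≫
          (λ_ (β.app (Φ.obj S))).hom ≫ (ρ_ (β.app (Φ.obj S))).inv := by
      rw [Bicategory.whiskerLeft_comp, ← reassoc_of% h, β.naturality_id,
        Bicategory.comp_whiskerRight, Category.assoc]
    exact key
  naturality_comp {a b c} f g := by
    let Φ := F.op.toPseudofunctor
    have h := β.naturality_naturality (Φ.mapComp f g).hom
    have key : (β.naturality (Φ.map (f ≫ g))).hom ≫
        β.app (Φ.obj a) ◁ (H'.map₂ (Φ.mapComp f g).hom ≫ (H'.mapComp (Φ.map f) (Φ.map g)).hom) =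
        (H.map₂ (Φ.mapComp f g).hom ≫ (H.mapComp (Φ.map f) (Φ.map g)).hom) ▷ β.app (Φ.obj c) ≫
          (α_ _ _ _).hom ≫ H.map (Φ.map f) ◁ (β.naturality (Φ.map g)).hom ≫
          (α_ _ _ _).inv ≫ (β.naturality (Φ.map f)).hom ▷ H'.map (Φ.map g) ≫
          (α_ _ _ _).hom := by
      rw [Bicategory.whiskerLeft_comp, ← reassoc_of% h, β.naturality_comp,
        Bicategory.comp_whiskerRight, Category.assoc]
    exact key

end TriPseudofunctor

/-! ### Categories with immersions -/

/-- Classes of closed and open immersions in a category, and a function assigning to every closed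
immersion with target `S` an open immersion with target `S`, its complement. -/
structure ImmersionData (C : Type u₁) [Category.{v₁} C] where
  closed : MorphismProperty C
  opn : MorphismProperty C
  compl : ∀ {Z S : C} (i : Z ⟶ S), closed i → Over S
  opn_compl : ∀ {Z S : C} (i : Z ⟶ S) (hi : closed i), opn (compl i hi).hom

namespace ImmersionData

variable {C : Type u₁} [Category.{v₁} C]

/-- The axioms of a category with immersions. -/
structure IsCategoryWithImmersions (I : ImmersionData C) : Prop where
  hasPullbacks : HasPullbacks C
  hasInitial : HasInitial C
  hasTerminal : HasTerminal C
  closed_mono : I.closed ≤ MorphismProperty.monomorphisms C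
  opn_mono : I.opn ≤ MorphismProperty.monomorphisms C
  iso_closed : MorphismProperty.isomorphisms C ≤ I.closed
  iso_opn : MorphismProperty.isomorphisms C ≤ I.opn
  closed_comp : I.closed.IsStableUnderComposition
  opn_comp : I.opn.IsStableUnderComposition
  closed_baseChange : I.closed.IsStableUnderBaseChange
  opn_baseChange : I.opn.IsStableUnderBaseChange
  /-- For a commutative square from `i₂ : Z₂ ⟶ S₂` to `i₁ : Z₁ ⟶ S₁` of closed immersions, the
  projection `q : U₁ ×_{S₁} S₂ ⟶ S₂` factors through the complement of `i₂` by an open immersion,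
  which is an isomorphism if the square is Cartesian. -/
  complement : ∀ {Z₁ S₁ Z₂ S₂ : C} {i₂ : Z₂ ⟶ S₂} {v₁ : Z₂ ⟶ Z₁} {u₁ : S₂ ⟶ S₁} {i₁ : Z₁ ⟶ S₁}
    (_ : CommSq i₂ v₁ u₁ i₁) (h₁ : I.closed i₁) (h₂ : I.closed i₂)
    {T : C} {p : T ⟶ (I.compl i₁ h₁).left} {q : T ⟶ S₂}
    (_ : IsPullback p q (I.compl i₁ h₁).hom u₁),
    ∃ j₂' : T ⟶ (I.compl i₂ h₂).left, I.opn j₂' ∧ j₂' ≫ (I.compl i₂ h₂).hom = q ∧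
      (IsPullback i₂ v₁ u₁ i₁ → IsIso j₂')

/-- The localization property (Loc) of a (premotivic) pseudofunctor. It refers only to the closed
immersions and their complements. -/
structure SatisfiesLoc (I : ImmersionData C) (H : TriPseudofunctor.{v, u} C) : Prop where
  /-- `H(W) = 0` for the fiber product `W` of a closed immersion and its complement. -/
  zero : ∀ {W Z S : C} (i : Z ⟶ S) (hi : I.closed i) {i' : W ⟶ (I.compl i hi).left}
    {j' : W ⟶ Z}, IsPullback i' j' (I.compl i hi).hom i → ∀ K : (H.at' W).carrier, IsZero K
  /-- `i_*` is fully faithful. -/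
  fullyFaithful : ∀ {Z S : C} (i : Z ⟶ S), I.closed i →
    ∃ (R : (H.at' Z).carrier ⥤ (H.at' S).carrier) (_ : H.star i ⊣ R), R.Full ∧ R.Faithful
  /-- The pair `(i^*, j^*)` is conservative. -/
  conservative : ∀ {Z S : C} (i : Z ⟶ S) (hi : I.closed i) {K L : (H.at' S).carrier}
    (a : K ⟶ L), IsIso ((H.star i).map a) → IsIso ((H.star (I.compl i hi).hom).map a) → IsIso a

/-! ### The full subcategory `ℰ` and the category `C̃` -/

/-- The conditions on the full subcategory `ℰ` of `C` given by the property `e` of objects. -/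
structure IsBase (I : ImmersionData C) (e : ObjectProperty C) : Prop where
  exists_closed : ∀ Z : C, ∃ (S : C) (i : Z ⟶ S), e S ∧ I.closed i
  of_opn : ∀ {U S : C} (j : U ⟶ S), I.opn j → e S → e U

variable (I : ImmersionData C) (e : ObjectProperty C)

/-- An open immersion of `C` with target in `ℰ`, as a morphism of `ℰ`. -/
def liftOver (hE : I.IsBase e) (S : e.FullSubcategory) (j : Over S.obj) (hj : I.opn j.hom) :
    Over S :=
  Over.mk (Y := (⟨j.left, hE.of_opn j.hom hj S.property⟩ : e.FullSubcategory))
    (ObjectProperty.homMk j.hom)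

/-- The immersions of `ℰ`. -/
def restrict (hE : I.IsBase e) : ImmersionData e.FullSubcategory where
  closed := I.closed.inverseImage e.ι
  opn := I.opn.inverseImage e.ι
  compl {_ S} i hi := I.liftOver e hE S (I.compl (e.ι.map i) hi) (I.opn_compl _ hi)
  opn_compl i hi := I.opn_compl (e.ι.map i) hi

/-- The category `C̃` of closed immersions `Z ⟶ S` of `C` with `S` in `ℰ`; the morphisms are the
commutative squares. -/
abbrev Pairs : Type (max u₁ v₁) :=
  ObjectProperty.FullSubcategory (C := Arrow C) (fun f ↦ I.closed f.hom ∧ e f.right)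

variable {I e}

namespace Pairs

/-- The object `S` of `ℰ` for an object `Z ⟶ S` of `C̃`. -/
def target (X : I.Pairs e) : e.FullSubcategory := ⟨X.obj.right, X.property.2⟩

/-- The complement `j : U ⟶ S` of `Z ⟶ S`, which lies in `ℰ`. -/
def complement (hE : I.IsBase e) (X : I.Pairs e) : Over X.target :=
  I.liftOver e hE X.target (I.compl X.obj.hom X.property.1) (I.opn_compl _ _)

/-- The functor `U : ℰ ⥤ C̃` sending `S` to `id : S ⟶ S`. -/
def ofBase (hI : I.IsCategoryWithImmersions) : e.FullSubcategory ⥤ I.Pairs e where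
  obj S := ⟨Arrow.mk (𝟙 S.obj), hI.iso_closed _ (inferInstanceAs (IsIso (𝟙 S.obj))), S.property⟩
  map u := ObjectProperty.homMk (Arrow.homMk u.hom u.hom (by simp))

/-- The canonical morphism from `Z ⟶ S` to `id : S ⟶ S` in `C̃`, with components `Z ⟶ S` and
`id : S ⟶ S`. -/
def rho (hI : I.IsCategoryWithImmersions) (X : I.Pairs e) : X ⟶ (ofBase hI).obj X.target :=
  ObjectProperty.homMk (Arrow.homMk (g := Arrow.mk (𝟙 X.obj.right)) X.obj.hom (𝟙 X.obj.right)
    (by simp))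

/-- The immersions of `C̃`: the closed immersions are the morphisms isomorphic to the canonical
morphism from some `Z ⟶ S` to `id : S ⟶ S`; the open immersions are the morphisms isomorphic to
`U(j)` for an open immersion `j` of `ℰ`; the complement of the canonical morphism is (up to
isomorphism over its target) `U(j)`, with `j` the complement of `Z ⟶ S`. -/
def immersions (hI : I.IsCategoryWithImmersions) (hE : I.IsBase e) :
    ImmersionData (I.Pairs e) where
  closed _ _ f := ∃ X : I.Pairs e, Nonempty (Arrow.mk f ≅ Arrow.mk (rho hI X))
  opn _ _ f := ∃ (U S : e.FullSubcategory) (j : U ⟶ S), (I.restrict e hE).opn j ∧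
    Nonempty (Arrow.mk f ≅ Arrow.mk ((ofBase hI).map j))
  compl _ hf := Over.mk ((ofBase hI).map (complement hE hf.choose).hom ≫
    (hf.choose_spec.some.inv).right)
  opn_compl _ hf := ⟨_, _, (complement hE hf.choose).hom, I.opn_compl _ _,
    ⟨Arrow.isoMk (Iso.refl _)
      ((Arrow.rightFunc.mapIso hf.choose_spec.some : _ ≅ (ofBase hI).obj hf.choose.target))
      (by
        have h : (hf.choose_spec.some.inv).right ≫ (hf.choose_spec.some.hom).right = 𝟙 _ :=
          congrArg Arrow.Hom.right hf.choose_spec.some.inv_hom_id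
        change 𝟙 _ ≫ _ = (_ ≫ _) ≫ (hf.choose_spec.some.hom).right
        rw [Category.id_comp, Category.assoc, h]
        exact (Category.comp_id _).symm)⟩⟩

/-- The class `P̃`: the Cartesian squares whose right vertical morphism `S₂ ⟶ S₁` is in `P`. -/
def tilde (P : MorphismProperty C) : MorphismProperty (I.Pairs e) := fun X₂ X₁ f ↦
  IsPullback X₂.obj.hom f.hom.left f.hom.right X₁.obj.hom ∧ P f.hom.right

end Pairs

end ImmersionData

end

/-! For X = (Z → S) with complement j : U → S, the category G(X) is the localization of V(S) whose
local objects are the K with j^*K = 0. Since j is a monomorphism in `P`, base change along its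
trivial kernel pair gives j^* j_♯ ≅ id. Hence the cone of j_♯ j^* K → K is killed by j^* and
reflects K into the kernel of j^* (`exists_reflection`). The objects annihilated by this reflection
("acyclic") are exactly those induced from U, that is K ≅ j_♯ j^* K. By the projection formula they
form a tensor ideal, so the localization is again symmetric monoidal and triangulated
(`exists_kernel_localization`).

For f : X₂ → X₁ the base change of U₁ factors through U₂, so f^* sends induced objects to acyclic
ones and descends to the localizations (`isZero_star_of_isZero`). 1-morphisms inverting what a
reflector inverts factor through it, and 2-morphisms lift uniquely. Pseudofunctoriality of G, the
localization transformation from V on targets to G, and later the coherence of β are therefore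
automatic. If f is Cartesian, f^* also preserves local objects, so the localization transformation
carries the universal arrows K → f^* f_♯ K to universal arrows. The premotivic axioms pass to G in
this way (`IsPremotivic.of_reflective`). For Z = S, (Loc) makes V(U) zero, so the localization is an
equivalence there; this gives δ. An object of the extension killed by both ρ^* and j^* is induced
from zero, which is the conservativity in (Loc).

For the second part, consider ρ^* δ on V(S) for arbitrary G, δ. It is an equivalence followed by a
reflector, and by base change and conservativity it annihilates exactly the objects induced from U.
A premotivic transformation preserves induced objects, so ρ^* δ' ε factors through ρ^* δ, and the
factorizations form β (`descent`). Conversely β composed with ρ^* δ depends only on the restriction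
of β to the base, and pointwise reflectors can be cancelled (`cancelIso`).

All statements about left adjoints f_♯ are phrased by universal arrows K → f^* T, which avoids
choosing adjoints. -/

noncomputable section

/-! ### Universal arrows -/

section UniversalArrows

universe w₁ w₂ w₃ w₄ x₁ x₂ x₃ x₄

variable {A : Type x₁} [Category.{w₁} A] {B : Type x₂} [Category.{w₂} B]
  {A' : Type x₃} [Category.{w₃} A'] {B' : Type x₄} [Category.{w₄} B']

/-- An arrow `η : K ⟶ G T` is universal if every arrow `K ⟶ G M` factors uniquely through it. -/
def IsUniversalArrow (G : B ⥤ A) {K : A} {T : B} (η : K ⟶ G.obj T) : Prop :=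
  ∀ M : B, Function.Bijective (fun g : T ⟶ M ↦ η ≫ G.map g)

namespace IsUniversalArrow

lemma unit {F : A ⥤ B} {G : B ⥤ A} (adj : F ⊣ G) (K : A) :
    IsUniversalArrow G (adj.unit.app K) := fun M ↦ by
  have : (fun g : F.obj K ⟶ M ↦ adj.unit.app K ≫ G.map g) = adj.homEquiv K M :=
    funext fun g ↦ (adj.homEquiv_unit (f := g)).symm
  rw [this]
  exact (adj.homEquiv K M).bijective

variable {G : B ⥤ A} {K : A} {T : B} {η : K ⟶ G.obj T}

lemma hom_ext (h : IsUniversalArrow G η) {M : B} {a b : T ⟶ M}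
    (hab : η ≫ G.map a = η ≫ G.map b) : a = b :=
  (h M).1 hab

lemma exists_lift (h : IsUniversalArrow G η) {M : B} (a : K ⟶ G.obj M) :
    ∃ g : T ⟶ M, η ≫ G.map g = a :=
  (h M).2 a

lemma exists_iso (h : IsUniversalArrow G η) {T' : B} {η' : K ⟶ G.obj T'}
    (h' : IsUniversalArrow G η') : ∃ e : T ≅ T', η ≫ G.map e.hom = η' := by
  obtain ⟨a, ha⟩ := h.exists_lift η'
  obtain ⟨b, hb⟩ := h'.exists_lift η
  refine ⟨⟨a, b, h.hom_ext ?_, h'.hom_ext ?_⟩, ha⟩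
  · simp [reassoc_of% ha, hb]
  · simp [reassoc_of% hb, ha]

lemma comp_map_iso (h : IsUniversalArrow G η) {T' : B} (e : T ⟶ T') [IsIso e] :
    IsUniversalArrow G (η ≫ G.map e) := fun M ↦ by
  have : (fun g : T' ⟶ M ↦ (η ≫ G.map e) ≫ G.map g) =
      (fun g : T ⟶ M ↦ η ≫ G.map g) ∘ (fun g : T' ⟶ M ↦ e ≫ g) := by
    ext g
    simp
  rw [this]
  exact (h M).comp ⟨fun a b hab ↦ (cancel_epi e).1 hab, fun a ↦ ⟨inv e ≫ a, by simp⟩⟩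

lemma iso_comp (h : IsUniversalArrow G η) {K' : A} (e : K' ⟶ K) [IsIso e] :
    IsUniversalArrow G (e ≫ η) := fun M ↦ by
  have : (fun g : T ⟶ M ↦ (e ≫ η) ≫ G.map g) =
      (fun a : K ⟶ G.obj M ↦ e ≫ a) ∘ (fun g : T ⟶ M ↦ η ≫ G.map g) := by
    ext g
    simp
  rw [this]
  exact Function.Bijective.comp ⟨fun a b hab ↦ (cancel_epi e).1 hab,
    fun a ↦ ⟨inv e ≫ a, by simp⟩⟩ (h M)

lemma of_iso_comp {K' : A} (e : K' ⟶ K) [IsIso e]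
    (h : IsUniversalArrow G (e ≫ η)) : IsUniversalArrow G η := by
  simpa using h.iso_comp (inv e)

lemma of_comp_map_iso {T' : B} (e : T ⟶ T') [IsIso e]
    (h : IsUniversalArrow G (η ≫ G.map e)) : IsUniversalArrow G η := by
  simpa [← Functor.map_comp] using h.comp_map_iso (inv e)

lemma of_isIso [G.Full] [G.Faithful] [IsIso η] : IsUniversalArrow G η := fun M ↦
  ⟨fun a b hab ↦ G.map_injective ((cancel_epi η).1 hab),
    fun a ↦ ⟨G.preimage (inv η ≫ a), by simp⟩⟩

/-- For an equivalence there is an invertible universal arrow, and universal arrows with the same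
source differ by an isomorphism of targets. -/
lemma isIso [G.IsEquivalence] (h : IsUniversalArrow G η) : IsIso η := by
  have h' : IsUniversalArrow G (G.objObjPreimageIso K).inv := of_isIso
  obtain ⟨e, he⟩ := h'.exists_iso h
  rw [← he]
  infer_instance

/-- The morphism on the right is the transpose of `η`. Each exchange transformation is such a
transpose, so its invertibility becomes a statement free of the chosen adjoint. -/
lemma iff_isIso {F : A ⥤ B} (adj : F ⊣ G) (η : K ⟶ G.obj T) :
    IsUniversalArrow G η ↔ IsIso (F.map η ≫ adj.counit.app T) := by
  have key : η = adj.unit.app K ≫ G.map (F.map η ≫ adj.counit.app T) := by simp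
  constructor
  · intro h
    obtain ⟨e, he⟩ := (unit adj K).exists_iso h
    have : F.map η ≫ adj.counit.app T = e.hom := (unit adj K).hom_ext (by rw [← key, he])
    rw [this]
    infer_instance
  · intro h
    rw [key]
    exact (unit adj K).comp_map_iso _

lemma isRightAdjoint (G : B ⥤ A)
    (h : ∀ K : A, ∃ (T : B) (η : K ⟶ G.obj T), IsUniversalArrow G η) : G.IsRightAdjoint := by
  choose T η h using h
  exact (Adjunction.adjunctionOfEquivLeft (G := G) (F_obj := T)
    (fun K M ↦ Equiv.ofBijective _ (h K M)) (by intros; simp)).isRightAdjoint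

lemma exists_of_isRightAdjoint (G : B ⥤ A) [G.IsRightAdjoint] (K : A) :
    ∃ (T : B) (η : K ⟶ G.obj T), IsUniversalArrow G η :=
  ⟨_, _, unit (Adjunction.ofIsRightAdjoint G) K⟩

end IsUniversalArrow

/-! ### Functors with a fully faithful right adjoint -/

/-- A functor is reflective if it has a fully faithful right adjoint. -/
def IsReflector (L : A ⥤ B) : Prop :=
  ∃ (ι : B ⥤ A) (_ : L ⊣ ι), ι.Full ∧ ι.Faithful

lemma IsReflector.of_iso {L L' : A ⥤ B} (h : IsReflector L) (e : L ≅ L') : IsReflector L' := by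
  obtain ⟨ι, adj, h₁, h₂⟩ := h
  exact ⟨ι, adj.ofNatIsoLeft e, h₁, h₂⟩

lemma IsReflector.of_isEquivalence (L : A ⥤ B) [L.IsEquivalence] : IsReflector L :=
  ⟨L.inv, L.asEquivalence.toAdjunction, inferInstance, inferInstance⟩

lemma IsReflector.comp {L : A ⥤ B} {L' : B ⥤ A'} (h : IsReflector L) (h' : IsReflector L') :
    IsReflector (L ⋙ L') := by
  obtain ⟨ι, adj, h₁, h₂⟩ := h
  obtain ⟨ι', adj', h₁', h₂'⟩ := h'
  exact ⟨ι' ⋙ ι, adj.comp adj', inferInstance, inferInstance⟩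

lemma IsReflector.essSurj {L : A ⥤ B} (h : IsReflector L) : L.EssSurj := by
  obtain ⟨ι, adj, h₁, h₂⟩ := h
  exact ⟨fun M ↦ ⟨ι.obj M, ⟨asIso (adj.counit.app M)⟩⟩⟩

section

variable {L : A ⥤ B} {ι : B ⥤ A}

lemma reflector_hom_ext (adj : L ⊣ ι) {K : A} {M : B} {a b : K ⟶ ι.obj M}
    (h : L.map a = L.map b) : a = b :=
  (adj.homEquiv _ _).symm.injective (by simp [Adjunction.homEquiv_counit, h])

variable [ι.Full] [ι.Faithful]

/-- If `L` inverts the maps inverted by a left adjoint functor `F`, then the right adjoint of `F`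
takes values in `L`-local objects. -/
lemma isIso_unit_of_leftAdjoint (adj : L ⊣ ι) {F : A ⥤ A'} {R : A' ⥤ A} (adj' : F ⊣ R)
    (hF : ∀ K : A, IsIso (F.map (adj.unit.app K))) (N : A') :
    IsIso (adj.unit.app (R.obj N)) := by
  have := hF (R.obj N)
  -- The transpose under `F ⊣ R` of the counit precomposed with the inverse of `F(unit)` is a
  -- retraction of the unit. It is also a section, since maps into a local object are detected by
  -- `L`.
  let r : ι.obj (L.obj (R.obj N)) ⟶ R.obj N :=
    adj'.homEquiv _ _ (inv (F.map (adj.unit.app (R.obj N))) ≫ adj'.counit.app N)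
  have hr : adj.unit.app (R.obj N) ≫ r = 𝟙 _ :=
    (adj'.homEquiv _ _).symm.injective
      (by rw [adj'.homEquiv_naturality_left_symm]; simp [r, Adjunction.homEquiv_counit])
  refine ⟨r, hr, reflector_hom_ext adj ?_⟩
  rw [← cancel_epi (L.map (adj.unit.app (R.obj N))), ← L.map_comp, reassoc_of% hr]
  simp

/-- The right adjoint of `L ⋙ f` takes local values, so followed by `L` it is right adjoint to `f`.
This yields the existence of right adjoints on localizations, in (B1) and (C1). -/
lemma isLeftAdjoint_of_reflector (adj : L ⊣ ι) {f : B ⥤ A'} (h : (L ⋙ f).IsLeftAdjoint) :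
    f.IsLeftAdjoint := by
  let R := (L ⋙ f).rightAdjoint
  let adj' : L ⋙ f ⊣ R := Adjunction.ofIsLeftAdjoint _
  have (N : A') : IsIso (adj.unit.app (R.obj N)) :=
    isIso_unit_of_leftAdjoint adj adj' (fun K ↦ by dsimp; infer_instance) N
  let e₁ : ι ⋙ (L ⋙ f) ≅ f ⋙ 𝟭 _ :=
    Functor.isoWhiskerRight (asIso adj.counit) f ≪≫ f.leftUnitor ≪≫ f.rightUnitor.symm
  let e₂ : 𝟭 _ ⋙ R ≅ (R ⋙ L) ⋙ ι :=
    NatIso.ofComponents (fun N ↦ asIso (adj.unit.app (R.obj N)))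
      (fun a ↦ by simp)
  exact (Adjunction.restrictFullyFaithful (iC := ι) (iD := 𝟭 _) (L := f) (R := R ⋙ L)
    adj' (Functor.FullyFaithful.ofFullyFaithful ι) (Functor.FullyFaithful.id _) e₁ e₂).isLeftAdjoint

end

/-- A reflector maps universal arrows to universal arrows, if local objects are preserved. -/
lemma IsUniversalArrow.map_reflector {L₁ : B ⥤ B'} {ι₁ : B' ⥤ B} (adj₁ : L₁ ⊣ ι₁)
    [ι₁.Full] [ι₁.Faithful] {L₂ : A ⥤ A'} {ι₂ : A' ⥤ A} (adj₂ : L₂ ⊣ ι₂)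
    [ι₂.Full] [ι₂.Faithful] {u : B ⥤ A} {f : B' ⥤ A'} (σ : u ⋙ L₂ ≅ L₁ ⋙ f)
    (hloc : ∀ M : B', IsIso (adj₂.unit.app (u.obj (ι₁.obj M))))
    {K : A} {T : B} {η : K ⟶ u.obj T} (h : IsUniversalArrow u η) :
    IsUniversalArrow f (L₂.map η ≫ σ.hom.app T) := by
  intro M
  -- Since `u (ι₁ M)` is local, maps into it are the same before and after applying `L₂`.
  have hL₂ (K : A) : Function.Bijective
      (fun a : K ⟶ u.obj (ι₁.obj M) ↦ L₂.map a) := by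
    have := hloc M
    constructor
    · intro a b hab
      rw [← cancel_mono (adj₂.unit.app (u.obj (ι₁.obj M)))]
      exact reflector_hom_ext adj₂ (by dsimp at hab; simp [hab])
    · intro b
      refine ⟨(adj₂.homEquiv _ _ b) ≫ inv (adj₂.unit.app (u.obj (ι₁.obj M))), ?_⟩
      simp [Adjunction.homEquiv_unit]
  -- The map in question is a composite of bijections: transposition under `adj₁`, universality of
  -- `η`, `L₂` on maps into a local object, and composition with an isomorphism.
  have e : (fun g : L₁.obj T ⟶ M ↦ (L₂.map η ≫ σ.hom.app T) ≫ f.map g) =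
      (fun a : L₂.obj K ⟶ L₂.obj (u.obj (ι₁.obj M)) ↦ a ≫ σ.hom.app _ ≫
        f.map (adj₁.counit.app M)) ∘ (fun a : K ⟶ u.obj (ι₁.obj M) ↦ L₂.map a) ∘
      (fun g : T ⟶ ι₁.obj M ↦ η ≫ u.map g) ∘ adj₁.homEquiv T M := by
    ext g
    have h₁ := σ.hom.naturality (adj₁.homEquiv T M g)
    dsimp at h₁
    simp only [Function.comp_apply, Functor.map_comp, Category.assoc]
    rw [reassoc_of% h₁, ← f.map_comp]
    simp [Adjunction.homEquiv_unit]
  rw [e]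
  refine Function.Bijective.comp ⟨fun a b hab ↦ ?_, fun a ↦ ?_⟩
    ((hL₂ K).comp ((h _).comp (adj₁.homEquiv T M).bijective))
  · simpa [← cancel_mono (σ.hom.app (ι₁.obj M) ≫ f.map (adj₁.counit.app M))] using hab
  · exact ⟨a ≫ inv (σ.hom.app (ι₁.obj M) ≫ f.map (adj₁.counit.app M)), by simp⟩

end UniversalArrows

/-! ### Reflective 1-morphisms of symmetric monoidal triangulated categories -/

namespace TensorTriCat

open Bicategory

variable {A B C D : TensorTriCat.{v, u}}

@[simp]
lemma functor_id (A : TensorTriCat.{v, u}) : Hom.functor (𝟙 A) = 𝟭 A.carrier := rfl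

@[simp]
lemma functor_comp (F : A ⟶ B) (G : B ⟶ C) :
    Hom.functor (F ≫ G) = Hom.functor F ⋙ Hom.functor G := rfl

@[simp]
lemma whiskerLeft_app (F : A ⟶ B) {G H : B ⟶ C} (a : G ⟶ H) (X : A) :
    (F ◁ a).natTrans.app X = a.natTrans.app ((Hom.functor F).obj X) := rfl

@[simp]
lemma whiskerRight_app {F G : A ⟶ B} (a : F ⟶ G) (H : B ⟶ C) (X : A) :
    (a ▷ H).natTrans.app X = (Hom.functor H).map (a.natTrans.app X) := rfl

@[simp]
lemma associator_hom_app (F : A ⟶ B) (G : B ⟶ C) (H : C ⟶ D) (X : A) :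
    (α_ F G H).hom.natTrans.app X = 𝟙 _ := rfl

@[simp]
lemma associator_inv_app (F : A ⟶ B) (G : B ⟶ C) (H : C ⟶ D) (X : A) :
    (α_ F G H).inv.natTrans.app X = 𝟙 _ := rfl

@[simp]
lemma leftUnitor_hom_app (F : A ⟶ B) (X : A) : (λ_ F).hom.natTrans.app X = 𝟙 _ := rfl

@[simp]
lemma leftUnitor_inv_app (F : A ⟶ B) (X : A) : (λ_ F).inv.natTrans.app X = 𝟙 _ := rfl

@[simp]
lemma rightUnitor_hom_app (F : A ⟶ B) (X : A) : (ρ_ F).hom.natTrans.app X = 𝟙 _ := rfl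

@[simp]
lemma rightUnitor_inv_app (F : A ⟶ B) (X : A) : (ρ_ F).inv.natTrans.app X = 𝟙 _ := rfl

@[simp]
lemma hom_inv_app {F G : A ⟶ B} (e : F ≅ G) (X : A) :
    e.hom.natTrans.app X ≫ e.inv.natTrans.app X = 𝟙 _ := by
  have := congr_arg (fun a : F ⟶ F ↦ a.natTrans.app X) e.hom_inv_id
  exact this

@[simp]
lemma inv_hom_app {F G : A ⟶ B} (e : F ≅ G) (X : A) :
    e.inv.natTrans.app X ≫ e.hom.natTrans.app X = 𝟙 _ :=
  hom_inv_app e.symm X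

@[simp]
lemma hom_inv_app_assoc {F G : A ⟶ B} (e : F ≅ G) (X : A) {Z : B.carrier}
    (z : (Hom.functor F).obj X ⟶ Z) :
    e.hom.natTrans.app X ≫ e.inv.natTrans.app X ≫ z = z := by
  rw [reassoc_of% (hom_inv_app e X)]

@[simp]
lemma inv_hom_app_assoc {F G : A ⟶ B} (e : F ≅ G) (X : A) {Z : B.carrier}
    (z : (Hom.functor G).obj X ⟶ Z) :
    e.inv.natTrans.app X ≫ e.hom.natTrans.app X ≫ z = z :=
  hom_inv_app_assoc e.symm X z

instance {F G : A ⟶ B} (e : F ≅ G) (X : A) : IsIso (e.hom.natTrans.app X) :=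
  ⟨_, hom_inv_app e X, inv_hom_app e X⟩

instance {F G : A ⟶ B} (e : F ≅ G) (X : A) : IsIso (e.inv.natTrans.app X) :=
  ⟨_, inv_hom_app e X, hom_inv_app e X⟩

/-- The isomorphism of functors underlying an invertible 2-morphism. -/
@[simps]
def functorIso {F G : A ⟶ B} (e : F ≅ G) : Hom.functor F ≅ Hom.functor G where
  hom := e.hom.natTrans
  inv := e.inv.natTrans
  hom_inv_id := by ext; simp
  inv_hom_id := by ext; simp

/-- Two 2-morphisms agree if they agree after precomposition with an essentially surjective
1-morphism. -/
lemma ext_of_essSurj (l : A ⟶ B) [(Hom.functor l).EssSurj] {F G : B ⟶ C} {a b : F ⟶ G}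
    (h : ∀ X, a.natTrans.app ((Hom.functor l).obj X) = b.natTrans.app ((Hom.functor l).obj X)) :
    a = b := by
  apply ext_app
  intro X
  let e := (Hom.functor l).objObjPreimageIso X
  rw [← cancel_epi ((Hom.functor F).map e.hom), NatTrans.naturality, NatTrans.naturality, h]

/-- A symmetric monoidal triangulated functor is reflective if it has a fully faithful right
adjoint. -/
def IsReflective (l : A ⟶ B) : Prop := IsReflector (Hom.functor l)

section

variable (l : A ⟶ B) {ι : B.carrier ⥤ A.carrier} (adj : Hom.functor l ⊣ ι)

open Functor MonoidalCategory

/-- After transposition to `l`, this follows from the monoidality of the counit and the braiding of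
`l`. It makes the factorization `ι ⋙ F` below braided. -/
lemma rightAdjoint_μ_braiding [ι.LaxMonoidal] [adj.IsMonoidal] (X Y : B.carrier) :
    LaxMonoidal.μ ι X Y ≫ ι.map (β_ X Y).hom =
      (β_ (ι.obj X) (ι.obj Y)).hom ≫ LaxMonoidal.μ ι Y X := by
  have h (X Y : B.carrier) : LaxMonoidal.μ (Hom.functor l) (ι.obj X) (ι.obj Y) ≫
      (Hom.functor l).map (LaxMonoidal.μ ι X Y) ≫ adj.counit.app (X ⊗ Y) =
        (adj.counit.app X ⊗ₘ adj.counit.app Y) := by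
    simpa using NatTrans.IsMonoidal.tensor (τ := adj.counit) X Y
  have h' : (Hom.functor l).map (ι.map (β_ X Y).hom) ≫ adj.counit.app (Y ⊗ X) =
      adj.counit.app (X ⊗ Y) ≫ (β_ X Y).hom := adj.counit.naturality _
  apply (adj.homEquiv _ _).symm.injective
  rw [adj.homEquiv_counit, adj.homEquiv_counit,
    ← cancel_epi (LaxMonoidal.μ (Hom.functor l) _ _)]
  simp only [Functor.map_comp, Category.assoc]
  rw [h', reassoc_of% h, LaxBraided.braided_assoc, h]
  simp

variable [ι.Full] [ι.Faithful]

/-- The inclusion of local objects is only lax monoidal. Its constraints become invertible under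
`l`, because the monoidal counit is invertible and `l` is strong. -/
lemma isIso_map_lax [ι.LaxMonoidal] [adj.IsMonoidal] :
    IsIso ((Hom.functor l).map (LaxMonoidal.ε ι)) ∧
      ∀ X Y, IsIso ((Hom.functor l).map (LaxMonoidal.μ ι X Y)) := by
  have (M : B.carrier) : IsIso (adj.counit.app M) := inferInstance
  constructor
  · have h : LaxMonoidal.ε (Hom.functor l) ≫ (Hom.functor l).map (LaxMonoidal.ε ι) ≫
        adj.counit.app (𝟙_ _) = 𝟙 _ := by
      simpa using NatTrans.IsMonoidal.unit (τ := adj.counit)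
    have : IsIso (LaxMonoidal.ε (Hom.functor l) ≫ (Hom.functor l).map (LaxMonoidal.ε ι) ≫
        adj.counit.app (𝟙_ _)) := by
      rw [h]
      infer_instance
    have := IsIso.of_isIso_comp_left (LaxMonoidal.ε (Hom.functor l))
      ((Hom.functor l).map (LaxMonoidal.ε ι) ≫ adj.counit.app (𝟙_ _))
    exact IsIso.of_isIso_comp_right _ (adj.counit.app (𝟙_ _))
  · intro X Y
    have h : LaxMonoidal.μ (Hom.functor l) (ι.obj X) (ι.obj Y) ≫
        (Hom.functor l).map (LaxMonoidal.μ ι X Y) ≫ adj.counit.app (X ⊗ Y) =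
        (adj.counit.app X ⊗ₘ adj.counit.app Y) := by
      simpa using NatTrans.IsMonoidal.tensor (τ := adj.counit) X Y
    have : IsIso (LaxMonoidal.μ (Hom.functor l) (ι.obj X) (ι.obj Y) ≫
        (Hom.functor l).map (LaxMonoidal.μ ι X Y) ≫ adj.counit.app (X ⊗ Y)) := by
      rw [h]
      infer_instance
    have := IsIso.of_isIso_comp_left (LaxMonoidal.μ (Hom.functor l) (ι.obj X) (ι.obj Y))
      ((Hom.functor l).map (LaxMonoidal.μ ι X Y) ≫ adj.counit.app (X ⊗ Y))
    exact IsIso.of_isIso_comp_right _ (adj.counit.app (X ⊗ Y))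

/-- The factorization is `ι ⋙ F`. As `F` inverts whatever `l` inverts, it inverts the lax
constraints of `ι`, making the composite strong monoidal, and the unit, making `F` isomorphic to `l`
followed by the composite. -/
lemma exists_factorization (adj : Hom.functor l ⊣ ι) (F : A ⟶ C)
    (hF : ∀ ⦃X Y : A.carrier⦄ (w : X ⟶ Y), IsIso ((Hom.functor l).map w) →
      IsIso ((Hom.functor F).map w)) :
    ∃ m : B ⟶ C, Nonempty (F ≅ l ≫ m) := by
  let := adj.rightAdjointLaxMonoidal
  let := adj.rightAdjointCommShift ℤ
  have := adj.commShift_of_leftAdjoint ℤ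
  have : ι.IsTriangulated := adj.isTriangulated_rightAdjoint
  have := hF _ (isIso_map_lax l adj).1
  have (X Y : B.carrier) : IsIso ((Hom.functor F).map (LaxMonoidal.μ ι X Y)) :=
    hF _ ((isIso_map_lax l adj).2 X Y)
  have : IsIso (LaxMonoidal.ε (ι ⋙ Hom.functor F)) := by
    rw [LaxMonoidal.comp_ε]
    infer_instance
  let τ : Hom.functor F ⟶ Hom.functor l ⋙ ι ⋙ Hom.functor F := (Hom.functor F).leftUnitor.inv ≫
    Functor.whiskerRight adj.unit (Hom.functor F) ≫
      (Functor.associator (Hom.functor l) ι (Hom.functor F)).hom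
  have hτ : NatTrans.IsMonoidal τ := inferInstance
  have hτ' : NatTrans.CommShift τ ℤ := inferInstance
  have (X Y : B.carrier) : IsIso (LaxMonoidal.μ (ι ⋙ Hom.functor F) X Y) := by
    rw [LaxMonoidal.comp_μ]
    infer_instance
  let : (ι ⋙ Hom.functor F).Monoidal := Monoidal.ofLaxMonoidal _
  let : (ι ⋙ Hom.functor F).Braided :=
    { braided X Y := by
        change (LaxMonoidal.μ (Hom.functor F) _ _ ≫
          (Hom.functor F).map (LaxMonoidal.μ ι X Y)) ≫ (Hom.functor F).map (ι.map (β_ X Y).hom) =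
          _ ≫ LaxMonoidal.μ (Hom.functor F) _ _ ≫ (Hom.functor F).map (LaxMonoidal.μ ι Y X)
        rw [Category.assoc, ← Functor.map_comp, rightAdjoint_μ_braiding l adj, Functor.map_comp,
          LaxBraided.braided_assoc]
        rfl }
  let m : B ⟶ C := ⟨ι ⋙ Hom.functor F⟩
  have (X : A) : IsIso ((Hom.functor F).map (adj.unit.app X)) := hF _ inferInstance
  have (X : A) : IsIso (τ.app X) := by
    dsimp [τ]
    infer_instance
  let e : Hom.functor F ≅ Hom.functor (l ≫ m) :=
    NatIso.ofComponents (fun X ↦ asIso (τ.app X)) (fun f ↦ τ.naturality f)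
  have : NatTrans.IsMonoidal e.hom := ⟨hτ.unit, hτ.tensor⟩
  have : NatTrans.CommShift e.hom ℤ := hτ'
  exact ⟨m, ⟨isoMk e⟩⟩

/-- The lift is `a` on the objects `ι M`, conjugated by the invertible counit; monoidality and shift
compatibility are inherited because the counit has both. -/
lemma exists_lift (adj : Hom.functor l ⊣ ι) {F G : B ⟶ C} (a : l ≫ F ⟶ l ≫ G) :
    ∃ b : F ⟶ G, l ◁ b = a := by
  let := adj.rightAdjointLaxMonoidal
  let := adj.rightAdjointCommShift ℤ
  have := adj.commShift_of_leftAdjoint ℤ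
  let a' : (Hom.functor l) ⋙ (Hom.functor F) ⟶ (Hom.functor l) ⋙ (Hom.functor G) := a.natTrans
  let b : Hom.functor F ⟶ Hom.functor G := (Hom.functor F).leftUnitor.inv ≫
    Functor.whiskerRight (asIso adj.counit).inv (Hom.functor F) ≫
      (Functor.associator ι (Hom.functor l) (Hom.functor F)).hom ≫
      Functor.whiskerLeft ι a' ≫
      (Functor.associator ι (Hom.functor l) (Hom.functor G)).inv ≫
      Functor.whiskerRight (asIso adj.counit).hom (Hom.functor G) ≫ (Hom.functor G).leftUnitor.hom
  have : NatTrans.IsMonoidal a' := a.isMonoidal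
  have : NatTrans.CommShift a' ℤ := a.commShift
  have : NatTrans.IsMonoidal (asIso adj.counit).hom :=
    inferInstanceAs (NatTrans.IsMonoidal adj.counit)
  have : NatTrans.CommShift (asIso adj.counit).hom ℤ :=
    inferInstanceAs (NatTrans.CommShift adj.counit ℤ)
  have : NatTrans.IsMonoidal b := inferInstance
  have : NatTrans.CommShift b ℤ := inferInstance
  refine ⟨⟨b⟩, ext_app fun X ↦ ?_⟩
  have h := a'.naturality (adj.unit.app X)
  -- By the triangle identity the inverse of the counit at `l X` is `l(unit)`; naturality of `a`
  -- then moves it to the other side, where it cancels.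
  have h' : inv (adj.counit.app ((Hom.functor l).obj X)) =
    (Hom.functor l).map (adj.unit.app X) :=
    IsIso.inv_eq_of_inv_hom_id (adj.left_triangle_components X)
  dsimp [b]
  simp only [Category.comp_id, Category.id_comp]
  rw [NatIso.isIso_inv_app, h']
  have h'' : (Hom.functor F).map ((Hom.functor l).map (adj.unit.app X)) ≫
      a'.app (ι.obj ((Hom.functor l).obj X)) =
        a.natTrans.app X ≫ (Hom.functor G).map ((Hom.functor l).map (adj.unit.app X)) := h
  rw [reassoc_of% h'', ← Functor.map_comp, adj.left_triangle_components, CategoryTheory.Functor.map_id]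
  exact Category.comp_id _

end

namespace IsReflective

variable {l : A ⟶ B}

lemma hom_ext (h : IsReflective l) {F G : B ⟶ C} {a b : F ⟶ G}
    (hab : ∀ X, a.natTrans.app ((Hom.functor l).obj X) =
      b.natTrans.app ((Hom.functor l).obj X)) : a = b :=
  haveI := IsReflector.essSurj h
  ext_of_essSurj l hab

lemma exists_lift (h : IsReflective l) {F G : B ⟶ C} (a : l ≫ F ⟶ l ≫ G) :
    ∃ b : F ⟶ G, l ◁ b = a := by
  obtain ⟨ι, adj, _, _⟩ := h
  exact TensorTriCat.exists_lift l adj a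

lemma exists_lift_iso (h : IsReflective l) {F G : B ⟶ C} (a : l ≫ F ≅ l ≫ G) :
    ∃ b : F ≅ G, l ◁ b.hom = a.hom := by
  obtain ⟨b, hb⟩ := h.exists_lift a.hom
  obtain ⟨c, hc⟩ := h.exists_lift a.inv
  refine ⟨⟨b, c, h.hom_ext fun X ↦ ?_, h.hom_ext fun X ↦ ?_⟩, hb⟩
  · change (l ◁ b).natTrans.app X ≫ (l ◁ c).natTrans.app X = _
    rw [hb, hc, hom_inv_app]
    rfl
  · change (l ◁ c).natTrans.app X ≫ (l ◁ b).natTrans.app X = _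
    rw [hb, hc, inv_hom_app]
    rfl

/-- Lift of a 2-morphism along a reflective 1-morphism. -/
def lift (h : IsReflective l) {F G : B ⟶ C} (a : l ≫ F ⟶ l ≫ G) : F ⟶ G :=
  (h.exists_lift a).choose

@[simp]
lemma lift_app (h : IsReflective l) {F G : B ⟶ C} (a : l ≫ F ⟶ l ≫ G) (X : A) :
    (h.lift a).natTrans.app ((Hom.functor l).obj X) = a.natTrans.app X :=
  congr_arg (fun b : l ≫ F ⟶ l ≫ G ↦ b.natTrans.app X) (h.exists_lift a).choose_spec

/-- Lift of an invertible 2-morphism along a reflective 1-morphism. -/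
def liftIso (h : IsReflective l) {F G : B ⟶ C} (a : l ≫ F ≅ l ≫ G) : F ≅ G :=
  (h.exists_lift_iso a).choose

@[simp]
lemma liftIso_hom_app (h : IsReflective l) {F G : B ⟶ C} (a : l ≫ F ≅ l ≫ G) (X : A) :
    (h.liftIso a).hom.natTrans.app ((Hom.functor l).obj X) = a.hom.natTrans.app X :=
  congr_arg (fun b : l ≫ F ⟶ l ≫ G ↦ b.natTrans.app X) (h.exists_lift_iso a).choose_spec

@[simp]
lemma liftIso_inv_app (h : IsReflective l) {F G : B ⟶ C} (a : l ≫ F ≅ l ≫ G) (X : A) :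
    (h.liftIso a).inv.natTrans.app ((Hom.functor l).obj X) = a.inv.natTrans.app X := by
  rw [← cancel_epi ((h.liftIso a).hom.natTrans.app ((Hom.functor l).obj X)), hom_inv_app,
    liftIso_hom_app, hom_inv_app]
  rfl

lemma exists_factorization (h : IsReflective l) (F : A ⟶ C)
    (hF : ∀ ⦃X Y : A.carrier⦄ (w : X ⟶ Y), IsIso ((Hom.functor l).map w) →
      IsIso ((Hom.functor F).map w)) :
    ∃ m : B ⟶ C, Nonempty (F ≅ l ≫ m) := by
  obtain ⟨ι, adj, _, _⟩ := h
  exact TensorTriCat.exists_factorization l adj F hF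

end IsReflective

end TensorTriCat

/-! ### Pseudofunctors and reflective 1-morphisms -/

namespace TensorTriCat

open Bicategory

section

universe w₁ x₁ y₁

variable {B : Type x₁} [Bicategory.{w₁, y₁} B]

@[simp]
lemma natTrans_comp_app {A A' : TensorTriCat.{v, u}} {F G H : A ⟶ A'} (a : F ⟶ G) (b : G ⟶ H)
    (X : A) : (a ≫ b).natTrans.app X = a.natTrans.app X ≫ b.natTrans.app X := rfl

@[simp]
lemma natTrans_id_app {A A' : TensorTriCat.{v, u}} (F : A ⟶ A') (X : A) :
    (Hom₂.natTrans (𝟙 F)).app X = 𝟙 ((Hom.functor F).obj X) := rfl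

@[simp]
lemma map_hom_inv_app {A A' : TensorTriCat.{v, u}} {F G : A ⟶ A'} (e : F ≅ G) (X : A)
    {E : Type*} [Category* E] (H : A'.carrier ⥤ E) :
    H.map (e.hom.natTrans.app X) ≫ H.map (e.inv.natTrans.app X) = 𝟙 _ := by
  rw [← H.map_comp, hom_inv_app, H.map_id]

@[simp]
lemma map_map_hom_inv_app {A A' : TensorTriCat.{v, u}} {F G : A ⟶ A'} (e : F ≅ G) (X : A)
    {E E' : Type*} [Category* E] [Category* E'] (H : A'.carrier ⥤ E) (K : E ⥤ E') :
    K.map (H.map (e.hom.natTrans.app X)) ≫ K.map (H.map (e.inv.natTrans.app X)) = 𝟙 _ := by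
  rw [← K.map_comp, map_hom_inv_app, K.map_id]

@[simp]
lemma map_hom_inv_app_assoc {A A' : TensorTriCat.{v, u}} {F G : A ⟶ A'} (e : F ≅ G) (X : A)
    {E : Type*} [Category* E] (H : A'.carrier ⥤ E) {Z : E}
    (z : H.obj ((Hom.functor F).obj X) ⟶ Z) :
    H.map (e.hom.natTrans.app X) ≫ H.map (e.inv.natTrans.app X) ≫ z = z := by
  rw [reassoc_of% (map_hom_inv_app e X H)]

@[simp]
lemma map_map_hom_inv_app_assoc {A A' : TensorTriCat.{v, u}} {F G : A ⟶ A'} (e : F ≅ G) (X : A)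
    {E E' : Type*} [Category* E] [Category* E'] (H : A'.carrier ⥤ E) (K : E ⥤ E') {Z : E'}
    (z : K.obj (H.obj ((Hom.functor F).obj X)) ⟶ Z) :
    K.map (H.map (e.hom.natTrans.app X)) ≫ K.map (H.map (e.inv.natTrans.app X)) ≫ z = z := by
  rw [reassoc_of% (map_map_hom_inv_app e X H K)]

lemma naturality_comp_left {A₁ A₂ A₃ : TensorTriCat.{v, u}} {F : A₁ ⟶ A₂} {G : A₂ ⟶ A₃}
    {H : A₁ ⟶ A₃} (a : F ≫ G ⟶ H) {X Y : A₁} (x : X ⟶ Y) :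
    (Hom.functor G).map ((Hom.functor F).map x) ≫ a.natTrans.app Y =
      a.natTrans.app X ≫ (Hom.functor H).map x :=
  a.natTrans.naturality x

lemma naturality_comp_comp {A₁ A₂ A₂' A₃ : TensorTriCat.{v, u}} {F : A₁ ⟶ A₂} {G : A₂ ⟶ A₃}
    {F' : A₁ ⟶ A₂'} {G' : A₂' ⟶ A₃} (a : F ≫ G ⟶ F' ≫ G') {X Y : A₁} (x : X ⟶ Y) :
    (Hom.functor G).map ((Hom.functor F).map x) ≫ a.natTrans.app Y =
      a.natTrans.app X ≫ (Hom.functor G').map ((Hom.functor F').map x) :=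
  a.natTrans.naturality x

lemma naturality_comp_left_assoc {A₁ A₂ A₃ : TensorTriCat.{v, u}} {F : A₁ ⟶ A₂} {G : A₂ ⟶ A₃}
    {H : A₁ ⟶ A₃} (a : F ≫ G ⟶ H) {X Y : A₁} (x : X ⟶ Y) {Z : A₃.carrier}
    (z : (Hom.functor H).obj Y ⟶ Z) :
    (Hom.functor G).map ((Hom.functor F).map x) ≫ a.natTrans.app Y ≫ z =
      a.natTrans.app X ≫ (Hom.functor H).map x ≫ z := by
  rw [reassoc_of% (naturality_comp_left a x)]

lemma naturality_comp_comp_assoc {A₁ A₂ A₂' A₃ : TensorTriCat.{v, u}} {F : A₁ ⟶ A₂}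
    {G : A₂ ⟶ A₃} {F' : A₁ ⟶ A₂'} {G' : A₂' ⟶ A₃} (a : F ≫ G ⟶ F' ≫ G') {X Y : A₁} (x : X ⟶ Y)
    {Z : A₃.carrier} (z : (Hom.functor G').obj ((Hom.functor F').obj Y) ⟶ Z) :
    (Hom.functor G).map ((Hom.functor F).map x) ≫ a.natTrans.app Y ≫ z =
      a.natTrans.app X ≫ (Hom.functor G').map ((Hom.functor F').map x) ≫ z := by
  rw [reassoc_of% (naturality_comp_comp a x)]

/-- Data presenting pointwise reflective localizations of a pseudofunctor. -/
structure LocalizationData (W : Pseudofunctor B TensorTriCat.{v, u}) where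
  obj : B → TensorTriCat.{v, u}
  l (b : B) : W.obj b ⟶ obj b
  reflective (b : B) : IsReflective (l b)
  map {a b : B} (f : a ⟶ b) : obj a ⟶ obj b
  σ {a b : B} (f : a ⟶ b) : W.map f ≫ l b ≅ l a ≫ map f

namespace LocalizationData

variable {W : Pseudofunctor B TensorTriCat.{v, u}} (d : LocalizationData W)

/-- The isomorphism inducing the compatibility of `map` with identities. -/
@[simps!]
def idIso (a : B) : d.l a ≫ d.map (𝟙 a) ≅ d.l a ≫ 𝟙 _ :=
  (d.σ (𝟙 a)).symm ≪≫ whiskerRightIso (W.mapId a) (d.l a) ≪≫ λ_ _ ≪≫ (ρ_ _).symm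

/-- The isomorphism inducing the compatibility of `map` with compositions. -/
@[simps!]
def compIso {a b c : B} (f : a ⟶ b) (g : b ⟶ c) :
    d.l a ≫ d.map (f ≫ g) ≅ d.l a ≫ d.map f ≫ d.map g :=
  (d.σ (f ≫ g)).symm ≪≫
    whiskerRightIso (W.mapComp f g) (d.l c) ≪≫ α_ _ _ _ ≪≫ whiskerLeftIso (W.map f) (d.σ g) ≪≫
    (α_ _ _ _).symm ≪≫ whiskerRightIso (d.σ f) (d.map g) ≪≫ α_ _ _ _

/-- The pseudofunctor given by pointwise reflective localizations. -/
@[simps obj map]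
def pseudofunctor : Pseudofunctor B TensorTriCat.{v, u} where
  obj := d.obj
  map := d.map
  -- Each structure 2-morphism is the unique lift of the corresponding one of `W`, conjugated by
  -- `σ`. Every axiom can thus be tested on objects `l X`, where it reduces to the axiom for `W`.
  map₂ {a b f g} η := (d.reflective a).lift ((d.σ f).inv ≫ W.map₂ η ▷ d.l b ≫ (d.σ g).hom)
  mapId a := (d.reflective a).liftIso (d.idIso a)
  mapComp {a b c} f g := (d.reflective a).liftIso (d.compIso f g)
  map₂_id f := (d.reflective _).hom_ext fun X ↦ by
    simp
  map₂_comp η θ := (d.reflective _).hom_ext fun X ↦ by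
    simp
  map₂_whisker_left f g h η := (d.reflective _).hom_ext fun X ↦ by
    simp
  map₂_whisker_right η h := (d.reflective _).hom_ext fun X ↦ by
    simp [← naturality_comp_comp_assoc]
  map₂_associator f g h := (d.reflective _).hom_ext fun X ↦ by
    simp only [Pseudofunctor.map₂_associator]
    simp [naturality_comp_left_assoc]
  map₂_left_unitor f := (d.reflective _).hom_ext fun X ↦ by
    simp [← naturality_comp_comp]
  map₂_right_unitor f := (d.reflective _).hom_ext fun X ↦ by
    simp

/-- The localization morphism. -/
def localization : W ⟶ d.pseudofunctor where
  app := d.l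
  naturality := d.σ
  naturality_naturality {a b f g} η := ext_app fun X ↦ by
    change (Hom.functor (d.l b)).map ((W.map₂ η).natTrans.app X) ≫ (d.σ g).hom.natTrans.app X =
      (d.σ f).hom.natTrans.app X ≫ ((d.reflective a).lift _).natTrans.app _
    simp
  naturality_id a := ext_app fun X ↦ by
    change (d.σ (𝟙 a)).hom.natTrans.app X ≫ ((d.reflective a).liftIso (d.idIso a)).hom.natTrans.app _ =
      (Hom.functor (d.l a)).map ((W.mapId a).hom.natTrans.app X) ≫ 𝟙 _ ≫ 𝟙 _
    simp
  naturality_comp {a b c} f g := ext_app fun X ↦ by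
    change (d.σ (f ≫ g)).hom.natTrans.app X ≫
      ((d.reflective a).liftIso (d.compIso f g)).hom.natTrans.app _ =
      (Hom.functor (d.l c)).map ((W.mapComp f g).hom.natTrans.app X) ≫ 𝟙 _ ≫
        (d.σ g).hom.natTrans.app _ ≫ 𝟙 _ ≫
          (Hom.functor (d.map g)).map ((d.σ f).hom.natTrans.app X) ≫ 𝟙 _
    simp

end LocalizationData

/-! ### Descent of transformations along pointwise reflective localizations. -/

section Descent

variable {W G H : Pseudofunctor B TensorTriCat.{v, u}} (L : W ⟶ G)
  (hL : ∀ b, IsReflective (L.app b)) (τ : W ⟶ H) (β : ∀ b, G.obj b ⟶ H.obj b)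
  (t : ∀ b, τ.app b ≅ L.app b ≫ β b)

/-- The isomorphism inducing the naturality of a family of morphisms with prescribed restrictions
to pointwise reflective localizations. -/
@[simps!]
def descentIso {a b : B} (f : a ⟶ b) :
    L.app a ≫ G.map f ≫ β b ≅ L.app a ≫ β a ≫ H.map f :=
  (α_ _ _ _).symm ≪≫ whiskerRightIso (L.naturality f).symm (β b) ≪≫ α_ _ _ _ ≪≫
    whiskerLeftIso (W.map f) (t b).symm ≪≫ τ.naturality f ≪≫ whiskerRightIso (t a) (H.map f) ≪≫
    α_ _ _ _

lemma naturality_naturality_app {F F' : Pseudofunctor B TensorTriCat.{v, u}} (α : F ⟶ F')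
    {a b : B} {f g : a ⟶ b} (η : f ⟶ g) (X : (F.obj a).carrier) :
    (Hom.functor (α.app b)).map ((F.map₂ η).natTrans.app X) ≫
      (α.naturality g).hom.natTrans.app X =
    (α.naturality f).hom.natTrans.app X ≫
      (F'.map₂ η).natTrans.app ((Hom.functor (α.app a)).obj X) :=
  congr_arg (fun (x : F.map f ≫ α.app b ⟶ α.app a ≫ F'.map g) ↦ x.natTrans.app X)
    (α.naturality_naturality η)

lemma naturality_id_app {F F' : Pseudofunctor B TensorTriCat.{v, u}} (α : F ⟶ F')
    (a : B) (X : (F.obj a).carrier) :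
    (α.naturality (𝟙 a)).hom.natTrans.app X ≫
      (F'.mapId a).hom.natTrans.app ((Hom.functor (α.app a)).obj X) =
    (Hom.functor (α.app a)).map ((F.mapId a).hom.natTrans.app X) := by
  have := congr_arg (fun (x : F.map (𝟙 a) ≫ α.app a ⟶ α.app a ≫ 𝟙 _) ↦ x.natTrans.app X)
    (α.naturality_id a)
  simpa [-Pseudofunctor.StrongTrans.naturality_id] using this

lemma naturality_comp_app {F F' : Pseudofunctor B TensorTriCat.{v, u}} (α : F ⟶ F')
    {a b c : B} (f : a ⟶ b) (g : b ⟶ c) (X : (F.obj a).carrier) :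
    (α.naturality (f ≫ g)).hom.natTrans.app X ≫
      (F'.mapComp f g).hom.natTrans.app ((Hom.functor (α.app a)).obj X) =
    (Hom.functor (α.app c)).map ((F.mapComp f g).hom.natTrans.app X) ≫
      (α.naturality g).hom.natTrans.app ((Hom.functor (F.map f)).obj X) ≫
        (Hom.functor (F'.map g)).map ((α.naturality f).hom.natTrans.app X) := by
  have := congr_arg (fun (x : F.map (f ≫ g) ≫ α.app c ⟶ α.app a ≫ F'.map f ≫ F'.map g) ↦
    x.natTrans.app X) (α.naturality_comp f g)
  simpa [-Pseudofunctor.StrongTrans.naturality_comp] using this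

lemma naturality_naturality_app_assoc {F F' : Pseudofunctor B TensorTriCat.{v, u}} (α : F ⟶ F')
    {a b : B} {f g : a ⟶ b} (η : f ⟶ g) (X : (F.obj a).carrier) {Z : (F'.obj b).carrier}
    (z : (Hom.functor (F'.map g)).obj ((Hom.functor (α.app a)).obj X) ⟶ Z) :
    (Hom.functor (α.app b)).map ((F.map₂ η).natTrans.app X) ≫
      (α.naturality g).hom.natTrans.app X ≫ z =
    (α.naturality f).hom.natTrans.app X ≫
      (F'.map₂ η).natTrans.app ((Hom.functor (α.app a)).obj X) ≫ z := by
  rw [reassoc_of% (naturality_naturality_app α η X)]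

lemma naturality_id_app_assoc {F F' : Pseudofunctor B TensorTriCat.{v, u}} (α : F ⟶ F')
    (a : B) (X : (F.obj a).carrier) {Z : (F'.obj a).carrier}
    (z : (Hom.functor (α.app a)).obj X ⟶ Z) :
    (α.naturality (𝟙 a)).hom.natTrans.app X ≫
      (F'.mapId a).hom.natTrans.app ((Hom.functor (α.app a)).obj X) ≫ z =
    (Hom.functor (α.app a)).map ((F.mapId a).hom.natTrans.app X) ≫ z := by
  rw [← naturality_id_app, Category.assoc]

lemma naturality_comp_app_assoc {F F' : Pseudofunctor B TensorTriCat.{v, u}} (α : F ⟶ F')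
    {a b c : B} (f : a ⟶ b) (g : b ⟶ c) (X : (F.obj a).carrier) {Z : (F'.obj c).carrier}
    (z : (Hom.functor (F'.map g)).obj
      ((Hom.functor (F'.map f)).obj ((Hom.functor (α.app a)).obj X)) ⟶ Z) :
    (α.naturality (f ≫ g)).hom.natTrans.app X ≫
      (F'.mapComp f g).hom.natTrans.app ((Hom.functor (α.app a)).obj X) ≫ z =
    (Hom.functor (α.app c)).map ((F.mapComp f g).hom.natTrans.app X) ≫
      (α.naturality g).hom.natTrans.app ((Hom.functor (F.map f)).obj X) ≫
        (Hom.functor (F'.map g)).map ((α.naturality f).hom.natTrans.app X) ≫ z := by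
  rw [reassoc_of% (naturality_comp_app α f g X)]

lemma comp_naturality_app {F F' F'' : Pseudofunctor B TensorTriCat.{v, u}} (α : F ⟶ F')
    (α' : F' ⟶ F'') {a b : B} (f : a ⟶ b) (X : (F.obj a).carrier) :
    ((α ≫ α').naturality f).hom.natTrans.app X =
      (Hom.functor (α'.app b)).map ((α.naturality f).hom.natTrans.app X) ≫
        (α'.naturality f).hom.natTrans.app ((Hom.functor (α.app a)).obj X) := by
  change 𝟙 _ ≫ (Hom.functor (α'.app b)).map ((α.naturality f).hom.natTrans.app X) ≫ 𝟙 _ ≫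
        (α'.naturality f).hom.natTrans.app ((Hom.functor (α.app a)).obj X) ≫ 𝟙 _ = _
  rw [Category.id_comp, Category.comp_id, Category.id_comp]

lemma modification_naturality_app {F F' : Pseudofunctor B TensorTriCat.{v, u}} {α α' : F ⟶ F'}
    (m : α ⟶ α') {a b : B} (f : a ⟶ b) (X : (F.obj a).carrier) :
    (m.as.app b).natTrans.app ((Hom.functor (F.map f)).obj X) ≫
      (α'.naturality f).hom.natTrans.app X = (α.naturality f).hom.natTrans.app X ≫
        (Hom.functor (F'.map f)).map ((m.as.app a).natTrans.app X) :=
  congr_arg (fun (x : F.map f ≫ α.app b ⟶ α'.app a ≫ F'.map f) ↦ x.natTrans.app X)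
    (m.as.naturality f)

/-- The component of an invertible modification. -/
@[simps]
def modificationIsoApp {F F' : Pseudofunctor B TensorTriCat.{v, u}} {α α' : F ⟶ F'}
    (m : α ≅ α') (b : B) : α.app b ≅ α'.app b where
  hom := m.hom.as.app b
  inv := m.inv.as.app b
  hom_inv_id := congr_arg (fun (x : α ⟶ α) ↦ x.as.app b) m.hom_inv_id
  inv_hom_id := congr_arg (fun (x : α' ⟶ α') ↦ x.as.app b) m.inv_hom_id

/-- Morphisms with prescribed restrictions to pointwise reflective localizations are the components
of a strong transformation. -/
def descent : G ⟶ H where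
  app := β
  naturality {a b} f := (hL a).liftIso (descentIso L τ β t f)
  naturality_naturality {a b f g} η := (hL _).hom_ext fun X ↦ by
    have h := congr_arg (Hom.functor (β b)).map (naturality_naturality_app L η X)
    simp only [Functor.map_comp] at h
    -- `descentIso` begins with the inverse of `L.naturality`; precomposing with `L.naturality`
    -- removes it and leaves an identity about `τ` and `t`. The two remaining axioms are treated in
    -- the same way.
    rw [← cancel_epi ((Hom.functor (β b)).map ((L.naturality f).hom.natTrans.app X))]
    simp [← reassoc_of% h, naturality_comp_left_assoc, ← naturality_naturality_app_assoc]
  naturality_id a := (hL _).hom_ext fun X ↦ by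
    have h := congr_arg (Hom.functor (β a)).map (naturality_id_app L a X)
    simp only [Functor.map_comp] at h
    rw [← cancel_epi ((Hom.functor (β a)).map ((L.naturality (𝟙 a)).hom.natTrans.app X))]
    simp [h, naturality_id_app_assoc]
  naturality_comp {a b c} f g := (hL _).hom_ext fun X ↦ by
    have h := congr_arg (Hom.functor (β c)).map (naturality_comp_app L f g X)
    simp only [Functor.map_comp] at h
    rw [← cancel_epi ((Hom.functor (β c)).map ((L.naturality (f ≫ g)).hom.natTrans.app X))]
    simp [reassoc_of% h, naturality_comp_app_assoc, ← naturality_comp_left_assoc,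
      ← naturality_comp_comp_assoc]

lemma descent_naturality_app {a b : B} (f : a ⟶ b) (X : (W.obj a).carrier) :
    ((descent L hL τ β t).naturality f).hom.natTrans.app ((Hom.functor (L.app a)).obj X) =
      (descentIso L τ β t f).hom.natTrans.app X :=
  (hL a).liftIso_hom_app _ _

/-- The restriction of the descended transformation. -/
def descentRestrictionIso : L ≫ descent L hL τ β t ≅ τ :=
  Pseudofunctor.StrongTrans.isoMk (fun b ↦ (t b).symm) (fun {a b} f ↦ ext_app fun X ↦ by
    change (t b).inv.natTrans.app _ ≫ (τ.naturality f).hom.natTrans.app X =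
      ((L ≫ descent L hL τ β t).naturality f).hom.natTrans.app X ≫
        (Hom.functor (H.map f)).map ((t a).inv.natTrans.app X)
    rw [comp_naturality_app, descent_naturality_app]
    have key : (t b).inv.natTrans.app ((Hom.functor (W.map f)).obj X) ≫
        (τ.naturality f).hom.natTrans.app X =
        ((Hom.functor (β b)).map ((L.naturality f).hom.natTrans.app X) ≫
          (descentIso L τ β t f).hom.natTrans.app X) ≫
            (Hom.functor (H.map f)).map ((t a).inv.natTrans.app X) := by
      simp
    exact key)

end Descent

/-! ### Uniqueness of descended transformations. -/

section Cancel

variable {W G H : Pseudofunctor B TensorTriCat.{v, u}} (L : W ⟶ G)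
  (hL : ∀ b, IsReflective (L.app b)) {β β' : G ⟶ H}

/-- The component of an invertible modification between composites. -/
def modificationCompIsoApp {L : W ⟶ G} (m : L ≫ β ≅ L ≫ β') (b : B) :
    L.app b ≫ β.app b ≅ L.app b ≫ β'.app b :=
  modificationIsoApp m b

lemma modificationCompIsoApp_naturality {L : W ⟶ G} (m : L ≫ β ≅ L ≫ β') {a b : B} (f : a ⟶ b)
    (X : (W.obj a).carrier) :
    (modificationCompIsoApp m b).hom.natTrans.app ((Hom.functor (W.map f)).obj X) ≫
      (Hom.functor (β'.app b)).map ((L.naturality f).hom.natTrans.app X) ≫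
        (β'.naturality f).hom.natTrans.app ((Hom.functor (L.app a)).obj X) =
    (Hom.functor (β.app b)).map ((L.naturality f).hom.natTrans.app X) ≫
      (β.naturality f).hom.natTrans.app ((Hom.functor (L.app a)).obj X) ≫
        (Hom.functor (H.map f)).map ((modificationCompIsoApp m a).hom.natTrans.app X) := by
  have h := modification_naturality_app m.hom f X
  rw [comp_naturality_app, comp_naturality_app] at h
  exact h.trans (Category.assoc _ _ _)

/-- Cancellation of pointwise reflective localizations. -/
def cancelIso (m : L ≫ β ≅ L ≫ β') : β ≅ β' :=
  Pseudofunctor.StrongTrans.isoMk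
    (fun b ↦ (hL b).liftIso (modificationCompIsoApp m b))
    (fun {a b} f ↦ (hL a).hom_ext fun X ↦ by
      rw [← cancel_epi ((Hom.functor (β.app b)).map ((L.naturality f).hom.natTrans.app X))]
      simp [modificationCompIsoApp_naturality])

end Cancel

end

end TensorTriCat

/-! ### Premotivic pseudofunctors and universal arrows -/

section

universe w₁ w₂ w₃ w₄ x₁ x₂ x₃ x₄

variable {A : Type x₁} [Category.{w₁} A] {B : Type x₂} [Category.{w₂} B]
  {A' : Type x₃} [Category.{w₃} A'] {B' : Type x₄} [Category.{w₄} B']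

/-- Universal arrows with isomorphic sources are isomorphic, so preservation of universality need
only be checked for one of them. Thus the premotivic axioms, stated for adjunction units, hold for
arbitrary universal arrows. -/
lemma IsUniversalArrow.transfer {G : B ⥤ A} {G' : B' ⥤ A'} {a : A ⥤ A'} {b : B ⥤ B'}
    (σ : G ⋙ a ⟶ b ⋙ G') {K : A} {T : B} {η : K ⟶ G.obj T} (h : IsUniversalArrow G η)
    (hσ : IsUniversalArrow G' (a.map η ≫ σ.app T)) {K' : A} {T' : B} {η' : K' ⟶ G.obj T'}
    (h' : IsUniversalArrow G η') (e : K' ≅ K) :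
    IsUniversalArrow G' (a.map η' ≫ σ.app T') := by
  obtain ⟨t, ht⟩ := (h.iso_comp e.hom).exists_iso h'
  have hn : a.map (G.map t.hom) ≫ σ.app T' = σ.app T ≫ G'.map (b.map t.hom) :=
    σ.naturality t.hom
  have := (hσ.comp_map_iso (b.map t.hom)).iso_comp (a.map e.hom)
  rw [← ht]
  simpa [hn] using this

end

namespace TriPseudofunctor

open TensorTriCat Bicategory Opposite MonoidalCategory

variable {D : Type u₁} [Category.{v₁} D] {P : MorphismProperty D}

section

variable {H : TriPseudofunctor.{v, u} D}

/-- The exchange transformation is by construction the transpose of the arrow on the right; likewise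
in the next two lemmas. -/
lemma isIso_exchangeBase_iff {X' X S' S : D} {g' : X' ⟶ X} {f' : X' ⟶ S'}
    {f : X ⟶ S} {g : S' ⟶ S} (sq : CommSq g' f' f g)
    {fs : (H.at' X).carrier ⥤ (H.at' S).carrier} (adj : fs ⊣ H.star f)
    {fs' : (H.at' X').carrier ⥤ (H.at' S').carrier} (adj' : fs' ⊣ H.star f')
    (K : (H.at' X).carrier) :
    IsIso (H.exchangeBase sq adj adj' K) ↔ IsUniversalArrow (H.star f')
      ((H.star g').map (adj.unit.app K) ≫
        (H.squareIso sq).hom.natTrans.app (fs.obj K)) := by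
  rw [IsUniversalArrow.iff_isIso adj', Functor.map_comp, Category.assoc]
  rfl

lemma isIso_exchangeTensor_iff {X S : D} {f : X ⟶ S}
    {fs : (H.at' X).carrier ⥤ (H.at' S).carrier} (adj : fs ⊣ H.star f)
    (K : (H.at' X).carrier) (L : (H.at' S).carrier) :
    IsIso (H.exchangeTensor adj K L) ↔ IsUniversalArrow (H.star f)
      (adj.unit.app K ▷ (H.star f).obj L ≫
        Functor.LaxMonoidal.μ (H.star f) (fs.obj K) L) := by
  rw [IsUniversalArrow.iff_isIso adj, Functor.map_comp, Category.assoc]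
  rfl

lemma isIso_exchangeTrans_iff {H' : TriPseudofunctor.{v, u} D} (α : H ⟶ H') {X S : D} {f : X ⟶ S}
    {fs : (H.at' X).carrier ⥤ (H.at' S).carrier} (adj : fs ⊣ H.star f)
    {fs' : (H'.at' X).carrier ⥤ (H'.at' S).carrier} (adj' : fs' ⊣ H'.star f)
    (K : (H.at' X).carrier) :
    IsIso (exchangeTrans α adj adj' K) ↔ IsUniversalArrow (H'.star f)
      ((α.app ⟨op X⟩).functor.map (adj.unit.app K) ≫
        (α.naturality f.op.toLoc).hom.natTrans.app (fs.obj K)) := by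
  rw [IsUniversalArrow.iff_isIso adj', Functor.map_comp, Category.assoc]
  rfl

lemma IsPremotivic.exists_universal (hH : H.IsPremotivic P) {X S : D} (f : X ⟶ S) (hf : P f)
    (K : (H.at' X).carrier) :
    ∃ (T : (H.at' S).carrier) (η : K ⟶ (H.star f).obj T), IsUniversalArrow (H.star f) η :=
  haveI := hH.b2 f hf
  IsUniversalArrow.exists_of_isRightAdjoint _ _

lemma IsPremotivic.universal_base (hH : H.IsPremotivic P) {X' X S' S : D} {g' : X' ⟶ X}
    {f' : X' ⟶ S'} {f : X ⟶ S} {g : S' ⟶ S} (sq : IsPullback g' f' f g) (hf : P f) (hf' : P f')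
    {K : (H.at' X).carrier} {T : (H.at' S).carrier} {η : K ⟶ (H.star f).obj T}
    (h : IsUniversalArrow (H.star f) η) :
    IsUniversalArrow (H.star f') ((H.star g').map η ≫
      (H.squareIso sq.toCommSq).hom.natTrans.app T) := by
  have := hH.b2 f hf
  have := hH.b2 f' hf'
  have h₁ := (isIso_exchangeBase_iff _ _ _ K).1 (hH.b3 sq hf hf'
    (Adjunction.ofIsRightAdjoint (H.star f)) (Adjunction.ofIsRightAdjoint (H.star f')) K)
  exact (IsUniversalArrow.unit (Adjunction.ofIsRightAdjoint (H.star f)) K).transfer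
    (a := H.star g') (b := H.star g) (H.squareIso sq.toCommSq).hom.natTrans h₁ h (Iso.refl _)

lemma IsPremotivic.universal_tensor (hH : H.IsPremotivic P) {X S : D} {f : X ⟶ S} (hf : P f)
    {K : (H.at' X).carrier} {T : (H.at' S).carrier} {η : K ⟶ (H.star f).obj T}
    (h : IsUniversalArrow (H.star f) η) (L : (H.at' S).carrier) :
    IsUniversalArrow (H.star f) (η ▷ (H.star f).obj L ≫
      Functor.LaxMonoidal.μ (H.star f) T L) := by
  have := hH.b2 f hf
  have h₁ := (isIso_exchangeTensor_iff _ K L).1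
    (hH.b4 f hf (Adjunction.ofIsRightAdjoint (H.star f)) K L)
  let σ : H.star f ⋙ tensorRight ((H.star f).obj L) ⟶ tensorRight L ⋙ H.star f :=
    { app T := Functor.LaxMonoidal.μ (H.star f) T L }
  exact (IsUniversalArrow.unit (Adjunction.ofIsRightAdjoint (H.star f)) K).transfer σ h₁ h
    (Iso.refl _)

/-- A transformation preserves universal arrows if it commutes with the functors `f_♯`. -/
def PreservesUniversal (P : MorphismProperty D) {H H' : TriPseudofunctor.{v, u} D}
    (α : H ⟶ H') : Prop :=
  ∀ ⦃X S : D⦄ (f : X ⟶ S), P f → ∀ ⦃K : (H.at' X).carrier⦄ ⦃T : (H.at' S).carrier⦄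
    (η : K ⟶ (H.star f).obj T), IsUniversalArrow (H.star f) η →
    IsUniversalArrow (H'.star f) ((α.app ⟨op X⟩).functor.map η ≫
        (α.naturality f.op.toLoc).hom.natTrans.app T)

variable {H' H'' : TriPseudofunctor.{v, u} D}

lemma IsPremotivicTrans.preservesUniversal {α : H ⟶ H'} (hα : IsPremotivicTrans P α)
    (hH : H.IsPremotivic P) (hH' : H'.IsPremotivic P) : PreservesUniversal P α := by
  intro X S f hf K T η h
  have := hH.b2 f hf
  have := hH'.b2 f hf
  have h₁ := (isIso_exchangeTrans_iff _ _ _ K).1 (hα.c2 f hf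
    (Adjunction.ofIsRightAdjoint (H.star f)) (Adjunction.ofIsRightAdjoint (H'.star f)) K)
  exact (IsUniversalArrow.unit (Adjunction.ofIsRightAdjoint (H.star f)) K).transfer
    (a := (α.app ⟨op X⟩).functor) (b := (α.app ⟨op S⟩).functor)
    (α.naturality f.op.toLoc).hom.natTrans h₁ h (Iso.refl _)

lemma PreservesUniversal.comp {α : H ⟶ H'} {α' : H' ⟶ H''} (h : PreservesUniversal P α)
    (h' : PreservesUniversal P α') : PreservesUniversal P (α ≫ α') := by
  intro X S f hf K T η hη
  have := h' f hf _ (h f hf η hη)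
  rw [comp_naturality_app]
  simpa using this

lemma PreservesUniversal.of_iso {α α' : H ⟶ H'} (h : PreservesUniversal P α) (m : α ≅ α') :
    PreservesUniversal P α' := by
  intro X S f hf K T η hη
  have h₁ := (h f hf η hη).comp_map_iso ((modificationIsoApp m ⟨op S⟩).hom.natTrans.app T)
  have h₂ := modification_naturality_app m.hom f.op.toLoc T
  have h₃ : (α.app ⟨op X⟩).functor.map η ≫ (m.hom.as.app ⟨op X⟩).natTrans.app _ =
    (m.hom.as.app ⟨op X⟩).natTrans.app K ≫ (α'.app ⟨op X⟩).functor.map η :=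
    (m.hom.as.app ⟨op X⟩).natTrans.naturality η
  refine IsUniversalArrow.of_iso_comp ((modificationIsoApp m ⟨op X⟩).hom.natTrans.app K) ?_
  convert h₁ using 1
  rw [Category.assoc]
  erw [← h₂]
  rw [reassoc_of% h₃]
  rfl

/-- Both sides pass through the inverse image along the diagonal of the square, where the
composition axiom of `α` applies to each of its two factorizations. -/
lemma squareIso_naturality (α : H ⟶ H') {X' X S' S : D} {g' : X' ⟶ X}
    {f' : X' ⟶ S'} {f : X ⟶ S} {g : S' ⟶ S} (sq : CommSq g' f' f g) (T : (H.at' S).carrier) :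
    (α.app ⟨op X'⟩).functor.map ((H.squareIso sq).hom.natTrans.app T) ≫
      (α.naturality f'.op.toLoc).hom.natTrans.app ((H.star g).obj T) ≫
        (H'.star f').map ((α.naturality g.op.toLoc).hom.natTrans.app T) =
    (α.naturality g'.op.toLoc).hom.natTrans.app ((H.star f).obj T) ≫
      (H'.star g').map ((α.naturality f.op.toLoc).hom.natTrans.app T) ≫
        (H'.squareIso sq).hom.natTrans.app ((α.app ⟨op S⟩).functor.obj T) := by
  rw [← cancel_epi ((α.app ⟨op X'⟩).functor.map
    ((H.mapComp f.op.toLoc g'.op.toLoc).hom.natTrans.app T))]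
  rw [← naturality_comp_app_assoc]
  simp [squareIso, Pseudofunctor.isoMapOfCommSq, Pseudofunctor.mapComp']
  rw [← naturality_naturality_app_assoc, naturality_comp_app]

end

/-! ### Transfer of the premotivic axioms to pointwise reflective localizations. -/

section Transfer

variable {W G H : TriPseudofunctor.{v, u} D} (L : W ⟶ G)

/-- A reflector is essentially surjective, so up to isomorphism every source comes from `W`. It is
therefore enough to test on images of arrows from `W`. -/
lemma _root_.IsUniversalArrow.transfer_of_reflective (hL : ∀ X, IsReflective (L.app X))
    {X S : D} {f : X ⟶ S} {A' B' : Type*} [Category* A'] [Category* B'] {G' : B' ⥤ A'}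
    {a : (G.at' X).carrier ⥤ A'} {b : (G.at' S).carrier ⥤ B'} (σ : G.star f ⋙ a ⟶ b ⋙ G')
    (hx : ∀ K : (W.at' X).carrier, ∃ (T : (W.at' S).carrier) (η : K ⟶ (W.star f).obj T),
      IsUniversalArrow (G.star f) ((L.app ⟨op X⟩).functor.map η ≫
        (L.naturality f.op.toLoc).hom.natTrans.app T) ∧
      IsUniversalArrow G' (a.map ((L.app ⟨op X⟩).functor.map η ≫
        (L.naturality f.op.toLoc).hom.natTrans.app T) ≫ σ.app _))
    {K : (G.at' X).carrier} {T : (G.at' S).carrier} {η : K ⟶ (G.star f).obj T}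
    (h : IsUniversalArrow (G.star f) η) : IsUniversalArrow G' (a.map η ≫ σ.app T) := by
  have := IsReflector.essSurj (hL ⟨op X⟩)
  obtain ⟨T₀, η₀, h₀, h₀'⟩ := hx ((L.app ⟨op X⟩).functor.objPreimage K)
  exact h₀.transfer σ h₀' h ((L.app ⟨op X⟩).functor.objObjPreimageIso K).symm

/-- Tensor products with objects from a reflective localization preserve universal arrows. -/
lemma IsPremotivic.universal_tensor_of_reflective (hW : W.IsPremotivic P)
    (hP : PreservesUniversal P L) {X S : D} {f : X ⟶ S} (hf : P f) {K : (W.at' X).carrier}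
    {T : (W.at' S).carrier} {η : K ⟶ (W.star f).obj T} (h : IsUniversalArrow (W.star f) η)
    (M : (W.at' S).carrier) :
    IsUniversalArrow (G.star f) (((L.app ⟨op X⟩).functor.map η ≫
      (L.naturality f.op.toLoc).hom.natTrans.app T) ▷
        (G.star f).obj ((L.app ⟨op S⟩).functor.obj M) ≫
          Functor.LaxMonoidal.μ (G.star f) _ _) := by
  let l := (L.app ⟨op X⟩).functor
  let l' := (L.app ⟨op S⟩).functor
  let n (T : (W.at' S).carrier) : l.obj ((W.star f).obj T) ⟶ (G.star f).obj (l'.obj T) :=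
    (L.naturality f.op.toLoc).hom.natTrans.app T
  have : IsIso (n M) := inferInstanceAs (IsIso ((L.naturality f.op.toLoc).hom.natTrans.app M))
  -- This is the monoidality of the 2-morphism `L.naturality f`. It identifies the arrow to be
  -- tested with the image under `L` of the projection formula arrow of `W`.
  have hn : Functor.LaxMonoidal.μ l ((W.star f).obj T) ((W.star f).obj M) ≫
      l.map (Functor.LaxMonoidal.μ (W.star f) T M) ≫ n (T ⊗ M) =
      (n T ⊗ₘ n M) ≫ Functor.LaxMonoidal.μ (G.star f) (l'.obj T) (l'.obj M) ≫
        (G.star f).map (Functor.LaxMonoidal.μ l' T M) := by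
    have := NatTrans.IsMonoidal.tensor (τ := (L.naturality f.op.toLoc).hom.natTrans) T M
    simpa using this
  have h₁ := (hP f hf _ (hW.universal_tensor hf h M)).iso_comp
    (Functor.LaxMonoidal.μ l K ((W.star f).obj M))
  apply IsUniversalArrow.of_comp_map_iso (Functor.LaxMonoidal.μ l' T M)
  apply IsUniversalArrow.of_iso_comp (l.obj K ◁ n M)
  convert h₁ using 1
  change l.obj K ◁ n M ≫ ((l.map η ≫ n T) ▷ (G.star f).obj (l'.obj M) ≫
    Functor.LaxMonoidal.μ (G.star f) _ _) ≫ (G.star f).map (Functor.LaxMonoidal.μ l' T M) =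
    Functor.LaxMonoidal.μ l K ((W.star f).obj M) ≫ l.map (η ▷ (W.star f).obj M ≫
      Functor.LaxMonoidal.μ (W.star f) T M) ≫ n (T ⊗ M)
  simp only [Functor.map_comp, Category.assoc]
  rw [← Functor.LaxMonoidal.μ_natural_left_assoc, hn, MonoidalCategory.tensorHom_def',
    MonoidalCategory.comp_whiskerRight]
  simp only [Category.assoc]
  rw [MonoidalCategory.whisker_exchange_assoc]

/-- Premotivic pseudofunctors descend to pointwise reflective localizations. -/
lemma IsPremotivic.of_reflective (hL : ∀ X, IsReflective (L.app X)) (hW : W.IsPremotivic P)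
    (hP : PreservesUniversal P L) : G.IsPremotivic P where
  b1 {X S} f := by
    obtain ⟨ι, adj, _, _⟩ := hL ⟨op S⟩
    obtain ⟨ι', adj', _, _⟩ := hL ⟨op X⟩
    apply isLeftAdjoint_of_reflector adj
    have := hW.b1 f
    exact (((Adjunction.ofIsLeftAdjoint (W.star f)).comp adj').ofNatIsoLeft
      (functorIso (L.naturality f.op.toLoc))).isLeftAdjoint
  b2 {X S} f hf := by
    have := IsReflector.essSurj (hL ⟨op X⟩)
    refine IsUniversalArrow.isRightAdjoint _ fun K ↦ ?_
    let e := (L.app ⟨op X⟩).functor.objObjPreimageIso K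
    obtain ⟨T, η, h⟩ := hW.exists_universal f hf ((L.app ⟨op X⟩).functor.objPreimage K)
    exact ⟨_, _, (hP f hf η h).iso_comp e.inv⟩
  b3 {X' X S' S g' f' f g} sq hf hf' fs adj fs' adj' K := by
    rw [isIso_exchangeBase_iff]
    refine IsUniversalArrow.transfer_of_reflective L hL (a := G.star g') (b := G.star g)
      (G.squareIso sq.toCommSq).hom.natTrans (fun K₀ ↦ ?_) (IsUniversalArrow.unit adj K)
    obtain ⟨T, η, h⟩ := hW.exists_universal f hf K₀
    refine ⟨T, η, hP f hf η h, ?_⟩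
    have h₁ := (hP f' hf' _ (hW.universal_base sq hf hf' h)).comp_map_iso
      ((L.naturality g.op.toLoc).hom.natTrans.app T)
    -- The base change of the image of `η` and the image of the base change of `η` agree up to the
    -- naturality isomorphisms of `L` along `g'` at the source and along `g` at the target.
    refine IsUniversalArrow.of_iso_comp
      ((L.naturality g'.op.toLoc).hom.natTrans.app K₀) ?_
    have h₂ := squareIso_naturality L sq.toCommSq T
    have h₃ := naturality_comp_comp (L.naturality g'.op.toLoc).hom η
    refine (congrArg (IsUniversalArrow (G.star f')) ?_).mp h₁
    symm
    change _ ≫ (G.star g').map ((L.app ⟨op X⟩).functor.map η ≫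
      (L.naturality f.op.toLoc).hom.natTrans.app T) ≫ _ =
      ((L.app ⟨op X'⟩).functor.map ((W.star g').map η ≫
        (W.squareIso sq.toCommSq).hom.natTrans.app T) ≫ _) ≫ _
    rw [Functor.map_comp, Functor.map_comp, Category.assoc, Category.assoc, Category.assoc]
    erw [h₂, reassoc_of% h₃]
  b4 {X S} f hf fs adj K M := by
    have := IsReflector.essSurj (hL ⟨op S⟩)
    let e := (L.app ⟨op S⟩).functor.objObjPreimageIso M
    rw [isIso_exchangeTensor_iff]
    let σ : G.star f ⋙ tensorRight ((G.star f).obj M) ⟶ tensorRight M ⋙ G.star f :=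
      { app T := Functor.LaxMonoidal.μ (G.star f) T M }
    refine IsUniversalArrow.transfer_of_reflective L hL σ (fun K₀ ↦ ?_)
      (IsUniversalArrow.unit adj K)
    obtain ⟨T, η, h⟩ := hW.exists_universal f hf K₀
    refine ⟨T, η, hP f hf η h, ?_⟩
    have h₁ := (hW.universal_tensor_of_reflective L hP hf h
      ((L.app ⟨op S⟩).functor.objPreimage M)).comp_map_iso (_ ◁ e.hom)
    refine IsUniversalArrow.of_iso_comp (_ ◁ (G.star f).map e.hom) ?_
    refine (congrArg (IsUniversalArrow (G.star f)) ?_).mp h₁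
    symm
    rw [Category.assoc, ← Functor.LaxMonoidal.μ_natural_right]
    exact MonoidalCategory.whisker_exchange_assoc _ _ _

/-- A transformation whose restriction to a pointwise reflective localization is premotivic is
premotivic. -/
lemma IsPremotivicTrans.of_reflective (hL : ∀ X, IsReflective (L.app X)) (hW : W.IsPremotivic P)
    (hP : PreservesUniversal P L) {β : G ⟶ H} (hβ : PreservesUniversal P (L ≫ β))
    (hβ' : ∀ X, ((L ≫ β).app X).functor.IsLeftAdjoint) : IsPremotivicTrans P β where
  c1 S := by
    obtain ⟨ι, adj, _, _⟩ := hL ⟨op S⟩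
    exact isLeftAdjoint_of_reflector adj (hβ' ⟨op S⟩)
  c2 {X S} f hf fs adj fs' adj' K := by
    rw [isIso_exchangeTrans_iff]
    refine IsUniversalArrow.transfer_of_reflective L hL (a := (β.app ⟨op X⟩).functor)
      (b := (β.app ⟨op S⟩).functor) (β.naturality f.op.toLoc).hom.natTrans (fun K₀ ↦ ?_)
      (IsUniversalArrow.unit adj K)
    obtain ⟨T, η, h⟩ := hW.exists_universal f hf K₀
    refine ⟨T, η, hP f hf η h, ?_⟩
    have := hβ f hf η h
    rw [comp_naturality_app] at this
    simpa using this

end Transfer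

end TriPseudofunctor

/-! ### Localization of symmetric monoidal triangulated categories -/

namespace TensorTriCat

open MonoidalCategory ZeroObject Pretriangulated

/-- Whiskering on the other side is conjugate to the given one by the braiding. -/
lemma isMonoidal_inverseImage (A : TensorTriCat.{v, u}) {D : Type*} [Category* D]
    {L : A.carrier ⥤ D}
    (h : ∀ (K : A.carrier) ⦃X Y : A.carrier⦄ (w : X ⟶ Y), IsIso (L.map w) →
      IsIso (L.map (K ◁ w))) :
    ((MorphismProperty.isomorphisms D).inverseImage L).IsMonoidal where
  whiskerLeft K _ _ w hw := h K w hw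
  whiskerRight {X Y} w hw K := by
    have : IsIso (L.map (K ◁ w)) := h K w hw
    change IsIso (L.map (w ▷ K))
    have h' : w ▷ K = (β_ X K).hom ≫ K ◁ w ≫ (β_ K Y).hom := by
      rw [← BraidedCategory.braiding_naturality_left_assoc, SymmetricCategory.symmetry,
        Category.comp_id]
    rw [h']
    simp only [Functor.map_comp]
    infer_instance

/-- An arrow `f` is isomorphic to `L (ι f)` through the counit. This permits testing exactness of a
functor on `D` after precomposition with `L`. -/
lemma mapArrow_essSurj (A : TensorTriCat.{v, u}) {D : Type*} [Category* D] {L : A.carrier ⥤ D}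
    {ι : D ⥤ A.carrier} (adj : L ⊣ ι) [ι.Full] [ι.Faithful] : L.mapArrow.EssSurj where
  mem_essImage f :=
    have h (M : D) : IsIso (adj.counit.app M) := inferInstance
    ⟨Arrow.mk (ι.map f.hom), ⟨Arrow.isoMk (@asIso _ _ _ _ (adj.counit.app f.left) (h _))
      (@asIso _ _ _ _ (adj.counit.app f.right) (h _)) (adj.counit.naturality f.hom).symm⟩⟩

/-! ### Monoidal structure on a reflective localization. -/

section OfReflector

variable (A : TensorTriCat.{v, u}) {D : Type u} [cat : Category.{v} D] [Preadditive D] [HasZeroObject D]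
  [HasShift D ℤ] [∀ n : ℤ, (shiftFunctor D n).Additive] [Pretriangulated D] [IsTriangulated D]
  {L : A.carrier ⥤ D} [cs : L.CommShift ℤ] [tri : L.IsTriangulated] {ι : D ⥤ A.carrier}

open Localization.Monoidal in
/-- The localization of a symmetric monoidal triangulated category given by a reflector
compatible with the tensor product. -/
def ofReflector (adj : L ⊣ ι) [ι.Full] [ι.Faithful]
    (h : ∀ (K : A.carrier) ⦃X Y : A.carrier⦄ (w : X ⟶ Y), IsIso (L.map w) →
      IsIso (L.map (K ◁ w))) : TensorTriCat.{v, u} :=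
  letI W := (MorphismProperty.isomorphisms D).inverseImage L
  haveI : W.IsMonoidal := A.isMonoidal_inverseImage h
  haveI : L.IsLocalization W := adj.isLocalization
  letI m : MonoidalCategory (LocalizedMonoidal L W (Iso.refl _)) := inferInstance
  letI s : SymmetricCategory (LocalizedMonoidal L W (Iso.refl _)) := inferInstance
  @TensorTriCat.mk D cat ‹_› ‹_› ‹_› ‹_› ‹_› ‹_› m s
    (fun K ↦ by
      let : MonoidalCategory D := m
      let mon : (toMonoidalCategory L W (Iso.refl _)).Monoidal := inferInstance
      let : L.Monoidal := mon
      let K' : A.carrier := ι.obj K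
      obtain ⟨_, _⟩ := A.exact_tensor K'
      -- Tensoring with `L (ι K)` is induced by the exact functor of tensoring with `ι K`, hence is
      -- exact; the counit `L (ι K) ≅ K` carries this over to `K`.
      let e : L ⋙ tensorLeft (L.obj K') ≅ tensorLeft K' ⋙ L :=
        NatIso.ofComponents (fun X ↦ Functor.Monoidal.μIso L K' X)
      let : Localization.Lifting L W (tensorLeft K' ⋙ L) (tensorLeft (L.obj K')) := ⟨e⟩
      let : (tensorLeft (L.obj K')).CommShift ℤ :=
        Functor.commShiftOfLocalization L W ℤ (tensorLeft K' ⋙ L) _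
      have : NatTrans.CommShift e.hom ℤ :=
        NatTrans.commShift_iso_hom_of_localization L W ℤ (tensorLeft K' ⋙ L) _
      have := A.mapArrow_essSurj adj
      have : (tensorLeft (L.obj K')).IsTriangulated := Functor.isTriangulated_of_precomp_iso e
      let e' : tensorLeft (L.obj K') ≅ tensorLeft K :=
        (tensoringLeft D).mapIso (asIso (adj.counit.app K))
      let := Functor.CommShift.ofIso e' ℤ
      have := Functor.CommShift.ofIso_compatibility e' ℤ
      exact ⟨inferInstance, Functor.isTriangulated_of_iso e'⟩)

open Localization.Monoidal in
/-- The localization functor to `ofReflector`. -/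
def toOfReflector (adj : L ⊣ ι) [ι.Full] [ι.Faithful]
    (h : ∀ (K : A.carrier) ⦃X Y : A.carrier⦄ (w : X ⟶ Y), IsIso (L.map w) →
      IsIso (L.map (K ◁ w))) : A ⟶ A.ofReflector adj h :=
  letI W := (MorphismProperty.isomorphisms D).inverseImage L
  haveI : W.IsMonoidal := A.isMonoidal_inverseImage h
  haveI : L.IsLocalization W := adj.isLocalization
  letI b : (toMonoidalCategory L W (Iso.refl _)).Braided := inferInstance
  @Hom.mk A (A.ofReflector adj h) L b cs tri

end OfReflector

/-! ### Reflection onto the kernel of restriction to an open part. -/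

section Kernel

variable {A U : TensorTriCat.{v, u}} (j : A ⟶ U)

/-- The kernel of a 1-morphism. -/
def kernel : ObjectProperty A.carrier := fun K ↦ IsZero ((Hom.functor j).obj K)

instance : (kernel j).IsTriangulated where
  exists_zero := ⟨0, isZero_zero _, (Hom.functor j).map_isZero (isZero_zero _)⟩
  isStableUnderShiftBy n :=
    { le_shift K hK := ((shiftFunctor _ n).map_isZero hK).of_iso
        (((Hom.functor j).commShiftIso n).app K) }
  ext₂' T hT h₁ h₃ := ObjectProperty.le_isoClosure _ _
    (Triangle.isZero₂_of_isZero₁₃ _ ((Hom.functor j).map_distinguished T hT) h₁ h₃)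

variable {j}

/-- The cone of the counit is the reflection to the kernel. -/
lemma exists_reflection (hj : ∀ M : U.carrier, ∃ (T : A.carrier)
      (η : M ⟶ (Hom.functor j).obj T), IsUniversalArrow (Hom.functor j) η ∧ IsIso η)
    (K : A.carrier) :
    ∃ (T : A.carrier) (c : T ⟶ K) (C : (kernel j).FullSubcategory) (p : K ⟶ (kernel j).ι.obj C)
      (d : (kernel j).ι.obj C ⟶ T⟦(1 : ℤ)⟧),
      Triangle.mk c p d ∈ distTriang _ ∧ IsIso ((Hom.functor j).map c) ∧
      IsUniversalArrow (Hom.functor j) (𝟙 ((Hom.functor j).obj T)) ∧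
      IsUniversalArrow (kernel j).ι p := by
  -- Here `T` is j_♯ j^* K and `c` is the counit. As j^* j_♯ ≅ id, the image of `c` is inverse to
  -- `η`, so the cone of `c` lies in the kernel.
  obtain ⟨T, η, h, _⟩ := hj ((Hom.functor j).obj K)
  obtain ⟨c, hc⟩ := h.exists_lift (𝟙 _)
  have hc' : IsIso ((Hom.functor j).map c) := by
    have : (Hom.functor j).map c = inv η := by
      rw [← cancel_epi η]; simpa using hc
    rw [this]; infer_instance
  obtain ⟨C, p, d, hT⟩ := distinguished_cocone_triangle c
  have hC : kernel j C := Triangle.isZero₃_of_isIso₁ _ ((Hom.functor j).map_distinguished _ hT) hc'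
  have hid : IsUniversalArrow (Hom.functor j) (𝟙 ((Hom.functor j).obj T)) := by
    have := h.iso_comp (inv η)
    simpa using this
  -- An induced object admits only zero maps into the kernel; the long exact sequence of Hom from
  -- the triangle then gives both halves of universality.
  have hzero {M : A.carrier} (hM : kernel j M) (f : T ⟶ M) : f = 0 :=
    hid.hom_ext (IsZero.eq_of_tgt hM _ _)
  refine ⟨T, c, ⟨C, hC⟩, p, d, hT, hc', hid, fun M ↦ ⟨fun a b hab ↦ ?_, fun a ↦ ?_⟩⟩
  · rw [← sub_eq_zero]
    have h₁ : p ≫ (a - b).hom = 0 := by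
      have : p ≫ a.hom = p ≫ b.hom := hab
      change p ≫ (a.hom - b.hom) = 0
      rw [Preadditive.comp_sub, this, sub_self]
    -- The difference factors through `T⟦1⟧`. Desuspending the factor gives a map from `T` to
    -- `M⟦-1⟧`, which is zero since the kernel is closed under shifts.
    obtain ⟨(f : T⟦(1 : ℤ)⟧ ⟶ M.obj), hf⟩ := Triangle.yoneda_exact₃ _ hT (a - b).hom h₁
    have hM : kernel j (M.obj⟦(-1 : ℤ)⟧) := (kernel j).le_shift (-1) _ M.property
    have hf' : f = 0 := by
      apply (shiftFunctor A.carrier (-1 : ℤ)).map_injective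
      rw [Functor.map_zero, ← cancel_epi ((shiftShiftNeg T (1 : ℤ)).inv), comp_zero]
      exact hzero hM _
    ext
    exact hf.trans ((congrArg (d ≫ ·) hf').trans comp_zero)
  · obtain ⟨f, hf⟩ := Triangle.yoneda_exact₂ _ hT a (hzero M.property _)
    exact ⟨ObjectProperty.homMk f, hf.symm⟩

/-- The localization of `A` at the kernel of a triangulated functor with a fully faithful left
adjoint which satisfies the projection formula. -/
lemma exists_kernel_localization (hj : ∀ M : U.carrier, ∃ (T : A.carrier)
      (η : M ⟶ (Hom.functor j).obj T), IsUniversalArrow (Hom.functor j) η ∧ IsIso η)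
    (htensor : ∀ ⦃M : U.carrier⦄ ⦃T : A.carrier⦄ (η : M ⟶ (Hom.functor j).obj T),
      IsUniversalArrow (Hom.functor j) η → ∀ K : A.carrier, IsUniversalArrow (Hom.functor j)
        (η ▷ (Hom.functor j).obj K ≫ Functor.LaxMonoidal.μ (Hom.functor j) T K)) :
    ∃ (B : TensorTriCat.{v, u}) (l : A ⟶ B) (ι : B.carrier ⥤ A.carrier)
      (_ : Hom.functor l ⊣ ι), ι.Full ∧ ι.Faithful ∧ Function.Injective ι.obj ∧
      Set.range ι.obj = {K | IsZero ((Hom.functor j).obj K)} := by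
  have hr : (kernel j).ι.IsRightAdjoint := IsUniversalArrow.isRightAdjoint _ fun K ↦ by
    obtain ⟨T, c, C, p, d, hT, hc, hid, hp⟩ := exists_reflection hj K
    exact ⟨C, p, hp⟩
  let L := (kernel j).ι.leftAdjoint
  let adj : L ⊣ (kernel j).ι := Adjunction.ofIsRightAdjoint _
  let : L.CommShift ℤ := adj.leftAdjointCommShift ℤ
  have : adj.CommShift ℤ := adj.commShift_of_rightAdjoint ℤ
  have : L.IsTriangulated := adj.isTriangulated_leftAdjoint
  -- the acyclic objects form a tensor ideal
  have hL (C K : A.carrier) (hC : IsZero (L.obj C)) : IsZero (L.obj (K ⊗ C)) := by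
    obtain ⟨T, c, C', p, d, hT, hc, hid, hp⟩ := exists_reflection hj C
    -- If the reflection of `C` vanishes, then `c` is an isomorphism and `C` is itself induced. By
    -- the projection formula so is `T ⊗ K`, which therefore has zero reflection.
    have hC' : IsZero C' := hC.of_iso (hp.exists_iso (IsUniversalArrow.unit adj C)).choose
    have : IsIso c := Triangle.isZero₃_iff_isIso₁ _ hT |>.1 ((kernel j).ι.map_isZero hC')
    have h₁ : IsUniversalArrow (Hom.functor j) (𝟙 ((Hom.functor j).obj (T ⊗ K))) := by
      have := (htensor _ hid K).iso_comp (inv (Functor.LaxMonoidal.μ (Hom.functor j) T K))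
      simpa using this
    have h₂ : IsZero (L.obj (T ⊗ K)) := by
      rw [IsZero.iff_id_eq_zero]
      apply (IsUniversalArrow.unit adj (T ⊗ K)).hom_ext
      exact h₁.hom_ext (IsZero.eq_of_tgt (L.obj (T ⊗ K)).property _ _)
    exact h₂.of_iso (L.mapIso (K ◁ᵢ (asIso c).symm ≪≫ β_ K T))
  have h (K : A.carrier) ⦃X Y : A.carrier⦄ (w : X ⟶ Y) (hw : IsIso (L.map w)) :
      IsIso (L.map (K ◁ w)) := by
    -- A morphism is inverted by `L` precisely when its cone is acyclic, and the exact functor `K ⊗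
    -- -` takes cones to cones.
    obtain ⟨C, p, d, hT⟩ := distinguished_cocone_triangle w
    have hC : IsZero (L.obj C) := Triangle.isZero₃_of_isIso₁ _ (L.map_distinguished _ hT) hw
    obtain ⟨_, _⟩ := A.exact_tensor K
    exact (Triangle.isZero₃_iff_isIso₁ _ (L.map_distinguished _
      ((tensorLeft K).map_distinguished _ hT))).1 (hL C K hC)
  refine ⟨A.ofReflector adj h, A.toOfReflector adj h, (kernel j).ι, adj,
    inferInstanceAs (kernel j).ι.Full, inferInstanceAs (kernel j).ι.Faithful, ?_, ?_⟩
  · rintro ⟨X, hX⟩ ⟨Y, hY⟩ (h : X = Y)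
    subst h
    rfl
  · ext K
    exact ⟨fun ⟨X, hX⟩ ↦ hX ▸ X.property, fun hK ↦ ⟨⟨K, hK⟩, rfl⟩⟩

end Kernel

end TensorTriCat

/-! ### The category of closed immersions -/

namespace ImmersionData

variable {C : Type u₁} [Category.{v₁} C] {I : ImmersionData C} {e : ObjectProperty C}

namespace Pairs

/-- The functor sending `Z ⟶ S` to `S`. -/
def targetFunctor : I.Pairs e ⥤ e.FullSubcategory where
  obj := target
  map f := ObjectProperty.homMk f.hom.right

/-- The object of `C̃` given by a closed immersion. -/
abbrev of {Z : C} {S : e.FullSubcategory} (z : Z ⟶ S.obj) (hz : I.closed z) : I.Pairs e :=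
  ⟨Arrow.mk z, hz, S.property⟩

/-- A morphism of `C̃` is determined by its components. -/
abbrev homMk {X Y : I.Pairs e} (l : X.obj.left ⟶ Y.obj.left) (r : X.obj.right ⟶ Y.obj.right)
    (w : l ≫ Y.obj.hom = X.obj.hom ≫ r) : X ⟶ Y :=
  ObjectProperty.homMk (Arrow.homMk l r w)

variable (hI : I.IsCategoryWithImmersions) (hE : I.IsBase e)

section

include hI

lemma mono_hom (X : I.Pairs e) : Mono X.obj.hom := hI.closed_mono _ X.property.1

lemma hom_ext {X Y : I.Pairs e} {f g : X ⟶ Y} (h : f.hom.right = g.hom.right) : f = g := by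
  have := mono_hom hI Y
  apply ObjectProperty.hom_ext
  ext
  · rw [← cancel_mono Y.obj.hom, Arrow.w, Arrow.w, h]
  · exact h

/-- Two morphisms to targets of objects of `C̃` lift to a common closed immersion. -/
lemma exists_lift {T : e.FullSubcategory} {X Y : I.Pairs e} (a : T ⟶ X.target)
    (b : T ⟶ Y.target) :
    ∃ (Z : C) (z : Z ⟶ T.obj) (hz : I.closed z) (α : of z hz ⟶ X) (β : of z hz ⟶ Y),
      α.hom.right = a.hom ∧ β.hom.right = b.hom := by
  have := hI.hasPullbacks
  have := hI.closed_baseChange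
  have := hI.closed_comp
  have ha : I.closed (pullback.fst a.hom X.obj.hom) :=
    MorphismProperty.pullback_fst _ _ X.property.1
  have hb : I.closed (pullback.fst b.hom Y.obj.hom) :=
    MorphismProperty.pullback_fst _ _ Y.property.1
  -- The closed immersion is the intersection in `T` of the preimages of the two given closed
  -- immersions.
  refine ⟨pullback (pullback.fst a.hom X.obj.hom) (pullback.fst b.hom Y.obj.hom),
    pullback.fst _ _ ≫ pullback.fst a.hom X.obj.hom,
    MorphismProperty.comp_mem _ _ _ (MorphismProperty.pullback_fst _ _ hb) ha,
    homMk (pullback.fst _ _ ≫ pullback.snd a.hom X.obj.hom) a.hom ?_,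
    homMk (pullback.snd _ _ ≫ pullback.snd b.hom Y.obj.hom) b.hom ?_, rfl, rfl⟩
  · exact (Category.assoc _ _ _).trans ((congr_arg (pullback.fst _ _ ≫ ·)
      pullback.condition.symm).trans (Category.assoc _ _ _).symm)
  · have h : pullback.fst (pullback.fst a.hom X.obj.hom) (pullback.fst b.hom Y.obj.hom) ≫
        pullback.fst a.hom X.obj.hom = pullback.snd _ _ ≫ pullback.fst b.hom Y.obj.hom :=
      pullback.condition
    exact (Category.assoc _ _ _).trans ((congr_arg (pullback.snd _ _ ≫ ·)
      pullback.condition.symm).trans ((Category.assoc _ _ _).symm.trans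
        (congr_arg (· ≫ b.hom) h.symm)))

/-- The functor `targetFunctor` preserves Cartesian squares. -/
lemma isPullback_target {X' X S' S : I.Pairs e} {g' : X' ⟶ X} {f' : X' ⟶ S'} {f : X ⟶ S}
    {g : S' ⟶ S} (h : IsPullback g' f' f g) :
    IsPullback (targetFunctor.map g') (targetFunctor.map f') (targetFunctor.map f)
      (targetFunctor.map g) := by
  have huniq {T : e.FullSubcategory} {a b : T ⟶ targetFunctor.obj X'}
      (h₁ : a ≫ targetFunctor.map g' = b ≫ targetFunctor.map g')
      (h₂ : a ≫ targetFunctor.map f' = b ≫ targetFunctor.map f') : a = b := by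
    -- A morphism from `T` need not extend to one from `id_T` in `C̃`, but it does from a smaller
    -- closed immersion into `T`. Applying the universal property there suffices, as morphisms of
    -- `C̃` are determined by their target components.
    obtain ⟨Z, z, hz, α, β, hα, hβ⟩ := exists_lift hI a b
    have : α = β := h.hom_ext
      (hom_ext hI (by
        change α.hom.right ≫ g'.hom.right = β.hom.right ≫ g'.hom.right
        rw [hα, hβ]
        exact congr_arg (fun t ↦ t.hom) h₁))
      (hom_ext hI (by
        change α.hom.right ≫ f'.hom.right = β.hom.right ≫ f'.hom.right
        rw [hα, hβ]
        exact congr_arg (fun t ↦ t.hom) h₂))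
    apply ObjectProperty.hom_ext
    rw [← hα, ← hβ, this]
  have hex {T : e.FullSubcategory} (a : T ⟶ targetFunctor.obj X) (b : T ⟶ targetFunctor.obj S')
      (hab : a ≫ targetFunctor.map f = b ≫ targetFunctor.map g) :
      ∃ c : T ⟶ targetFunctor.obj X', c ≫ targetFunctor.map g' = a ∧
        c ≫ targetFunctor.map f' = b := by
    obtain ⟨Z, z, hz, α, β, hα, hβ⟩ := exists_lift hI a b
    have w : α ≫ f = β ≫ g := hom_ext hI (by
      change α.hom.right ≫ f.hom.right = β.hom.right ≫ g.hom.right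
      rw [hα, hβ]
      exact congr_arg (fun t ↦ t.hom) hab)
    refine ⟨ObjectProperty.homMk (h.lift α β w).hom.right, ?_, ?_⟩
    · apply ObjectProperty.hom_ext
      rw [← hα]
      exact congr_arg (fun t ↦ t.hom.right) (h.lift_fst α β w)
    · apply ObjectProperty.hom_ext
      rw [← hβ]
      exact congr_arg (fun t ↦ t.hom.right) (h.lift_snd α β w)
  refine ⟨(h.toCommSq.map targetFunctor), ⟨PullbackCone.IsLimit.mk _
    (fun s ↦ (hex s.fst s.snd s.condition).choose)
    (fun s ↦ (hex s.fst s.snd s.condition).choose_spec.1)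
    (fun s ↦ (hex s.fst s.snd s.condition).choose_spec.2)
    (fun s m h₁ h₂ ↦ huniq ?_ ?_)⟩⟩
  · exact h₁.trans (hex s.fst s.snd s.condition).choose_spec.1.symm
  · exact h₂.trans (hex s.fst s.snd s.condition).choose_spec.2.symm

end

/-- A morphism of `C̃` is Cartesian if it is given by a Cartesian square. -/
def IsCartesian {X₂ X₁ : I.Pairs e} (f : X₂ ⟶ X₁) : Prop :=
  IsPullback X₂.obj.hom f.hom.left f.hom.right X₁.obj.hom

lemma isCartesian_of_isIso {X₂ X₁ : I.Pairs e} (f : X₂ ⟶ X₁) [IsIso f] : IsCartesian f := by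
  have : IsIso f.hom := inferInstanceAs (IsIso ((ObjectProperty.ι _).map f))
  have : IsIso f.hom.left := inferInstance
  have : IsIso f.hom.right := inferInstance
  exact IsPullback.of_vert_isIso ⟨(Arrow.w f.hom).symm⟩

/-- Cartesian morphisms give Cartesian squares with the canonical closed immersions. -/
lemma IsCartesian.isPullback_rho {X₂ X₁ : I.Pairs e} {f : X₂ ⟶ X₁} (hf : IsCartesian f) :
    IsPullback f (rho hI X₂) (rho hI X₁) ((ofBase hI).map (targetFunctor.map f)) := by
  refine ⟨⟨hom_ext hI ((Category.comp_id _).trans (Category.id_comp _).symm)⟩, 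
    ⟨PullbackCone.IsLimit.mk _ (fun s ↦ homMk (hf.lift s.snd.hom.left s.fst.hom.left ?_) s.snd.hom.right ?_)
    (fun s ↦ hom_ext hI ?_) (fun s ↦ hom_ext hI ?_) (fun s m h₁ h₂ ↦ hom_ext hI ?_)⟩⟩
  · exact (congr_arg (fun t ↦ t.hom.left) s.condition).symm
  · exact (IsPullback.lift_fst hf _ _ _).trans
      ((Category.comp_id _).symm.trans (Arrow.w s.snd.hom))
  · have h := (congr_arg (fun t ↦ t.hom.right) s.condition).symm
    exact h.trans (Category.comp_id _)
  · exact Category.comp_id _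
  · have h := (congr_arg (fun t ↦ t.hom.right) h₂)
    exact (Category.comp_id _).symm.trans h

/-- The canonical closed immersion of `id : S ⟶ S` is the identity. -/
lemma rho_ofBase (S : e.FullSubcategory) : rho hI ((ofBase hI).obj S) = 𝟙 _ :=
  hom_ext hI rfl

lemma rho_naturality {X₂ X₁ : I.Pairs e} (f : X₂ ⟶ X₁) :
    f ≫ rho hI X₁ = rho hI X₂ ≫ (ofBase hI).map (targetFunctor.map f) :=
  hom_ext hI ((Category.comp_id _).trans (Category.id_comp _).symm)

/-- The complement as a morphism of the base. -/
abbrev j (X : I.Pairs e) : (complement hE X).left ⟶ X.target := (complement hE X).hom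

lemma j_opn (X : I.Pairs e) : I.opn (j hE X).hom := I.opn_compl _ _

lemma isPullback_of_ι {A B C' D : e.FullSubcategory} {f : A ⟶ B} {g : A ⟶ C'} {h : B ⟶ D}
    {k : C' ⟶ D} (H : IsPullback f.hom g.hom h.hom k.hom) : IsPullback f g h k :=
  IsPullback.of_map e.ι (by
    apply ObjectProperty.hom_ext
    exact H.w) H

include hI

/-- The base change of the complement, with its comparison with the complement. -/
lemma exists_complement {X₂ X₁ : I.Pairs e} (f : X₂ ⟶ X₁) :
    ∃ (T : e.FullSubcategory) (p : T ⟶ (complement hE X₁).left) (q : T ⟶ X₂.target)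
      (j' : T ⟶ (complement hE X₂).left),
      IsPullback p q (j hE X₁) (targetFunctor.map f) ∧ I.opn q.hom ∧ j' ≫ j hE X₂ = q ∧
      (IsCartesian f → IsIso j') := by
  have := hI.hasPullbacks
  have := hI.opn_baseChange
  have hq : I.opn (pullback.snd (j hE X₁).hom f.hom.right) :=
    MorphismProperty.pullback_snd (j hE X₁).hom (show X₂.obj.right ⟶ X₁.target.obj from f.hom.right)
      (j_opn hE X₁)
  obtain ⟨j', hj', w, hiso⟩ := hI.complement
    (⟨(Arrow.w f.hom).symm⟩ : CommSq X₂.obj.hom f.hom.left f.hom.right X₁.obj.hom)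
    X₁.property.1 X₂.property.1
    (IsPullback.of_hasPullback (j hE X₁).hom f.hom.right)
  let T : e.FullSubcategory := ⟨pullback (j hE X₁).hom f.hom.right, hE.of_opn _ hq X₂.property.2⟩
  let j'' : T ⟶ (complement hE X₂).left := ObjectProperty.homMk j'
  refine ⟨T, ObjectProperty.homMk (pullback.fst _ _), ObjectProperty.homMk (pullback.snd _ _),
    j'', ?_, hq, ?_, fun hf ↦ ?_⟩
  · exact isPullback_of_ι (IsPullback.of_hasPullback (j hE X₁).hom f.hom.right)
  · apply ObjectProperty.hom_ext
    exact w
  · have : IsIso (e.ι.map j'') := hiso hf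
    exact isIso_of_reflects_iso j'' e.ι

/-- The complement of a Cartesian base change is the base change of the complement. -/
lemma IsCartesian.exists_complement {X₂ X₁ : I.Pairs e} {f : X₂ ⟶ X₁} (hf : IsCartesian f) :
    ∃ c : (complement hE X₂).left ⟶ (complement hE X₁).left,
      IsPullback c (j hE X₂) (j hE X₁) (targetFunctor.map f) := by
  obtain ⟨T, p, q, j', h, _, w, hj'⟩ := Pairs.exists_complement hI hE f
  have := hj' hf
  exact ⟨inv j' ≫ p, IsPullback.of_iso h (asIso j') (Iso.refl _) (Iso.refl _) (Iso.refl _)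
    (by simp) (by simpa using w.symm) (by simp)
    ((Category.comp_id _).trans (Category.id_comp _).symm)⟩

/-- The restriction of a closed immersion to its complement. -/
lemma exists_restriction (X : I.Pairs e) :
    ∃ (Z : C) (z : Z ⟶ (complement hE X).left.obj) (hz : I.closed z) (f : of z hz ⟶ X),
      IsCartesian f ∧ targetFunctor.map f = j hE X ∧ IsIso (j hE (of z hz)) := by
  have := hI.hasPullbacks
  have := hI.closed_baseChange
  have hm : Mono (j hE X) :=
    e.ι.mono_of_mono_map (hI.opn_mono _ (j_opn hE X) : Mono (j hE X).hom)
  have hz : I.closed (pullback.fst (j hE X).hom X.obj.hom) :=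
    MorphismProperty.pullback_fst _ _ X.property.1
  let f : of (S := (complement hE X).left) (pullback.fst (j hE X).hom X.obj.hom) hz ⟶ X :=
    homMk (pullback.snd _ _) (j hE X).hom pullback.condition.symm
  have hf : IsCartesian f := IsPullback.of_hasPullback _ _
  refine ⟨_, _, hz, f, hf, rfl, ?_⟩
  obtain ⟨c, hc⟩ := hf.exists_complement hI hE
  -- The complement of the restriction is the base change of the monomorphism `j` along itself.
  exact IsKernelPair.isIso_of_mono (f := j hE X) hc.flip

end Pairs

end ImmersionData

/-! ### Inverse image functors -/

namespace TriPseudofunctor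

open TensorTriCat Bicategory Opposite MonoidalCategory

section

variable {D : Type u₁} [Category.{v₁} D] (H : TriPseudofunctor.{v, u} D)

/-- The isomorphism `(f ≫ g)^* ≅ g^* ⋙ f^*`. -/
def starComp {X Y S : D} (f : X ⟶ Y) (g : Y ⟶ S) : H.star (f ≫ g) ≅ H.star g ⋙ H.star f :=
  functorIso (H.mapComp g.op.toLoc f.op.toLoc)

/-- The isomorphism `𝟙^* ≅ 𝟭`. -/
def starId (S : D) : H.star (𝟙 S) ≅ 𝟭 _ := functorIso (H.mapId ⟨op S⟩)

variable {H}

lemma isZero_star {X S : D} (f : X ⟶ S) {K : (H.at' S).carrier} (hK : IsZero K) :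
    IsZero ((H.star f).obj K) := (H.star f).map_isZero hK

lemma isZero_star_comp_iff {X Y S : D} (f : X ⟶ Y) (g : Y ⟶ S) (K : (H.at' S).carrier) :
    IsZero ((H.star (f ≫ g)).obj K) ↔ IsZero ((H.star f).obj ((H.star g).obj K)) :=
  ((H.starComp f g).app K).isZero_iff

lemma isIso_star_comp_iff {X Y S : D} (f : X ⟶ Y) (g : Y ⟶ S) {K L : (H.at' S).carrier}
    (a : K ⟶ L) :
    IsIso ((H.star (f ≫ g)).map a) ↔ IsIso ((H.star f).map ((H.star g).map a)) :=
  NatIso.isIso_map_iff (H.starComp f g) a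

lemma isIso_of_isIso_star {X S : D} (f : X ⟶ S) [IsIso f] {K L : (H.at' S).carrier} (a : K ⟶ L)
    (h : IsIso ((H.star f).map a)) : IsIso a := by
  have h₁ : IsIso ((H.star (inv f ≫ f)).map a) := by
    rw [isIso_star_comp_iff]
    infer_instance
  rw [IsIso.inv_hom_id] at h₁
  exact (NatIso.isIso_map_iff (H.starId S) a).1 h₁

lemma isZero_of_isZero_star {X S : D} (f : X ⟶ S) [IsIso f] {K : (H.at' S).carrier}
    (h : IsZero ((H.star f).obj K)) : IsZero K := by
  have h₁ : IsZero ((H.star (inv f ≫ f)).obj K) :=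
    (isZero_star_comp_iff _ _ _).2 (isZero_star _ h)
  rw [IsIso.inv_hom_id] at h₁
  exact ((H.starId S).app K).isZero_iff.1 h₁

instance {X S : D} (f : X ⟶ S) [IsIso f] : (H.star f).IsEquivalence :=
  Equivalence.isEquivalence_functor (CategoryTheory.Equivalence.mk (H.star f) (H.star (inv f))
    ((H.starId S).symm ≪≫ eqToIso (by simp) ≪≫ H.starComp (inv f) f)
    ((H.starComp f (inv f)).symm ≪≫ eqToIso (by simp) ≪≫ H.starId X))

/-- If the value of a pseudofunctor at `S` is zero, so is its value at any object over `S`. -/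
lemma isZero_of_hom {X S : D} (f : X ⟶ S) (hS : ∀ K : (H.at' S).carrier, IsZero K)
    (K : (H.at' X).carrier) : IsZero K := by
  obtain ⟨_, _⟩ := (H.at' X).exact_tensor K
  -- Inverse image is unital, so the unit over `X` is zero, and every object is its tensor product
  -- with the unit.
  have h : IsZero (𝟙_ (H.at' X).carrier) :=
    (isZero_star f (hS (𝟙_ _))).of_iso (Functor.Monoidal.εIso (H.star f))
  exact ((tensorLeft K).map_isZero h).of_iso (ρ_ K).symm

/-- A functor with a universal arrow from a zero object. -/
lemma _root_.IsUniversalArrow.isZero {A B : TensorTriCat.{v, u}} {f : A ⟶ B}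
    {K : B.carrier} {T : A.carrier} {η : K ⟶ (Hom.functor f).obj T}
    (h : IsUniversalArrow (Hom.functor f) η) (hK : IsZero K) : IsZero T := by
  rw [IsZero.iff_id_eq_zero]
  exact h.hom_ext (hK.eq_of_src _ _)

end

section

variable {D : Type u₁} [Category.{v₁} D] {D' : Type u₂} [Category.{v₂} D'] (F : D ⥤ D')
  (H : TriPseudofunctor.{v, u} D')

lemma precomp_squareIso {X' X S' S : D} {g' : X' ⟶ X} {f' : X' ⟶ S'} {f : X ⟶ S} {g : S' ⟶ S}
    (sq : CommSq g' f' f g) :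
    (precomp F H).squareIso sq = H.squareIso (sq.map F) := by
  ext : 1
  let Φ := F.op.toPseudofunctor
  let t := f.op.toLoc
  let r := g'.op.toLoc
  let l := g.op.toLoc
  let k := f'.op.toLoc
  have w : t ≫ r = l ≫ k := sq.flip.op.toLoc.w
  have w' : Φ.map t ≫ Φ.map r = Φ.map l ≫ Φ.map k := (sq.map F).flip.op.toLoc.w
  -- The two isomorphisms differ by 2-morphisms of a locally discrete bicategory, where parallel
  -- 2-morphisms coincide.
  have h : (Φ.mapComp t r).inv ≫ Φ.map₂ (eqToHom w) ≫ (Φ.mapComp l k).hom = eqToHom w' :=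
    Subsingleton.elim _ _
  change ((H.mapComp (Φ.map t) (Φ.map r)).inv ≫ H.map₂ (Φ.mapComp t r).inv) ≫
    H.map₂ (Φ.map₂ (eqToHom w)) ≫ H.map₂ (Φ.mapComp l k).hom ≫
      (H.mapComp (Φ.map l) (Φ.map k)).hom =
    (H.mapComp (Φ.map t) (Φ.map r)).inv ≫ H.map₂ (eqToHom w') ≫
      (H.mapComp (Φ.map l) (Φ.map k)).hom
  rw [← h, H.map₂_comp, H.map₂_comp]
  simp only [Category.assoc]

variable {F H}

lemma IsPremotivic.precomp {P : MorphismProperty D} {P' : MorphismProperty D'}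
    (hH : H.IsPremotivic P') (hF : ∀ ⦃X S : D⦄ (f : X ⟶ S), P f → P' (F.map f))
    (hF' : ∀ ⦃X' X S' S : D⦄ (g' : X' ⟶ X) (f' : X' ⟶ S') (f : X ⟶ S) (g : S' ⟶ S),
      IsPullback g' f' f g → IsPullback (F.map g') (F.map f') (F.map f) (F.map g)) :
    (precomp F H).IsPremotivic P where
  b1 f := hH.b1 (F.map f)
  b2 f hf := hH.b2 (F.map f) (hF f hf)
  b3 {X' X S' S g' f' f g} sq hf hf' fs adj fs' adj' K := by
    have := hH.b3 (hF' _ _ _ _ sq) (hF _ hf) (hF _ hf') adj adj' K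
    have h := (isIso_exchangeBase_iff _ _ _ _).1 this
    refine (isIso_exchangeBase_iff _ _ _ _).2 ?_
    rw [precomp_squareIso]
    exact h
  b4 f hf fs adj K L := hH.b4 (F.map f) (hF f hf) adj K L

end

end TriPseudofunctor

/-! ### Restriction along the functors between the base and the category of closed immersions -/

namespace TensorTriCat

open Bicategory

section

variable {B : Type u₁} [Bicategory.{v₂, v₁} B] [Strict B] (H : Pseudofunctor B TensorTriCat.{v, u})
  {b₀ b₁ b₂ b₃ : B} (f₀₁ : b₀ ⟶ b₁)
  (f₁₂ : b₁ ⟶ b₂) (f₂₃ : b₂ ⟶ b₃) (f₀₂ : b₀ ⟶ b₂) (f₁₃ : b₁ ⟶ b₃) (f : b₀ ⟶ b₃)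
  (h₀₂ : f₀₁ ≫ f₁₂ = f₀₂) (h₁₃ : f₁₂ ≫ f₂₃ = f₁₃) (hf : f₀₂ ≫ f₂₃ = f) (hf' : f₀₁ ≫ f₁₃ = f)

lemma mapComp'_assoc_app (K : (H.obj b₀).carrier) :
    (H.mapComp' f₀₂ f₂₃ f hf).hom.natTrans.app K ≫
      (Hom.functor (H.map f₂₃)).map ((H.mapComp' f₀₁ f₁₂ f₀₂ h₀₂).hom.natTrans.app K) =
    (H.mapComp' f₀₁ f₁₃ f hf').hom.natTrans.app K ≫
      (H.mapComp' f₁₂ f₂₃ f₁₃ h₁₃).hom.natTrans.app ((Hom.functor (H.map f₀₁)).obj K) := by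
  have := congr_arg (fun (x : H.map f ⟶ (H.map f₀₁ ≫ H.map f₁₂) ≫ H.map f₂₃) ↦ x.natTrans.app K)
    (H.mapComp'₀₂₃_hom_comp_mapComp'_hom_whiskerRight f₀₁ f₁₂ f₂₃ f₀₂ f₁₃ f h₀₂ h₁₃ hf)
  simpa using this

end

section

variable {B : Type u₁} [Bicategory.{v₂, v₁} B] [Strict B] (H : Pseudofunctor B TensorTriCat.{v, u})
  {b₀ b₁ : B}

lemma mapComp'_comp_id_app (f₀₁ : b₀ ⟶ b₁) (K : (H.obj b₀).carrier) :
    (H.mapComp' f₀₁ (𝟙 b₁) f₀₁).hom.natTrans.app K ≫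
      (H.mapId b₁).hom.natTrans.app ((Hom.functor (H.map f₀₁)).obj K) = 𝟙 _ := by
  have := congr_arg (fun (x : H.map f₀₁ ⟶ H.map f₀₁ ≫ 𝟙 _) ↦ x.natTrans.app K)
    (show (H.mapComp' f₀₁ (𝟙 b₁) f₀₁).hom ≫ H.map f₀₁ ◁ (H.mapId b₁).hom = (ρ_ _).inv by
      simp [H.mapComp'_comp_id_hom])
  simpa using this

lemma mapComp'_id_comp_app (f₀₁ : b₀ ⟶ b₁) (K : (H.obj b₀).carrier) :
    (H.mapComp' (𝟙 b₀) f₀₁ f₀₁).hom.natTrans.app K ≫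
      (Hom.functor (H.map f₀₁)).map ((H.mapId b₀).hom.natTrans.app K) = 𝟙 _ := by
  have := congr_arg (fun (x : H.map f₀₁ ⟶ 𝟙 _ ≫ H.map f₀₁) ↦ x.natTrans.app K)
    (show (H.mapComp' (𝟙 b₀) f₀₁ f₀₁).hom ≫ (H.mapId b₀).hom ▷ H.map f₀₁ = (λ_ _).inv by
      simp [H.mapComp'_id_comp_hom])
  simpa using this

/-- The isomorphism `𝟙^* ≅ 𝟙` for a morphism equal to the identity. -/
def mapId' (g : b₀ ⟶ b₀) (hg : g = 𝟙 b₀) : H.map g ≅ 𝟙 _ :=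
  H.map₂Iso (eqToIso hg) ≪≫ H.mapId b₀

lemma mapId'_rfl : mapId' H (𝟙 b₀) rfl = H.mapId b₀ := by
  ext : 1
  change H.map₂ (𝟙 _) ≫ (H.mapId b₀).hom = _
  rw [H.map₂_id, Category.id_comp]

lemma mapComp'_comp_mapId'_app (f₀₁ : b₀ ⟶ b₁) (g : b₁ ⟶ b₁) (hg : g = 𝟙 b₁) (hf : f₀₁ ≫ g = f₀₁)
    (K : (H.obj b₀).carrier) :
    (H.mapComp' f₀₁ g f₀₁ hf).hom.natTrans.app K ≫
      (mapId' H g hg).hom.natTrans.app ((Hom.functor (H.map f₀₁)).obj K) = 𝟙 _ := by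
  subst hg
  rw [mapId'_rfl]
  exact mapComp'_comp_id_app H f₀₁ K

lemma mapComp'_mapId'_comp_app (f₀₁ : b₀ ⟶ b₁) (g : b₀ ⟶ b₀) (hg : g = 𝟙 b₀) (hf : g ≫ f₀₁ = f₀₁)
    (K : (H.obj b₀).carrier) :
    (H.mapComp' g f₀₁ f₀₁ hf).hom.natTrans.app K ≫
      (Hom.functor (H.map f₀₁)).map ((mapId' H g hg).hom.natTrans.app K) = 𝟙 _ := by
  subst hg
  rw [mapId'_rfl]
  exact mapComp'_id_comp_app H f₀₁ K

lemma mapComp'_inv_comp_mapComp'_mapId (r d : b₀ ⟶ b₁) (g : b₀ ⟶ b₀) (hg : g = 𝟙 b₀)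
    (h : g ≫ r = d) (h' : r ≫ 𝟙 b₁ = d) (K : (H.obj b₀).carrier) :
    ((H.mapComp' g r d h).inv.natTrans.app K ≫ (H.mapComp' r (𝟙 b₁) d h').hom.natTrans.app K) ≫
      (H.mapId b₁).hom.natTrans.app ((Hom.functor (H.map r)).obj K) =
    (Hom.functor (H.map r)).map ((mapId' H g hg).hom.natTrans.app K) ≫ 𝟙 _ ≫ 𝟙 _ := by
  obtain rfl : r = d := by rw [← h', Strict.comp_id]
  rw [Category.assoc, Category.comp_id, Category.comp_id, mapComp'_comp_id_app, Category.comp_id,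
    ← cancel_epi ((H.mapComp' g r r h).hom.natTrans.app K),
    mapComp'_mapId'_comp_app, hom_inv_app]

/-- This is the composition axiom for `restrictUnit`: two naturality squares pasted along their
common side. It follows from associativity of the comparison isomorphisms for the three triples of
composable morphisms involved. -/
lemma mapComp'_inv_comp_mapComp'_mapComp {a' b' c' a b c : B} (ra : a' ⟶ a) (rb : b' ⟶ b)
    (rc : c' ⟶ c) (φ : a' ⟶ b') (ψ : b' ⟶ c') (χ : a' ⟶ c') (f : a ⟶ b) (g : b ⟶ c)
    (d₁ : a' ⟶ b) (d₂ : b' ⟶ c) (d₃ : a' ⟶ c) (hχ : φ ≫ ψ = χ) (h₁ : φ ≫ rb = d₁)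
    (h₁' : ra ≫ f = d₁) (h₂ : ψ ≫ rc = d₂) (h₂' : rb ≫ g = d₂) (h₃ : χ ≫ rc = d₃)
    (h₃' : ra ≫ f ≫ g = d₃) (K : (H.obj a').carrier) :
    ((H.mapComp' χ rc d₃ h₃).inv.natTrans.app K ≫
      (H.mapComp' ra (f ≫ g) d₃ h₃').hom.natTrans.app K) ≫
        (H.mapComp f g).hom.natTrans.app ((Hom.functor (H.map ra)).obj K) =
    (Hom.functor (H.map rc)).map ((H.mapComp' φ ψ χ hχ).hom.natTrans.app K) ≫ 𝟙 _ ≫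
      ((H.mapComp' ψ rc d₂ h₂).inv.natTrans.app ((Hom.functor (H.map φ)).obj K) ≫
        (H.mapComp' rb g d₂ h₂').hom.natTrans.app ((Hom.functor (H.map φ)).obj K)) ≫ 𝟙 _ ≫
      (Hom.functor (H.map g)).map ((H.mapComp' φ rb d₁ h₁).inv.natTrans.app K ≫
        (H.mapComp' ra f d₁ h₁').hom.natTrans.app K) ≫ 𝟙 _ := by
  have hf : d₁ ≫ g = d₃ := by rw [← h₁', ← h₃', Strict.assoc]
  have hf' : φ ≫ d₂ = d₃ := by rw [← hf, ← h₁, ← h₂', Strict.assoc]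
  have e₁ := mapComp'_assoc_app H φ rb g d₁ d₂ d₃ h₁ h₂' hf hf' K
  have e₂ := mapComp'_assoc_app H φ ψ rc χ d₂ d₃ hχ h₂ h₃ hf' K
  have e₃ := mapComp'_assoc_app H ra f g d₁ (f ≫ g) d₃ h₁' rfl hf h₃' K
  rw [Pseudofunctor.mapComp'_eq_mapComp] at e₃
  simp only [Category.comp_id, Category.id_comp, Category.assoc, Functor.map_comp]
  rw [← cancel_epi ((H.mapComp' χ rc d₃ h₃).hom.natTrans.app K), hom_inv_app_assoc, ← e₃,
    reassoc_of% e₂, hom_inv_app_assoc, ← reassoc_of% e₁, map_hom_inv_app_assoc]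

end

end TensorTriCat

namespace TriPseudofunctor

open TensorTriCat Bicategory Opposite MonoidalCategory

section

variable {D : Type u₁} [Category.{v₁} D] {D' : Type u₂} [Category.{v₂} D'] (F : D ⥤ D')
  (H : TriPseudofunctor.{v, u} D')

lemma map_comp_eq {a b c : LocallyDiscrete Dᵒᵖ} {f : a ⟶ b} {g : b ⟶ c} {fg : a ⟶ c}
    (h : f ≫ g = fg) :
    F.op.toPseudofunctor.map f ≫ F.op.toPseudofunctor.map g = F.op.toPseudofunctor.map fg := by
  subst h
  exact (congr_arg (fun t ↦ t.toLoc) (F.op.map_comp f.as g.as)).symm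

lemma precomp_mapComp' {a b c : LocallyDiscrete Dᵒᵖ} (f : a ⟶ b) (g : b ⟶ c) (fg : a ⟶ c)
    (h : f ≫ g = fg) :
    (precomp F H).mapComp' f g fg h =
      H.mapComp' (F.op.toPseudofunctor.map f) (F.op.toPseudofunctor.map g)
        (F.op.toPseudofunctor.map fg) (map_comp_eq F h) := by
  subst h
  rw [Pseudofunctor.mapComp'_eq_mapComp]
  ext : 1
  exact congr_arg (fun t ↦ H.map₂ t ≫ (H.mapComp _ _).hom) (Subsingleton.elim _ _)

end

section

variable {D : Type u₁} [Category.{v₁} D] {D' : Type u₂} [Category.{v₂} D'] (F : D ⥤ D')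
  (F' : D' ⥤ D) (r : 𝟭 D ⟶ F ⋙ F') (H : TriPseudofunctor.{v, u} D)

/-- The action of an endofunctor on the 1-morphisms. -/
abbrev endoMap {a b : LocallyDiscrete Dᵒᵖ} (f : a ⟶ b) :
    F'.op.toPseudofunctor.obj (F.op.toPseudofunctor.obj a) ⟶
      F'.op.toPseudofunctor.obj (F.op.toPseudofunctor.obj b) :=
  F'.op.toPseudofunctor.map (F.op.toPseudofunctor.map f)

/-- The component of a coaugmentation. -/
abbrev endoUnit (a : LocallyDiscrete Dᵒᵖ) :
    F'.op.toPseudofunctor.obj (F.op.toPseudofunctor.obj a) ⟶ a :=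
  (r.app a.as.unop).op.toLoc

lemma endoUnit_naturality {a b : LocallyDiscrete Dᵒᵖ} (f : a ⟶ b) :
    endoMap F F' f ≫ endoUnit F F' r b = endoUnit F F' r a ≫ f :=
  congr_arg (fun t ↦ (Quiver.Hom.op t).toLoc) (r.naturality f.as.unop).symm

lemma precomp_precomp_mapComp {a b c : LocallyDiscrete Dᵒᵖ} (f : a ⟶ b) (g : b ⟶ c) :
    (precomp F (precomp F' H)).mapComp f g =
      H.mapComp' (endoMap F F' f) (endoMap F F' g) (endoMap F F' (f ≫ g))
        (map_comp_eq F' (map_comp_eq F rfl)) := by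
  rw [← Pseudofunctor.mapComp'_eq_mapComp, precomp_mapComp', precomp_mapComp']

lemma precomp_precomp_mapId (a : LocallyDiscrete Dᵒᵖ) :
    (precomp F (precomp F' H)).mapId a =
      mapId' H (endoMap F F' (𝟙 a))
        (congr_arg (fun t ↦ t.toLoc) ((F ⋙ F').op.map_id a.as)) := by
  ext : 1
  let Φ := F.op.toPseudofunctor
  let Φ' := F'.op.toPseudofunctor
  change H.map₂ (Φ'.map₂ (Φ.mapId a).hom) ≫ H.map₂ (Φ'.mapId _).hom ≫ (H.mapId _).hom =
    H.map₂ (eqToHom (congr_arg (fun t ↦ t.toLoc) ((F ⋙ F').op.map_id a.as))) ≫ (H.mapId _).hom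
  exact (H.map₂_comp_assoc _ _ _).symm.trans
    (congr_arg (fun t ↦ H.map₂ t ≫ (H.mapId _).hom) (Subsingleton.elim _ _))

/-- The transformation induced by a coaugmentation. -/
def restrictUnit : precomp F (precomp F' H) ⟶ H where
  app a := H.map (endoUnit F F' r a)
  naturality {a b} f :=
    (H.mapComp' (endoMap F F' f) (endoUnit F F' r b) (endoUnit F F' r a ≫ f)
      (endoUnit_naturality F F' r f)).symm ≪≫
    H.mapComp' (endoUnit F F' r a) f (endoUnit F F' r a ≫ f)
  naturality_naturality {a b f g} η := by
    obtain rfl := LocallyDiscrete.eq_of_hom η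
    obtain rfl := Subsingleton.elim (𝟙 f) η
    simp only [PrelaxFunctor.map₂_id]
    exact (congr_arg (· ≫ _) (Bicategory.id_whiskerRight _ _)).trans
      ((Category.id_comp _).trans ((Category.comp_id _).symm.trans
        (congr_arg (_ ≫ ·) (Bicategory.whiskerLeft_id _ _).symm)))
  naturality_id a := ext_app fun K ↦ by
    rw [precomp_precomp_mapId]
    exact mapComp'_inv_comp_mapComp'_mapId H (endoUnit F F' r a) (endoUnit F F' r a ≫ 𝟙 a)
      (endoMap F F' (𝟙 a)) _ (endoUnit_naturality F F' r (𝟙 a)) rfl K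
  naturality_comp {a b c} f g := ext_app fun K ↦ by
    rw [precomp_precomp_mapComp]
    exact mapComp'_inv_comp_mapComp'_mapComp H (endoUnit F F' r a) (endoUnit F F' r b)
      (endoUnit F F' r c) (endoMap F F' f) (endoMap F F' g) (endoMap F F' (f ≫ g)) f g
      (endoUnit F F' r a ≫ f) (endoUnit F F' r b ≫ g) (endoUnit F F' r a ≫ f ≫ g) _
      (endoUnit_naturality F F' r f) rfl (endoUnit_naturality F F' r g) rfl
      (endoUnit_naturality F F' r (f ≫ g)) rfl K

end

end TriPseudofunctor

namespace ImmersionData.Pairs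

open TensorTriCat Bicategory Opposite TriPseudofunctor

variable {C : Type u₁} [Category.{v₁} C] {I : ImmersionData C} {e : ObjectProperty C}
  (hI : I.IsCategoryWithImmersions)

/-- The canonical morphisms form a natural transformation. -/
def rhoTrans : 𝟭 (I.Pairs e) ⟶ targetFunctor ⋙ ofBase hI where
  app := rho hI
  naturality _ _ f := rho_naturality hI f

/-- The transformation given by the functors `ρ^*`. -/
def restrictRho (G : TriPseudofunctor.{v, u} (I.Pairs e)) :
    precomp targetFunctor (precomp (ofBase hI) G) ⟶ G :=
  restrictUnit targetFunctor (ofBase hI) (rhoTrans hI) G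

/-- The identification of `V` with the restriction of its extension. -/
def toPrecompPrecomp (V : TriPseudofunctor.{v, u} e.FullSubcategory) :
    V ⟶ precomp (ofBase hI) (precomp targetFunctor V) where
  -- The composite of `ofBase` and `targetFunctor` is definitionally the identity on objects and
  -- morphisms, so identities serve as components.
  app a := 𝟙 (V.obj a)
  naturality {a b} f := ρ_ (V.map f) ≪≫ (λ_ (V.map f)).symm
  naturality_naturality {a b f g} η := by
    obtain rfl := LocallyDiscrete.eq_of_hom η
    obtain rfl := Subsingleton.elim (𝟙 f) η
    simp only [PrelaxFunctor.map₂_id]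
    exact (congr_arg (· ≫ _) (Bicategory.id_whiskerRight _ _)).trans
      ((Category.id_comp _).trans ((Category.comp_id _).symm.trans
        (congr_arg (_ ≫ ·) (Bicategory.whiskerLeft_id _ _).symm)))
  naturality_id a := ext_app fun K ↦ by
    rw [precomp_precomp_mapId]
    have h : mapId' V (endoMap (ofBase hI) targetFunctor (𝟙 a)) rfl = V.mapId a := mapId'_rfl V
    have h' : ((𝟙 _ ≫ 𝟙 _) ≫ (V.mapId a).hom.natTrans.app K) =
      ((V.mapId a).hom.natTrans.app K ≫ 𝟙 _ ≫ 𝟙 _) := by simp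
    exact (congr_arg
      (fun t : V.map (𝟙 a) ≅ 𝟙 (V.obj a) ↦ (𝟙 _ ≫ 𝟙 _) ≫ t.hom.natTrans.app K) h).trans h'
  naturality_comp {a b c} f g := ext_app fun K ↦ by
    rw [precomp_precomp_mapComp]
    have h : V.mapComp' (endoMap (ofBase hI) targetFunctor f)
      (endoMap (ofBase hI) targetFunctor g) (endoMap (ofBase hI) targetFunctor (f ≫ g)) rfl =
      V.mapComp f g := V.mapComp'_eq_mapComp _ _
    have h' : ((𝟙 _ ≫ 𝟙 _) ≫ (V.mapComp f g).hom.natTrans.app K) =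
      ((V.mapComp f g).hom.natTrans.app K ≫ 𝟙 _ ≫ (𝟙 _ ≫ 𝟙 _) ≫ 𝟙 _ ≫
        (Hom.functor (V.map g)).map (𝟙 _ ≫ 𝟙 _) ≫ 𝟙 _) := by simp
    exact (congr_arg (fun t : V.map (f ≫ g) ≅ V.map f ≫ V.map g ↦
      (𝟙 _ ≫ 𝟙 _) ≫ t.hom.natTrans.app K) h).trans h'

end ImmersionData.Pairs

/-! ### Reflective functors, acyclic objects and equivalences -/

section

universe w₁ w₂ w₃ x₁ x₂ x₃

variable {A : Type x₁} [Category.{w₁} A] {B : Type x₂} [Category.{w₂} B]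
  {A' : Type x₃} [Category.{w₃} A']

/-- `F` is isomorphic to the inverse of `E` followed by the reflector `E ⋙ F`. -/
lemma IsReflector.of_equivalence_comp {E : A ⥤ B} [E.IsEquivalence] {F : B ⥤ A'}
    (h : IsReflector (E ⋙ F)) : IsReflector F :=
  ((IsReflector.of_isEquivalence E.inv).comp h).of_iso
    ((Functor.associator _ _ _).symm ≪≫
      Functor.isoWhiskerRight E.asEquivalence.counitIso F ≪≫ F.leftUnitor)

end

namespace TensorTriCat

open Bicategory Pretriangulated

variable {A B C : TensorTriCat.{v, u}}

lemma isIso_map_iff_isZero (F : A ⟶ B) {T : Triangle A.carrier} (hT : T ∈ distTriang _) :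
    IsIso ((Hom.functor F).map T.mor₁) ↔ IsZero ((Hom.functor F).obj T.obj₃) :=
  (Triangle.isZero₃_iff_isIso₁ _ ((Hom.functor F).map_distinguished T hT)).symm

lemma isZero_of_isZero_map (F : A ⟶ B) [(Hom.functor F).Faithful] {K : A.carrier}
    (h : IsZero ((Hom.functor F).obj K)) : IsZero K := by
  rw [IsZero.iff_id_eq_zero]
  exact (Hom.functor F).map_injective (h.eq_of_src _ _)

lemma isIso_map_of_isZero (F : A ⟶ B) (F' : A ⟶ C)
    (h : ∀ K, IsZero ((Hom.functor F).obj K) → IsZero ((Hom.functor F').obj K))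
    {X Y : A.carrier} (w : X ⟶ Y) (hw : IsIso ((Hom.functor F).map w)) :
    IsIso ((Hom.functor F').map w) := by
  obtain ⟨Z, g, d, hT⟩ := distinguished_cocone_triangle w
  exact (isIso_map_iff_isZero F' hT).2 (h _ ((isIso_map_iff_isZero F hT).1 hw))

lemma IsReflective.exists_factorization_of_isZero {l : A ⟶ B} (hl : IsReflective l) (F : A ⟶ C)
    (h : ∀ K, IsZero ((Hom.functor l).obj K) → IsZero ((Hom.functor F).obj K)) :
    ∃ m : B ⟶ C, Nonempty (F ≅ l ≫ m) :=
  hl.exists_factorization F fun _ _ w hw ↦ isIso_map_of_isZero l F h w hw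

/-- Factoring the identity through the reflective 1-morphism `l` produces an inverse that is already
symmetric monoidal and triangulated. -/
lemma exists_equivalence (l : A ⟶ B) [(Hom.functor l).IsEquivalence] :
    ∃ e : Bicategory.Equivalence A B, e.hom = l := by
  have hl : IsReflective l := IsReflector.of_isEquivalence _
  obtain ⟨m, ⟨i⟩⟩ := hl.exists_factorization (𝟙 A) fun _ _ w hw ↦
    isIso_of_reflects_iso w (Hom.functor l)
  exact ⟨Bicategory.Equivalence.mkOfAdjointifyCounit i
    (hl.liftIso ((α_ _ _ _).symm ≪≫ whiskerRightIso i.symm l ≪≫ λ_ _ ≪≫ (ρ_ _).symm)), rfl⟩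

/-- `l` is a localization whose local objects are the objects annihilated by `j`. -/
def IsKernelLocalization (j : A ⟶ C) (l : A ⟶ B) : Prop :=
  ∃ (ι : B.carrier ⥤ A.carrier) (_ : Hom.functor l ⊣ ι), ι.Full ∧ ι.Faithful ∧
    Function.Injective ι.obj ∧ Set.range ι.obj = {K | IsZero ((Hom.functor j).obj K)}

namespace IsKernelLocalization

variable {j : A ⟶ C} {l : A ⟶ B}

lemma reflective (h : IsKernelLocalization j l) : IsReflective l := by
  obtain ⟨ι, adj, h₁, h₂, _⟩ := h
  exact ⟨ι, adj, h₁, h₂⟩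

lemma isZero_of_universal (h : IsKernelLocalization j l) {K : A.carrier}
    (hK : ∀ ⦃M : A.carrier⦄, IsZero ((Hom.functor j).obj M) → ∀ a : K ⟶ M, a = 0) :
    IsZero ((Hom.functor l).obj K) := by
  obtain ⟨ι, adj, h₁, h₂, -, h₃⟩ := h
  have hM (M : B.carrier) : IsZero ((Hom.functor j).obj (ι.obj M)) := h₃.le ⟨M, rfl⟩
  rw [IsZero.iff_id_eq_zero]
  apply (IsUniversalArrow.unit adj K).hom_ext
  rw [hK (hM _) (_ ≫ _), hK (hM _) (_ ≫ _)]

/-- The acyclic objects are the objects which are induced along `j`. -/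
lemma isZero_iff (h : IsKernelLocalization j l)
    (hj : ∀ M : C.carrier, ∃ (T : A.carrier)
      (η : M ⟶ (Hom.functor j).obj T), IsUniversalArrow (Hom.functor j) η ∧ IsIso η)
    (K : A.carrier) :
    IsZero ((Hom.functor l).obj K) ↔
      IsUniversalArrow (Hom.functor j) (𝟙 ((Hom.functor j).obj K)) := by
  constructor
  · intro hK
    obtain ⟨ι, adj, h₁, h₂, -, h₃⟩ := h
    obtain ⟨T, c, M, p, d, hT, hc, hid, hp⟩ := exists_reflection hj K
    obtain ⟨M', hM'⟩ := h₃.ge M.property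
    have hp₀ {N : A.carrier} (hN : ∃ M', ι.obj M' = N) (a : K ⟶ N) : a = 0 := by
      obtain ⟨M', rfl⟩ := hN
      apply (adj.homEquiv _ _).symm.injective
      exact hK.eq_of_src _ _
    -- `M` is the reflection of `K` in the kernel, and every map from `K` into the kernel is zero
    -- because `l` annihilates `K`. Hence `c` is an isomorphism and `K` is induced.
    have hM : IsZero M := by
      rw [IsZero.iff_id_eq_zero]
      apply hp.hom_ext
      rw [hp₀ ⟨M', hM'⟩ (_ ≫ _), hp₀ ⟨M', hM'⟩ (_ ≫ _)]
    have : IsIso c := (Triangle.isZero₃_iff_isIso₁ _ hT).1 ((kernel j).ι.map_isZero hM)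
    simpa using (hid.comp_map_iso c).iso_comp (inv ((Hom.functor j).map c))
  · intro hK
    refine h.isZero_of_universal fun M hM a ↦ hK.hom_ext (hM.eq_of_tgt _ _)

/-- If `j` is zero, then the localization is an equivalence. -/
lemma isEquivalence (h : IsKernelLocalization j l)
    (hj : ∀ K : A.carrier, IsZero ((Hom.functor j).obj K)) : (Hom.functor l).IsEquivalence := by
  obtain ⟨ι, adj, h₁, h₂, -, h₃⟩ := h
  have : ι.EssSurj := ⟨fun K ↦ by
    obtain ⟨M, hM⟩ := h₃.ge (hj K)
    exact ⟨M, ⟨eqToIso hM⟩⟩⟩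
  have : ι.IsEquivalence := {}
  exact adj.isEquivalence_left_of_isEquivalence_right

end IsKernelLocalization

end TensorTriCat

namespace TriPseudofunctor

open TensorTriCat Bicategory Opposite MonoidalCategory

variable {D : Type u₁} [Category.{v₁} D] {P : MorphismProperty D} {H : TriPseudofunctor.{v, u} D}

/-- The kernel pair of a monomorphism is trivial, so base change along it shows that the image of
`η` under the equivalence 𝟙^* is universal for 𝟙^*, hence invertible. This is f^* f_♯ ≅ id. -/
lemma IsPremotivic.isIso_of_mono (hH : H.IsPremotivic P) {X S : D} {f : X ⟶ S} [Mono f]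
    (hf : P f) (hX : P (𝟙 X)) {K : (H.at' X).carrier} {T : (H.at' S).carrier}
    {η : K ⟶ (H.star f).obj T} (h : IsUniversalArrow (H.star f) η) : IsIso η := by
  have h₁ := (hH.universal_base (IsKernelPair.id_of_mono f) hf hX h).isIso
  have h₂ : IsIso ((H.star (𝟙 X)).map η) :=
    IsIso.of_isIso_comp_right _
      ((H.squareIso (IsKernelPair.id_of_mono f).toCommSq).hom.natTrans.app T)
  exact isIso_of_isIso_star (𝟙 X) η h₂

end TriPseudofunctor

/-! ### The localization property in terms of the canonical closed immersions -/

namespace ImmersionData.Pairs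

open TensorTriCat Bicategory Opposite TriPseudofunctor

variable {C : Type u₁} [Category.{v₁} C] {I : ImmersionData C} {e : ObjectProperty C}

lemma comp_eq_of_square {W U S S' Z X : C} (i : W ⟶ U) (u : U ⟶ S') (v : S' ⟶ S) (v' : S ⟶ S')
    (hv : v ≫ v' = 𝟙 _) (k : W ⟶ Z) (f : Z ⟶ S) (l : Z ⟶ X) (r : X ⟶ S') (h : l ≫ r = f ≫ v')
    (w : i ≫ u ≫ v = k ≫ f) : (k ≫ l) ≫ r = i ≫ u := by
  rw [Category.assoc, h, ← Category.assoc k, ← w, Category.assoc, Category.assoc, hv,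
    Category.comp_id]

lemma isIso_j_of_iso (hI : I.IsCategoryWithImmersions) (hE : I.IsBase e) {X Y : I.Pairs e}
    (f : X ⟶ Y) [IsIso f] [IsIso (j hE Y)] : IsIso (j hE X) := by
  obtain ⟨c, hc⟩ := (isCartesian_of_isIso f).exists_complement hI hE
  exact hc.isIso_snd_of_isIso

/-- The property (Loc) for the canonical closed immersions. -/
structure SatisfiesRhoLoc (hI : I.IsCategoryWithImmersions) (hE : I.IsBase e)
    (G : TriPseudofunctor.{v, u} (I.Pairs e)) : Prop where
  zero (X : I.Pairs e) [IsIso (j hE X)] (K : (G.at' X).carrier) : IsZero K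
  reflector (X : I.Pairs e) : IsReflector (G.star (rho hI X))
  conservative (X : I.Pairs e) {K L : (G.at' ((ofBase hI).obj X.target)).carrier} (a : K ⟶ L) :
    IsIso ((G.star (rho hI X)).map a) → IsIso ((G.star ((ofBase hI).map (j hE X))).map a) → IsIso a

variable {hI : I.IsCategoryWithImmersions} {hE : I.IsBase e}
  {G : TriPseudofunctor.{v, u} (I.Pairs e)}

/-- Each closed immersion is transported along an isomorphism of arrows to a canonical one. For the
vanishing statement, the fiber product maps to the restriction of `X` to its complement, where `G`
is zero, and `isZero_of_hom` applies. -/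
lemma SatisfiesRhoLoc.satisfiesLoc (h : SatisfiesRhoLoc hI hE G) :
    (immersions hI hE).SatisfiesLoc G where
  zero {W Z S} f hf i' j' sq := by
    let X := hf.choose
    let E : Arrow.mk f ≅ Arrow.mk (rho hI X) := hf.choose_spec.some
    obtain ⟨Z₀, z, hz, f₀, hf₀, hT, _⟩ := exists_restriction hI hE X
    have hsq := hf₀.isPullback_rho hI
    rw [hT] at hsq
    have w : i' ≫ (ofBase hI).map (j hE X) ≫ E.inv.right = j' ≫ f := sq.w
    have w₁ : E.hom.left ≫ rho hI X = f ≫ E.hom.right := E.hom.w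
    have w₂ : E.inv.right ≫ E.hom.right = 𝟙 _ := congrArg Arrow.Hom.right E.inv_hom_id
    refine isZero_of_hom (hsq.lift (j' ≫ E.hom.left) i' ?_) (fun K ↦ h.zero _ K)
    exact comp_eq_of_square _ _ _ _ w₂ _ _ _ _ w₁ w
  fullyFaithful {Z S} f hf := by
    obtain ⟨X, ⟨E⟩⟩ := hf
    have w : f = E.hom.left ≫ rho hI X ≫ E.inv.right := by
      have w₁ : E.inv.left ≫ f = rho hI X ≫ E.inv.right := E.inv.w
      rw [← w₁]
      have w₂ : E.hom.left ≫ E.inv.left = 𝟙 _ := congrArg Arrow.Hom.left E.hom_inv_id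
      rw [reassoc_of% w₂]
    have : IsReflector (G.star (E.hom.left ≫ rho hI X ≫ E.inv.right)) :=
      ((((IsReflector.of_isEquivalence (G.star E.inv.right)).comp (h.reflector X)).of_iso
        (G.starComp _ _).symm).comp (IsReflector.of_isEquivalence (G.star E.hom.left))).of_iso
        (G.starComp _ _).symm
    rw [← w] at this
    exact this
  conservative {Z S} f hf K L a := by
    let X := hf.choose
    let E : Arrow.mk f ≅ Arrow.mk (rho hI X) := hf.choose_spec.some
    intro h₁ h₂
    have w : f = E.hom.left ≫ rho hI X ≫ E.inv.right := by
      have w₁ : E.inv.left ≫ f = rho hI X ≫ E.inv.right := E.inv.w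
      rw [← w₁]
      have w₂ : E.hom.left ≫ E.inv.left = 𝟙 _ := congrArg Arrow.Hom.left E.hom_inv_id
      rw [reassoc_of% w₂]
    have h₂' : IsIso ((G.star ((ofBase hI).map (j hE X) ≫ E.inv.right)).map a) := h₂
    rw [isIso_star_comp_iff] at h₂'
    rw [w, isIso_star_comp_iff] at h₁
    have h₃ := (isIso_star_comp_iff _ _ _).1 (isIso_of_isIso_star _ _ h₁)
    exact isIso_of_isIso_star E.inv.right a (h.conservative X _ h₃ h₂')

lemma satisfiesRhoLoc (h : (immersions hI hE).SatisfiesLoc G) : SatisfiesRhoLoc hI hE G where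
  zero X _ K := by
    have hf : (immersions hI hE).closed (rho hI X) := ⟨X, ⟨Iso.refl _⟩⟩
    -- The complement of `rho X` is defined through a chosen presentation, which may differ from `X`
    -- by an isomorphism and has to be compared with it.
    let E : Arrow.mk (rho hI X) ≅ Arrow.mk (rho hI hf.choose) := hf.choose_spec.some
    let g : hf.choose ⟶ X := E.inv.left
    have : IsIso g := inferInstanceAs (IsIso E.inv.left)
    have := isIso_j_of_iso hI hE g
    have : IsIso (((immersions hI hE).compl (rho hI X) hf).hom) :=
      inferInstanceAs (IsIso ((ofBase hI).map (j hE hf.choose) ≫ E.inv.right))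
    -- Since the complement is an isomorphism, its fiber product with `rho X` is `X` itself.
    exact h.zero (rho hI X) hf (i' := rho hI X ≫ inv ((immersions hI hE).compl (rho hI X) hf).hom)
      (j' := 𝟙 X) (IsPullback.of_vert_isIso ⟨by simp⟩) K
  reflector X := h.fullyFaithful (rho hI X) ⟨X, ⟨Iso.refl _⟩⟩
  conservative X K L a h₁ h₂ := by
    have hf : (immersions hI hE).closed (rho hI X) := ⟨X, ⟨Iso.refl _⟩⟩
    let E : Arrow.mk (rho hI X) ≅ Arrow.mk (rho hI hf.choose) := hf.choose_spec.some
    let g : hf.choose ⟶ X := E.inv.left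
    have : IsIso g := inferInstanceAs (IsIso E.inv.left)
    obtain ⟨c, hc⟩ := (isCartesian_of_isIso g).exists_complement hI hE
    have w : E.inv.left ≫ rho hI X = rho hI hf.choose ≫ E.inv.right := E.inv.w
    have hr : (ofBase hI).map (targetFunctor.map g) = E.inv.right := hom_ext hI (by
      have := congr_arg (fun t ↦ t.hom.right) w
      exact (Category.comp_id _).symm.trans (this.trans (Category.id_comp _)))
    have hcompl : ((immersions hI hE).compl (rho hI X) hf).hom =
        (ofBase hI).map c ≫ (ofBase hI).map (j hE X) := by
      change (ofBase hI).map (j hE hf.choose) ≫ E.inv.right = _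
      rw [← hr]
      exact ((ofBase hI).map_comp _ _).symm.trans
        ((congrArg (ofBase hI).map hc.w.symm).trans ((ofBase hI).map_comp _ _))
    refine h.conservative (rho hI X) hf a h₁ ?_
    have : IsIso ((G.star ((ofBase hI).map c ≫ (ofBase hI).map (j hE X))).map a) := by
      rw [isIso_star_comp_iff]
      infer_instance
    rw [← hcompl] at this
    exact this

end ImmersionData.Pairs

/-! ### The extension of a pseudofunctor to the category of closed immersions -/

namespace TriPseudofunctor

lemma isZero_star_star_of_comm {D : Type u₁} [Category.{v₁} D] {H : TriPseudofunctor.{v, u} D}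
    {X' X S' S : D} {g' : X' ⟶ X} {f' : X' ⟶ S'} {f : X ⟶ S} {g : S' ⟶ S}
    (w : g' ≫ f = f' ≫ g) {K : (H.at' S).carrier} (hK : IsZero ((H.star f).obj K)) :
    IsZero ((H.star f').obj ((H.star g).obj K)) := by
  rw [← isZero_star_comp_iff, ← w, isZero_star_comp_iff]
  exact isZero_star _ hK

end TriPseudofunctor

namespace ImmersionData.Pairs

open TensorTriCat Bicategory Opposite TriPseudofunctor

variable {C : Type u₁} [Category.{v₁} C] {I : ImmersionData C} {e : ObjectProperty C}
  (hI : I.IsCategoryWithImmersions) (hE : I.IsBase e) {P : MorphismProperty C}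
  (hP_opn : I.opn ≤ P) {V : TriPseudofunctor.{v, u} e.FullSubcategory}
  (hV : V.IsPremotivic (P.inverseImage e.ι))

include hP_opn in
lemma inverseImage_j (X : I.Pairs e) : P.inverseImage e.ι (j hE X) :=
  hP_opn (j hE X).hom (j_opn hE X)

include hI hP_opn hV in
lemma exists_universal_j (X : I.Pairs e) (M : (V.at' (complement hE X).left).carrier) :
    ∃ (T : (V.at' X.target).carrier) (η : M ⟶ (V.star (j hE X)).obj T),
      IsUniversalArrow (V.star (j hE X)) η ∧ IsIso η := by
  obtain ⟨T, η, h⟩ := hV.exists_universal (j hE X) (inverseImage_j hE hP_opn X) M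
  have hm : Mono (j hE X) :=
    e.ι.mono_of_mono_map (hI.opn_mono _ (j_opn hE X) : Mono (j hE X).hom)
  refine ⟨T, η, h, hV.isIso_of_mono (inverseImage_j hE hP_opn X)
    (hP_opn (𝟙 (complement hE X).left.obj) ?_) h⟩
  exact hI.iso_opn _ (inferInstanceAs (IsIso (𝟙 (complement hE X).left.obj)))

include hI hV in
lemma isPremotivic_precomp_target :
    (precomp (targetFunctor (I := I)) V).IsPremotivic (tilde P) :=
  hV.precomp (fun _ _ _ hf ↦ hf.2) (fun _ _ _ _ _ _ _ _ h ↦ isPullback_target hI h)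

include hI hP_opn hV in
/-- Objects induced along the complement of `X₁` become acyclic on `X₂`. -/
lemma isZero_star_of_isZero {X₂ X₁ : I.Pairs e} (f : X₂ ⟶ X₁) {B₁ B₂ : TensorTriCat.{v, u}}
    {l₁ : V.at' X₁.target ⟶ B₁} (h₁ : IsKernelLocalization (V.map (j hE X₁).op.toLoc) l₁)
    {l₂ : V.at' X₂.target ⟶ B₂} (h₂ : IsKernelLocalization (V.map (j hE X₂).op.toLoc) l₂)
    (K : (V.at' X₁.target).carrier) (hK : IsZero ((Hom.functor l₁).obj K)) :
    IsZero ((Hom.functor l₂).obj ((V.star (targetFunctor.map f)).obj K)) := by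
  rw [h₁.isZero_iff (exists_universal_j hI hE hP_opn hV X₁)] at hK
  obtain ⟨T, p, q, j', sq, hq, w, -⟩ := exists_complement hI hE f
  -- An acyclic object is induced from U₁, so its pullback is induced along `q`. As `q` factors
  -- through U₂, any `M` killed by restriction to U₂ is killed by q^* and receives no nonzero map
  -- from the pullback.
  have h := hV.universal_base sq (inverseImage_j hE hP_opn X₁) (hP_opn q.hom hq) hK
  refine h₂.isZero_of_universal fun M hM a ↦ ?_
  have hqM : IsZero ((V.star q).obj M) := by
    rw [← w]
    exact (isZero_star_comp_iff _ _ _).2 (isZero_star _ hM)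
  exact h.hom_ext (hqM.eq_of_tgt _ _)

/-- `L` is objectwise the localization with local objects the objects supported on the closed
immersions. -/
def IsExtension {G : TriPseudofunctor.{v, u} (I.Pairs e)} (L : precomp targetFunctor V ⟶ G) :
    Prop :=
  ∀ X : I.Pairs e, IsKernelLocalization (V.map (j hE X).op.toLoc) (L.app ⟨op X⟩)

-- The localizations exist because the open restriction has a fully faithful left adjoint with a
-- projection formula. The inverse images descend by `isZero_star_of_isZero`, and all coherence is
-- supplied by `LocalizationData`.
include hI hP_opn hV in
lemma exists_extension : ∃ (G : TriPseudofunctor.{v, u} (I.Pairs e))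
    (L : precomp targetFunctor V ⟶ G), IsExtension hE L := by
  have h (X : LocallyDiscrete (I.Pairs e)ᵒᵖ) : ∃ (B : TensorTriCat.{v, u})
      (l : V.at' X.as.unop.target ⟶ B),
      IsKernelLocalization (V.map (j hE X.as.unop).op.toLoc) l :=
    exists_kernel_localization (exists_universal_j hI hE hP_opn hV _)
      fun M T η hη K ↦ hV.universal_tensor (inverseImage_j hE hP_opn _) hη K
  choose B l hl using h
  have h' {a b : LocallyDiscrete (I.Pairs e)ᵒᵖ} (f : a ⟶ b) :
      ∃ m : B a ⟶ B b, Nonempty ((precomp targetFunctor V).map f ≫ l b ≅ l a ≫ m) :=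
    (hl a).reflective.exists_factorization_of_isZero _
      (isZero_star_of_isZero hI hE hP_opn hV f.as.unop (hl a) (hl b))
  choose m hm using @h'
  let d : LocalizationData (precomp targetFunctor V) :=
    { obj := B
      l := l
      reflective a := (hl a).reflective
      map {a b} f := m (a := a) (b := b) f
      σ {a b} f := (hm (a := a) (b := b) f).some }
  exact ⟨d.pseudofunctor, d.localization, fun X ↦ hl ⟨op X⟩⟩

section

variable {G : TriPseudofunctor.{v, u} (I.Pairs e)}

/-- The restriction along a canonical closed immersion. -/
def rhoIso (L : precomp targetFunctor V ⟶ G) (X : I.Pairs e) :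
    (L.app ⟨op ((ofBase hI).obj X.target)⟩).functor ⋙ G.star (rho hI X) ≅
      (L.app ⟨op X⟩).functor :=
  (functorIso (L.naturality (rho hI X).op.toLoc)).symm ≪≫
    Functor.isoWhiskerRight (V.starId X.target) (L.app ⟨op X⟩).functor ≪≫ Functor.leftUnitor _

lemma isZero_rho_iff (L : precomp targetFunctor V ⟶ G) (X : I.Pairs e)
    (K : (V.at' X.target).carrier) :
    IsZero ((G.star (rho hI X)).obj ((L.app ⟨op ((ofBase hI).obj X.target)⟩).functor.obj K)) ↔
      IsZero ((L.app ⟨op X⟩).functor.obj K) :=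
  ((rhoIso hI L X).app K).isZero_iff

/-- The comparison of a pseudofunctor with the restriction of its extension. -/
abbrev comparison (L : precomp targetFunctor V ⟶ G) : V ⟶ precomp (ofBase hI) G :=
  toPrecompPrecomp hI V ≫ precompTrans (ofBase hI) L

end

namespace IsExtension

variable {hE} {G : TriPseudofunctor.{v, u} (I.Pairs e)} {L : precomp targetFunctor V ⟶ G}
  (hL : IsExtension hE L)

include hL

lemma reflective (X : LocallyDiscrete (I.Pairs e)ᵒᵖ) : IsReflective (L.app X) :=
  (hL X.as.unop).reflective

-- For a Cartesian morphism the complement upstairs is the base change of the one downstairs.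
-- Inverse image therefore preserves objects vanishing on the complement, which is the locality
-- required by `map_reflector`.
include hI in
lemma preservesUniversal : PreservesUniversal (tilde P) L := by
  intro X S f hf K T η h
  obtain ⟨ι₁, adj₁, _, _, -, h₁⟩ := hL S
  obtain ⟨ι₂, adj₂, _, _, -, h₂⟩ := hL X
  refine h.map_reflector adj₁ adj₂ (functorIso (L.naturality f.op.toLoc)) fun M ↦ ?_
  obtain ⟨c, hc⟩ := IsCartesian.exists_complement hI hE hf.1
  have hM : IsZero ((V.star (j hE S)).obj (ι₁.obj M)) := h₁.le ⟨M, rfl⟩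
  have hM' : IsZero ((V.star (j hE X)).obj ((V.star (targetFunctor.map f)).obj (ι₁.obj M))) :=
    isZero_star_star_of_comm hc.w hM
  obtain ⟨N, hN⟩ := h₂.ge hM'
  -- The unit is invertible at every value of `ι₂`; locality is known only as an equality of
  -- objects, which is eliminated by substitution.
  have h₃ (N' : (V.at' X.target).carrier) (h : ι₂.obj N = N') : IsIso (adj₂.unit.app N') := by
    subst h
    infer_instance
  exact h₃ _ hN

include hI hV in
lemma isPremotivic : G.IsPremotivic (tilde P) :=
  IsPremotivic.of_reflective L hL.reflective (isPremotivic_precomp_target hI hV)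
    (hL.preservesUniversal hI)

-- The complement of an identity is the fiber product of that identity with itself, so (Loc) makes
-- `V` zero there and every object is local.
include hI in
lemma isEquivalence (hLoc : (I.restrict e hE).SatisfiesLoc V) (S : e.FullSubcategory) :
    (L.app ⟨op ((ofBase hI).obj S)⟩).functor.IsEquivalence := by
  have hm : Mono (j hE ((ofBase hI).obj S)) :=
    e.ι.mono_of_mono_map (hI.opn_mono _ (j_opn hE ((ofBase hI).obj S)) : Mono (j hE _).hom)
  have hi : (I.restrict e hE).closed (𝟙 S) := hI.iso_closed _ (inferInstanceAs (IsIso (𝟙 S.obj)))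
  have sq : IsPullback (𝟙 (complement hE ((ofBase hI).obj S)).left) (j hE ((ofBase hI).obj S))
      (j hE ((ofBase hI).obj S)) (𝟙 S) := IsPullback.of_id_fst
  exact (hL ((ofBase hI).obj S)).isEquivalence fun K ↦ hLoc.zero (𝟙 S) hi sq _

include hP_opn hV in
lemma satisfiesRhoLoc (hLoc : (I.restrict e hE).SatisfiesLoc V) : SatisfiesRhoLoc hI hE G where
  zero X _ K := by
    obtain ⟨ι, adj, _, _, -, h⟩ := hL X
    have h₁ : IsZero ((V.star (j hE X)).obj (ι.obj K)) := h.le ⟨K, rfl⟩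
    have h₂ : IsZero (ι.obj K) := isZero_of_isZero_star (H := V) (j hE X) h₁
    exact ((L.app ⟨op X⟩).functor.map_isZero h₂).of_iso
      (asIso (adj.counit.app K)).symm
  reflector X := by
    have := hL.isEquivalence hI hLoc X.target
    exact IsReflector.of_equivalence_comp
      (E := (L.app ⟨op ((ofBase hI).obj X.target)⟩).functor)
      ((hL X).reflective.of_iso (rhoIso hI L X).symm)
  conservative X K K' a h₁ h₂ := by
    have := hL.isEquivalence hI hLoc X.target
    -- Conservativity amounts to the vanishing of a cone killed by both restrictions. Lifted to an
    -- object `M₀` of `V`, the first vanishing says that `M₀` is induced from the complement, the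
    -- second that it is induced from zero.
    obtain ⟨M, b, d, hT⟩ := Pretriangulated.distinguished_cocone_triangle a
    have h₁' : IsZero ((G.star (rho hI X)).obj M) := (isIso_map_iff_isZero _ hT).1 h₁
    have h₂' : IsZero ((G.star ((ofBase hI).map (j hE X))).obj M) :=
      (isIso_map_iff_isZero _ hT).1 h₂
    refine (isIso_map_iff_isZero (𝟙 _) hT).2 ?_
    change IsZero M
    obtain ⟨M₀, ⟨E⟩⟩ : ∃ M₀,
        Nonempty ((L.app ⟨op ((ofBase hI).obj X.target)⟩).functor.obj M₀ ≅ M) :=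
      ⟨_, ⟨Functor.objObjPreimageIso _ M⟩⟩
    have h₃ : IsZero ((L.app ⟨op X⟩).functor.obj M₀) :=
      (isZero_rho_iff hI L X M₀).1 (h₁'.of_iso ((G.star _).mapIso E))
    have := hL.isEquivalence hI hLoc (complement hE X).left
    have h₄ : IsZero ((L.app ⟨op ((ofBase hI).obj (complement hE X).left)⟩).functor.obj
        ((V.star (j hE X)).obj M₀)) :=
      (h₂'.of_iso ((G.star _).mapIso E)).of_iso ((functorIso
        (L.naturality ((ofBase hI).map (j hE X)).op.toLoc)).app M₀)
    have h₅ : IsZero ((V.star (j hE X)).obj M₀) :=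
      isZero_of_isZero_map (L.app ⟨op ((ofBase hI).obj (complement hE X).left)⟩) h₄
    have h₆ : IsZero M₀ := IsUniversalArrow.isZero
      (((hL X).isZero_iff (exists_universal_j hI hE hP_opn hV X) M₀).1 h₃) h₅
    exact ((L.app ⟨op ((ofBase hI).obj X.target)⟩).functor.map_isZero h₆).of_iso E.symm

lemma isPseudonaturalEquivalence_comparison (hLoc : (I.restrict e hE).SatisfiesLoc V) :
    IsPseudonaturalEquivalence (comparison hI L) := fun S ↦ by
  have := hL.isEquivalence hI hLoc S
  have : (Hom.functor ((comparison hI L).app ⟨op S⟩)).IsEquivalence :=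
    inferInstanceAs (𝟭 _ ⋙ (L.app ⟨op ((ofBase hI).obj S)⟩).functor).IsEquivalence
  exact exists_equivalence _

lemma exists_rightAdjoint (X : I.Pairs e) :
    ∃ ι : (G.at' X).carrier ⥤ (V.at' X.target).carrier,
      ι.Full ∧ ι.Faithful ∧ Function.Injective ι.obj ∧
      Set.range ι.obj = {K | IsZero ((V.star (complement hE X).hom).obj K)} ∧
      Nonempty (((comparison hI L).app ⟨op X.target⟩).functor ⋙ G.star (X.rho hI) ⊣ ι) := by
  obtain ⟨ι, adj, h₁, h₂, h₃, h₄⟩ := hL X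
  exact ⟨ι, h₁, h₂, h₃, h₄, ⟨adj.ofNatIsoLeft ((rhoIso hI L X).symm ≪≫
    Functor.isoWhiskerRight (Functor.leftUnitor _).symm _)⟩⟩

end IsExtension

end ImmersionData.Pairs

/-! ### Modifications between restrictions -/

namespace TensorTriCat

open Bicategory

lemma mapComp'_inv_comp_mapComp'_hom_mapId' {B : Type u₁} [Bicategory.{v₂, v₁} B] [Strict B]
    (H : Pseudofunctor B TensorTriCat.{v, u}) {b₀ b₁ : B} (f d : b₀ ⟶ b₁) (g : b₁ ⟶ b₁)
    (g' : b₀ ⟶ b₀) (hg : g = 𝟙 b₁) (hg' : g' = 𝟙 b₀) (h : f ≫ g = d) (h' : g' ≫ f = d)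
    (K : (H.obj b₀).carrier) :
    ((H.mapComp' f g d h).inv.natTrans.app K ≫ (H.mapComp' g' f d h').hom.natTrans.app K) ≫
      (Hom.functor (H.map f)).map ((mapId' H g' hg').hom.natTrans.app K) =
      (mapId' H g hg).hom.natTrans.app ((Hom.functor (H.map f)).obj K) := by
  obtain rfl : d = f := by rw [← h, hg, Strict.comp_id]
  rw [Category.assoc, mapComp'_mapId'_comp_app, Category.comp_id,
    ← cancel_epi ((H.mapComp' d g d h).hom.natTrans.app K), hom_inv_app, mapComp'_comp_mapId'_app]

lemma isEquivalence_functor_hom {A B : TensorTriCat.{v, u}} (e : Bicategory.Equivalence A B) :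
    (Hom.functor e.hom).IsEquivalence :=
  (CategoryTheory.Equivalence.mk (Hom.functor e.hom) (Hom.functor e.inv) (functorIso e.unit)
    (functorIso e.counit)).isEquivalence_functor

end TensorTriCat

namespace TriPseudofunctor

open TensorTriCat Bicategory Opposite

variable {D : Type u₁} [Category.{v₁} D] {D' : Type u₂} [Category.{v₂} D']

/-- This identifies the naturality isomorphisms of `restrictUnit` with the square isomorphisms
occurring in the base change axiom. -/
lemma isoMapOfCommSq_eq (H : TriPseudofunctor.{v, u} D) {a b c d : LocallyDiscrete Dᵒᵖ}
    {t : a ⟶ b} {l : a ⟶ c} {r : b ⟶ d} {k : c ⟶ d} (sq : CommSq t l r k) (m : a ⟶ d)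
    (h : t ≫ r = m) (h' : l ≫ k = m) :
    H.isoMapOfCommSq sq = (H.mapComp' t r m h).symm ≪≫ H.mapComp' l k m h' := by
  subst h
  rw [Pseudofunctor.mapComp'_eq_mapComp]
  rfl

section

variable (F : D ⥤ D') (F' : D' ⥤ D) (r : 𝟭 D ⟶ F ⋙ F')

lemma restrictUnit_naturality (H : TriPseudofunctor.{v, u} D) {X S : D} (f : X ⟶ S) :
    (restrictUnit F F' r H).naturality f.op.toLoc =
      H.squareIso ⟨(r.naturality f).symm⟩ :=
  (isoMapOfCommSq_eq H _ _ _ _).symm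

/-- The compatibility of `restrictUnit` with transformations. -/
def restrictUnitCompIso {H H' : TriPseudofunctor.{v, u} D} (β : H ⟶ H') :
    restrictUnit F F' r H ≫ β ≅
      precompTrans F (precompTrans F' β) ≫ restrictUnit F F' r H' :=
  Pseudofunctor.StrongTrans.isoMk (fun a ↦ β.naturality (endoUnit F F' r a)) (fun {a b} f ↦
    ext_app fun K ↦ by
      let g := f.as.unop
      have h := squareIso_naturality β ⟨(r.naturality g).symm⟩ K
      have h₁ := comp_naturality_app (restrictUnit F F' r H) β g.op.toLoc K
      have h₂ := comp_naturality_app (precompTrans F (precompTrans F' β))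
        (restrictUnit F F' r H') g.op.toLoc K
      rw [restrictUnit_naturality] at h₁ h₂
      refine (congrArg (_ ≫ ·) h₂).trans (Eq.trans ?_ (congrArg (· ≫ _) h₁).symm)
      exact h.symm.trans (Category.assoc _ _ _).symm)

end

section

variable (F : D ⥤ D')

/-- The restriction of an invertible modification. -/
def precompTransIso {H H' : TriPseudofunctor.{v, u} D'} {α β : H ⟶ H'} (m : α ≅ β) :
    precompTrans F α ≅ precompTrans F β :=
  Pseudofunctor.StrongTrans.isoMk (fun a ↦ modificationIsoApp m (F.op.toPseudofunctor.obj a))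
    (fun f ↦ m.hom.as.naturality (F.op.toPseudofunctor.map f))

end

end TriPseudofunctor

namespace ImmersionData.Pairs

open TensorTriCat Bicategory Opposite TriPseudofunctor

variable {C : Type u₁} [Category.{v₁} C] {I : ImmersionData C} {e : ObjectProperty C}
  (hI : I.IsCategoryWithImmersions)

/-- The compatibility of `toPrecompPrecomp` with transformations. -/
def toPrecompPrecompCompIso {V V' : TriPseudofunctor.{v, u} e.FullSubcategory} (α : V ⟶ V') :
    toPrecompPrecomp hI V ≫ precompTrans (ofBase hI) (precompTrans targetFunctor α) ≅
      α ≫ toPrecompPrecomp hI V' :=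
  Pseudofunctor.StrongTrans.isoMk (fun a ↦ λ_ (α.app a) ≪≫ (ρ_ (α.app a)).symm) (fun {a b} f ↦
    ext_app fun K ↦ by
      have h₁ := comp_naturality_app (toPrecompPrecomp hI V)
        (precompTrans (ofBase hI) (precompTrans targetFunctor α)) f K
      have h₂ := comp_naturality_app α (toPrecompPrecomp hI V') f K
      refine (congrArg (_ ≫ ·) h₂).trans (Eq.trans ?_ (congrArg (· ≫ _) h₁).symm)
      have h : (𝟙 _ ≫ 𝟙 _) ≫ (Hom.functor (𝟙 (V'.obj b))).map ((α.naturality f).hom.natTrans.app K) ≫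
          𝟙 _ ≫ 𝟙 _ = ((Hom.functor (α.app b)).map (𝟙 _ ≫ 𝟙 _) ≫
            (α.naturality f).hom.natTrans.app K) ≫ (Hom.functor (V'.map f)).map (𝟙 _ ≫ 𝟙 _) := by
        simp
      exact h)

/-- The canonical closed immersion of an identity. -/
abbrev rhoOfBase (a : LocallyDiscrete e.FullSubcategoryᵒᵖ) :
    (ofBase (I := I) hI).op.toPseudofunctor.obj a ⟶ (ofBase hI).op.toPseudofunctor.obj a :=
  (rho hI ((ofBase hI).obj a.as.unop)).op.toLoc

lemma rhoOfBase_eq (a : LocallyDiscrete e.FullSubcategoryᵒᵖ) :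
    rhoOfBase (I := I) hI a = 𝟙 _ :=
  congr_arg (fun t ↦ (Quiver.Hom.op t).toLoc) (rho_ofBase hI a.as.unop)

/-- A triangle identity. -/
def toPrecompPrecompRestrictIso (G : TriPseudofunctor.{v, u} (I.Pairs e)) :
    toPrecompPrecomp hI (precomp (ofBase hI) G) ≫ precompTrans (ofBase hI) (restrictRho hI G) ≅
      𝟙 (precomp (ofBase hI) G) :=
  Pseudofunctor.StrongTrans.isoMk (fun a ↦ λ_ _ ≪≫ mapId' G (rhoOfBase hI a) (rhoOfBase_eq hI a))
    (fun {a b} f ↦ ext_app fun K ↦ by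
      have h₁ := comp_naturality_app (toPrecompPrecomp hI (precomp (ofBase hI) G))
        (precompTrans (ofBase hI) (restrictRho hI G)) f K
      let g : (ofBase hI).op.toPseudofunctor.obj a ⟶ (ofBase hI).op.toPseudofunctor.obj b :=
        (ofBase hI).op.toPseudofunctor.map f
      have w : g ≫ rhoOfBase hI b = rhoOfBase hI a ≫ g := by
        rw [rhoOfBase_eq, rhoOfBase_eq, Strict.comp_id, Strict.id_comp]
      have h := mapComp'_inv_comp_mapComp'_hom_mapId' G g
        (rhoOfBase hI a ≫ g) (rhoOfBase hI b) (rhoOfBase hI a) (rhoOfBase_eq hI b)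
        (rhoOfBase_eq hI a) w rfl K
      refine Eq.trans ?_ (congrArg (· ≫ _) h₁).symm
      have h' : (𝟙 _ ≫ (mapId' G (rhoOfBase hI b) (rhoOfBase_eq hI b)).hom.natTrans.app
          ((Hom.functor (G.map g)).obj K)) ≫ 𝟙 _ ≫ 𝟙 _ =
          ((Hom.functor (G.map (rhoOfBase hI b))).map (𝟙 _ ≫ 𝟙 ((Hom.functor (G.map g)).obj K)) ≫
            (G.mapComp' g (rhoOfBase hI b) (rhoOfBase hI a ≫ g) w).inv.natTrans.app K ≫
              (G.mapComp' (rhoOfBase hI a) g (rhoOfBase hI a ≫ g) rfl).hom.natTrans.app K) ≫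
            (Hom.functor (G.map g)).map (𝟙 _ ≫
              (mapId' G (rhoOfBase hI a) (rhoOfBase_eq hI a)).hom.natTrans.app K) := by
        simp only [Category.comp_id, Category.id_comp, CategoryTheory.Functor.map_id]
        rw [h]
      exact h')

end ImmersionData.Pairs

/-! ### Extension of transformations to the category of closed immersions -/

namespace TriPseudofunctor

open TensorTriCat Bicategory Opposite

variable {D : Type u₁} [Category.{v₁} D]

/-- An equivalence is a reflector for which every object is local. -/
lemma PreservesUniversal.of_isEquivalence (P : MorphismProperty D)
    {H H' : TriPseudofunctor.{v, u} D} (α : H ⟶ H')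
    (hα : ∀ X : D, (α.app ⟨op X⟩).functor.IsEquivalence) : PreservesUniversal P α := by
  intro X S f _ K T η h
  have := hα X
  have := hα S
  exact h.map_reflector (α.app ⟨op S⟩).functor.asEquivalence.toAdjunction
    (α.app ⟨op X⟩).functor.asEquivalence.toAdjunction (functorIso (α.naturality f.op.toLoc))
    fun M ↦ inferInstance

lemma IsPseudonaturalEquivalence.isEquivalence {H H' : TriPseudofunctor.{v, u} D} {α : H ⟶ H'}
    (hα : IsPseudonaturalEquivalence α) (X : D) : (α.app ⟨op X⟩).functor.IsEquivalence := by
  obtain ⟨e, he⟩ := hα X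
  rw [← he]
  exact isEquivalence_functor_hom e

end TriPseudofunctor

namespace ImmersionData.Pairs

open TensorTriCat Bicategory Opposite TriPseudofunctor

variable {C : Type u₁} [Category.{v₁} C] {I : ImmersionData C} {e : ObjectProperty C}
  (hI : I.IsCategoryWithImmersions) {hE : I.IsBase e} {P : MorphismProperty C}

lemma tilde_ofBase_map {X S : e.FullSubcategory} (f : X ⟶ S) (hf : P f.hom) :
    tilde P ((ofBase (I := I) hI).map f) :=
  ⟨IsPullback.of_id_fst, hf⟩

section

variable {G : TriPseudofunctor.{v, u} (I.Pairs e)} (hG : G.IsPremotivic (tilde P))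

-- A Cartesian morphism forms a Cartesian square with the canonical immersions, so this is base
-- change for `U(f)` along `rho S`.
include hG in
lemma universal_restrictRho {X S : I.Pairs e} {f : X ⟶ S} (hf : tilde P f)
    {K : (G.at' ((ofBase hI).obj X.target)).carrier}
    {T : (G.at' ((ofBase hI).obj S.target)).carrier}
    {η : K ⟶ (G.star ((ofBase hI).map (targetFunctor.map f))).obj T}
    (h : IsUniversalArrow (G.star ((ofBase hI).map (targetFunctor.map f))) η) :
    IsUniversalArrow (G.star f) ((G.star (rho hI X)).map η ≫
      (G.squareIso ⟨(rho_naturality hI f).symm⟩).hom.natTrans.app T) :=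
  hG.universal_base (IsCartesian.isPullback_rho hI hf.1).flip
    (tilde_ofBase_map hI (targetFunctor.map f) hf.2) hf h

include hG in
lemma preservesUniversal_restrictRho : PreservesUniversal (tilde P) (restrictRho hI G) := by
  intro X S f hf K T η h
  have := universal_restrictRho hI hG hf h
  have e₁ := restrictUnit_naturality targetFunctor (ofBase hI) (rhoTrans hI) G f
  refine (congrArg (IsUniversalArrow (G.star f)) ?_).mp this
  exact congrArg (fun t : G.map ((ofBase hI).map (targetFunctor.map f)).op.toLoc ≫
      G.map (rho hI X).op.toLoc ≅ G.map (rho hI S).op.toLoc ≫ G.map f.op.toLoc ↦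
    (G.star (rho hI X)).map η ≫ t.hom.natTrans.app T) e₁.symm

end

section

variable {V : TriPseudofunctor.{v, u} e.FullSubcategory}
  {G : TriPseudofunctor.{v, u} (I.Pairs e)} (δ : V ⟶ precomp (ofBase hI) G)

/-- The transformation given by `ρ^* δ`. -/
abbrev extension : precomp targetFunctor V ⟶ G := precompTrans targetFunctor δ ≫ restrictRho hI G

/-- The restriction of `extension` to the base. -/
def comparisonExtensionIso : comparison hI (extension hI δ) ≅ δ :=
  (α_ (toPrecompPrecomp hI V) (precompTrans (ofBase hI) (precompTrans targetFunctor δ))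
    (precompTrans (ofBase hI) (restrictRho hI G))).symm ≪≫
    whiskerRightIso (toPrecompPrecompCompIso hI δ) _ ≪≫ α_ _ _ _ ≪≫
    whiskerLeftIso δ (toPrecompPrecompRestrictIso hI G) ≪≫ ρ_ _

variable {δ} (hδ : IsPseudonaturalEquivalence δ)

include hδ

lemma reflective_extension (hG : SatisfiesRhoLoc hI hE G) (X : LocallyDiscrete (I.Pairs e)ᵒᵖ) :
    IsReflective ((extension hI δ).app X) := by
  have := hδ.isEquivalence X.as.unop.target
  exact (IsReflector.of_isEquivalence (δ.app ⟨op X.as.unop.target⟩).functor).comp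
    (hG.reflector X.as.unop)

lemma preservesUniversal_extension (hG : G.IsPremotivic (tilde P)) :
    PreservesUniversal (tilde P) (extension hI δ) :=
  (PreservesUniversal.of_isEquivalence _ _ fun X ↦ hδ.isEquivalence X.target).comp
    (preservesUniversal_restrictRho hI hG)

variable (hP_opn : I.opn ≤ P)

include hP_opn

/-- Objects induced along the complement are annihilated by restriction to the closed immersion. -/
lemma isZero_extension_of_universal (hG : G.IsPremotivic (tilde P))
    (hG' : SatisfiesRhoLoc hI hE G) (X : I.Pairs e) {K : (V.at' (complement hE X).left).carrier}
    {T : (V.at' X.target).carrier} {η : K ⟶ (V.star (j hE X)).obj T}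
    (h : IsUniversalArrow (V.star (j hE X)) η) :
    IsZero (((extension hI δ).app ⟨op X⟩).functor.obj T) := by
  obtain ⟨Z, z, hz, f, hf, hT, _⟩ := exists_restriction hI hE X
  have hf' : tilde P f := ⟨hf, by
    have h₁ : f.hom.right = (j hE X).hom := congrArg (fun t ↦ t.hom) hT
    rw [h₁]
    exact hP_opn _ (j_opn hE X)⟩
  have h₁ := PreservesUniversal.of_isEquivalence (P.inverseImage e.ι) δ hδ.isEquivalence (j hE X)
    (inverseImage_j hE hP_opn X) η h
  have sq := (hf.isPullback_rho hI).flip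
  rw [hT] at sq
  -- Base change along `rho X` moves the source to the restriction of `X` to its complement, where
  -- `G` is zero; a universal arrow out of zero has zero target. This is i^* j_♯ = 0.
  have h₂ := hG.universal_base sq
    (tilde_ofBase_map hI (j hE X) (hP_opn _ (j_opn hE X))) hf' h₁
  exact IsUniversalArrow.isZero h₂ (hG'.zero _ _)

/-- The counit j_♯ j^* K → K becomes an isomorphism on the complement and a map between zero objects
on the closed part. By conservativity for `G` it is an isomorphism after δ, hence already in `V`. -/
lemma universal_of_isZero_extension (hV : V.IsPremotivic (P.inverseImage e.ι))
    (hG : G.IsPremotivic (tilde P)) (hG' : SatisfiesRhoLoc hI hE G) (X : I.Pairs e)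
    (K : (V.at' X.target).carrier)
    (hK : IsZero (((extension hI δ).app ⟨op X⟩).functor.obj K)) :
    IsUniversalArrow (V.star (j hE X)) (𝟙 ((V.star (j hE X)).obj K)) := by
  obtain ⟨T, η, h, _⟩ := exists_universal_j hI hE hP_opn hV X ((V.star (j hE X)).obj K)
  obtain ⟨c, hc⟩ := h.exists_lift (𝟙 ((V.star (j hE X)).obj K))
  have hc' : IsIso ((V.star (j hE X)).map c) := by
    have : IsIso (η ≫ (V.star (j hE X)).map c) := by
      rw [hc]
      infer_instance
    exact IsIso.of_isIso_comp_left η _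
  have hT := isZero_extension_of_universal hI hδ hP_opn hG hG' X h
  have := hδ.isEquivalence X.target
  have hδc : IsIso ((δ.app ⟨op X.target⟩).functor.map c) := by
    refine hG'.conservative X _ ?_ ?_
    · exact hT.isIso hK _
    · exact (NatIso.isIso_map_iff (functorIso (δ.naturality (j hE X).op.toLoc)) c).1
        (inferInstanceAs (IsIso ((δ.app ⟨op (complement hE X).left⟩).functor.map
          ((V.star (j hE X)).map c))))
  have : IsIso c := isIso_of_reflects_iso c (δ.app ⟨op X.target⟩).functor
  rw [← hc]
  exact h.comp_map_iso c

end

section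

variable (hP_opn : I.opn ≤ P) {V V' : TriPseudofunctor.{v, u} e.FullSubcategory}
  {G G' : TriPseudofunctor.{v, u} (I.Pairs e)} (hV : V.IsPremotivic (P.inverseImage e.ι))
  (hV' : V'.IsPremotivic (P.inverseImage e.ι)) (hG : G.IsPremotivic (tilde P))
  (hGL : SatisfiesRhoLoc hI hE G) (hG' : G'.IsPremotivic (tilde P))
  (hGL' : SatisfiesRhoLoc hI hE G') {δ : V ⟶ precomp (ofBase hI) G}
  {δ' : V' ⟶ precomp (ofBase hI) G'} (hδ : IsPseudonaturalEquivalence δ)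
  (hδ' : IsPseudonaturalEquivalence δ') {θ : V ⟶ V'}
  (hθ : IsPremotivicTrans (P.inverseImage e.ι) θ)

include hP_opn hV hV' hG hGL hG' hGL' hδ hδ' hθ

/-- Objects annihilated by ρ^* δ are induced from the complement; `θ` preserves induced objects, and
ρ^* δ' annihilates them. -/
lemma exists_descent (X : LocallyDiscrete (I.Pairs e)ᵒᵖ) :
    ∃ m : G.obj X ⟶ G'.obj X,
      Nonempty ((precompTrans targetFunctor θ ≫ extension hI δ').app X ≅
        (extension hI δ).app X ≫ m) := by
  refine (reflective_extension hI hδ hGL X).exists_factorization_of_isZero _ fun K hK ↦ ?_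
  have h := universal_of_isZero_extension hI hδ hP_opn hV hG hGL X.as.unop K hK
  exact isZero_extension_of_universal hI hδ' hP_opn hG' hGL' X.as.unop
    (hθ.preservesUniversal hV hV' (j hE X.as.unop) (inverseImage_j hE hP_opn _) _ h)

/-- Premotivic transformations extend to the category of closed immersions. -/
lemma exists_extension_trans :
    ∃ β : G ⟶ G', IsPremotivicTrans (tilde P) β ∧
      Nonempty (δ ≫ precompTrans (ofBase hI) β ≅ θ ≫ δ') := by
  choose m hm using exists_descent hI hP_opn hV hV' hG hGL hG' hGL' hδ hδ' hθ
  let τ := precompTrans targetFunctor θ ≫ extension hI δ'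
  let L := extension hI δ
  have hL := reflective_extension hI hδ hGL
  let β := descent L hL τ m (fun b ↦ (hm b).some)
  let E : L ≫ β ≅ τ := descentRestrictionIso L hL τ m (fun b ↦ (hm b).some)
  have hτ : PreservesUniversal (tilde P) τ := by
    refine PreservesUniversal.comp ?_ (preservesUniversal_extension hI hδ' hG')
    exact fun X S f hf K T η h ↦ hθ.preservesUniversal hV hV' (targetFunctor.map f) hf.2 η h
  refine ⟨β, IsPremotivicTrans.of_reflective L hL (isPremotivic_precomp_target hI hV)
    (preservesUniversal_extension hI hδ hG) (hτ.of_iso E.symm) fun X ↦ ?_, ⟨?_⟩⟩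
  · let Y := X.as.unop
    have h₁ := hθ.c1 Y.target
    have h₂ := hδ'.isEquivalence Y.target
    have h₃ := hG'.b1 (rho hI Y)
    have h₄ : (τ.app X).functor.IsLeftAdjoint :=
      ((Adjunction.ofIsLeftAdjoint (θ.app ⟨op Y.target⟩).functor).comp
        ((Adjunction.ofIsLeftAdjoint (δ'.app ⟨op Y.target⟩).functor).comp
          (Adjunction.ofIsLeftAdjoint (G'.star (rho hI Y))))).isLeftAdjoint
    exact Functor.isLeftAdjoint_of_iso (functorIso (modificationIsoApp E.symm X))
  -- Restricting `E` to the base gives the required modification once the restrictions of ρ^* δ and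
  -- ρ^* δ' are identified with δ and δ'.
  · exact whiskerRightIso (comparisonExtensionIso hI δ).symm (precompTrans (ofBase hI) β) ≪≫
      α_ _ _ _ ≪≫ whiskerLeftIso (toPrecompPrecomp hI V) (precompTransIso (ofBase hI) E) ≪≫
      (α_ (toPrecompPrecomp hI V) (precompTrans (ofBase hI) (precompTrans targetFunctor θ))
        (precompTrans (ofBase hI) (extension hI δ'))).symm ≪≫
      whiskerRightIso (toPrecompPrecompCompIso hI θ) _ ≪≫ α_ _ _ _ ≪≫
      whiskerLeftIso θ (comparisonExtensionIso hI δ')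

end

/-- Transformations are determined by their restrictions to the base. -/
lemma nonempty_iso_of_restriction {V : TriPseudofunctor.{v, u} e.FullSubcategory}
    {G G' : TriPseudofunctor.{v, u} (I.Pairs e)} (hGL : SatisfiesRhoLoc hI hE G)
    {δ : V ⟶ precomp (ofBase hI) G} (hδ : IsPseudonaturalEquivalence δ) {β β' : G ⟶ G'}
    (m : δ ≫ precompTrans (ofBase hI) β ≅ δ ≫ precompTrans (ofBase hI) β') :
    Nonempty (β ≅ β') := by
  -- Naturality of `β` along the canonical morphisms moves it before ρ^*, so the composite involves
  -- only the restriction of `β` to the base.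
  let E (β : G ⟶ G') : extension hI δ ≫ β ≅
      precompTrans targetFunctor (δ ≫ precompTrans (ofBase hI) β) ≫ restrictRho hI G' :=
    α_ _ _ _ ≪≫ whiskerLeftIso _ (restrictUnitCompIso targetFunctor (ofBase hI) (rhoTrans hI) β) ≪≫
      (α_ (precompTrans targetFunctor δ)
        (precompTrans targetFunctor (precompTrans (ofBase hI) β)) (restrictRho hI G')).symm
  exact ⟨cancelIso _ (reflective_extension hI hδ hGL)
    (E β ≪≫ whiskerRightIso (precompTransIso targetFunctor m) _ ≪≫ (E β').symm)⟩

end ImmersionData.Pairs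

end

/-! ### Assembly of the theorem. -/

open ImmersionData TriPseudofunctor in
theorem mainTheorem8 {C : Type u₁} [Category.{v₁} C]
    (I : ImmersionData C) (hI : I.IsCategoryWithImmersions)
    (e : ObjectProperty C) (hE : I.IsBase e)
    (P : MorphismProperty C)
    (hP_iso : MorphismProperty.isomorphisms C ≤ P) (hP_comp : P.IsStableUnderComposition)
    (hP_baseChange : P.IsStableUnderBaseChange) (hP_opn : I.opn ≤ P) :
    (∀ V : TriPseudofunctor.{v, u} e.FullSubcategory,
      V.IsPremotivic (P.inverseImage e.ι) → (I.restrict e hE).SatisfiesLoc V →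
      ∃ G : TriPseudofunctor.{v, u} (I.Pairs e),
        G.IsPremotivic (Pairs.tilde P) ∧ (Pairs.immersions hI hE).SatisfiesLoc G ∧
        ∃ δ : V ⟶ precomp (Pairs.ofBase hI) G,
          IsPseudonaturalEquivalence δ ∧
          ∀ X : I.Pairs e, ∃ ι : (G.at' X).carrier ⥤ (V.at' X.target).carrier,
            ι.Full ∧ ι.Faithful ∧ Function.Injective ι.obj ∧
            Set.range ι.obj =
              {K | IsZero ((V.star (Pairs.complement hE X).hom).obj K)} ∧
            Nonempty ((δ.app ⟨Opposite.op X.target⟩).functor ⋙ G.star (X.rho hI) ⊣ ι)) ∧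
    (∀ (V V' : TriPseudofunctor.{v, u} e.FullSubcategory)
      (G G' : TriPseudofunctor.{v, u} (I.Pairs e)),
      V.IsPremotivic (P.inverseImage e.ι) → (I.restrict e hE).SatisfiesLoc V →
      V'.IsPremotivic (P.inverseImage e.ι) → (I.restrict e hE).SatisfiesLoc V' →
      G.IsPremotivic (Pairs.tilde P) → (Pairs.immersions hI hE).SatisfiesLoc G →
      G'.IsPremotivic (Pairs.tilde P) → (Pairs.immersions hI hE).SatisfiesLoc G' →
      ∀ (δ : V ⟶ precomp (Pairs.ofBase hI) G) (δ' : V' ⟶ precomp (Pairs.ofBase hI) G')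
        (θ : V ⟶ V'),
        IsPseudonaturalEquivalence δ → IsPseudonaturalEquivalence δ' →
        IsPremotivicTrans (P.inverseImage e.ι) θ →
        (∃ β : G ⟶ G', IsPremotivicTrans (Pairs.tilde P) β ∧
          Nonempty (δ ≫ precompTrans (Pairs.ofBase hI) β ≅ θ ≫ δ')) ∧
        ∀ β β' : G ⟶ G',
          IsPremotivicTrans (Pairs.tilde P) β →
          Nonempty (δ ≫ precompTrans (Pairs.ofBase hI) β ≅ θ ≫ δ') →
          IsPremotivicTrans (Pairs.tilde P) β' →
          Nonempty (δ ≫ precompTrans (Pairs.ofBase hI) β' ≅ θ ≫ δ') →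
          Nonempty (β ≅ β')) := by
  refine ⟨fun V hV hLoc ↦ ?_, fun V V' G G' hV _ hV' _ hG hGL hG' hGL' δ δ' θ hδ hδ' hθ ↦ ⟨?_, ?_⟩⟩
  · obtain ⟨G, L, hL⟩ := Pairs.exists_extension hI hE hP_opn hV
    exact ⟨G, hL.isPremotivic hI hV, (hL.satisfiesRhoLoc hI hP_opn hV hLoc).satisfiesLoc,
      Pairs.comparison hI L, hL.isPseudonaturalEquivalence_comparison hI hLoc,
      hL.exists_rightAdjoint hI⟩
  · exact Pairs.exists_extension_trans hI hP_opn hV hV' hG (Pairs.satisfiesRhoLoc hGL) hG'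
      (Pairs.satisfiesRhoLoc hGL') hδ hδ' hθ
  · rintro β β' - ⟨m⟩ - ⟨m'⟩
    exact Pairs.nonempty_iso_of_restriction hI (Pairs.satisfiesRhoLoc hGL) hδ (m ≪≫ m'.symm)
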